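/- **Setting (qCCS).** Let $qVar$ be a countably infinite set of quantum variables, each carrying a qubit, and let $\mathcal H_S$ be the state space of the variables in $S\subseteq qVar$, with computational basis the $0/1$-assignments to $S$ with finitely many $1$s; $\mathcal H=\mathcal H_{qVar}$. $\mathcal{SO}(\mathcal H_S)$ is the set of completely positive trace-preserving maps on the trace-class operators on $\mathcal H_S$; such a map acts on density operators on $\mathcal H$ by extension with the identity. Fix sets of classical channels $c$ and quantum channels $\mathsf c$, data expressions $e$ over the reals (variables, real constants and arbitrary operation symbols with a fixed interpretation), and boolean expressions $b$ built from comparisons of data expressions by $\neg,\wedge,\vee,\to$, true and false. Process terms, up to $\alpha$-conversion, are $$P::=\mathbf{nil}\mid\tau.P\mid c?x.P\mid c!e.P\mid\mathsf c?q.P\mid\mathsf c!q.P\mid\mathcal E[\tilde q].P\mid M[\tilde q;x].P\mid P+P\mid P\|P\mid P[f]\mid P\backslash L\mid\mathbf{if}\ b\ \mathbf{then}\ P\mid A(\tilde q;\tilde x),$$ where tuples $\tilde q$ consist of distinct variables (and are nonempty after $\mathcal E$ and $M$), $\mathcal E$ is a completely positive trace-preserving map and $M=\sum_i\lambda_iE^i$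 a projective measurement with simple spectrum on the qubits $\tilde q$, $f$ is a relabelling of channels respecting the two kinds, and $L$ is a set of channels. Here $c?x$ and $M[\tilde q;x]$ bind $x$, and $\mathsf c?q$ binds $q$; $qv(P)$ is the set of free quantum variables, with $qv(A(\tilde q;\tilde x))=\tilde q$. Terms are legal: $q\notin qv(P)$ in $\mathsf c!q.P$, and $qv(P)\cap qv(Q)=\emptyset$ in $P\|Q$. Each constant has a defining equation $A(\tilde q;\tilde x):=P_A$ with $P_A$ legal and its free variables among $\tilde q,\tilde x$. A *configuration* $\langle P,\rho\rangle$ is a legal process $P$ without free classical variables together with a density operator $\rho$ on $\mathcal H$. For $\mathcal C=\langle P,\rho\rangle$ put $qv(\mathcal C)=qv(P)$, $\mathrm{ptr}(\mathcal C)=\mathrm{tr}_{qv(P)}\rho$, $\mathcal C\|R=\langle P\|R,\rho\rangle$, and $\mathcal E(\mathcal C)=\langle P,\mathcal E(\rho)\rangle$ for $\mathcal E\in\mathcal{SO}(\mathcal H_{\overline{qv(P)}})$. **Transitions.** Actions are $\tau$, $c?v$, $c!v$ ($v\in\mathbb R$), $\mathsf c?r$, $\mathsf c!r$ ($r\in qVar$).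 The transitions $\mathcal C\xrightarrow{\alpha}\Delta$ from configurations to probability distributions over configurations are generated by the following rules, in which a configuration to the right of an arrow stands for its point distribution: * $\langle\tau.P,\rho\rangle\xrightarrow{\tau}\langle P,\rho\rangle$; $\langle c?x.P,\rho\rangle\xrightarrow{c?v}\langle P[v/x],\rho\rangle$ for all $v\in\mathbb R$; $\langle c!e.P,\rho\rangle\xrightarrow{c!v}\langle P,\rho\rangle$ where $v$ is the value of $e$. * $\langle\mathsf c?q.P,\rho\rangle\xrightarrow{\mathsf c?r}\langle P[r/q],\rho\rangle$ if $r\notin qv(\mathsf c?q.P)$; $\langle\mathsf c!q.P,\rho\rangle\xrightarrow{\mathsf c!q}\langle P,\rho\rangle$. * $\langle\mathcal E[\tilde q].P,\rho\rangle\xrightarrow{\tau}\langle P,\mathcal E_{\tilde q}(\rho)\rangle$; $\langle M[\tilde q;x].P,\rho\rangle\xrightarrow{\tau}\sum_ip_i\langle P[\lambda_i/x],E^i_{\tilde q}\rho E^i_{\tilde q}/p_i\rangle$, where $p_i=\mathrm{tr}(E^i_{\tilde q}\rho)$. * Communication (and its mirror image): if $\langle P_1,\rho\rangle\xrightarrow{a?u}\langle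 P_1',\rho\rangle$ and $\langle P_2,\rho\rangle\xrightarrow{a!u}\langle P_2',\rho\rangle$, with $a$ a channel of either kind, then $\langle P_1\|P_2,\rho\rangle\xrightarrow{\tau}\langle P_1'\|P_2',\rho\rangle$. * Interleaving (and its mirror image): if $\langle P_1,\rho\rangle\xrightarrow{\alpha}\Delta$, and $r\notin qv(P_2)$ in case $\alpha=\mathsf c?r$, then $\langle P_1\|P_2,\rho\rangle\xrightarrow{\alpha}\Delta\|P_2$. * If $\langle P,\rho\rangle\xrightarrow{\alpha}\Delta$, then $\langle P+Q,\rho\rangle\xrightarrow{\alpha}\Delta$ and $\langle Q+P,\rho\rangle\xrightarrow{\alpha}\Delta$; $\langle P[f],\rho\rangle\xrightarrow{f(\alpha)}\Delta[f]$; $\langle P\backslash L,\rho\rangle\xrightarrow{\alpha}\Delta\backslash L$ if the channel of $\alpha$ (if any) is not in $L$; $\langle\mathbf{if}\ b\ \mathbf{then}\ P,\rho\rangle\xrightarrow{\alpha}\Delta$ if $b$ is true. * If $\langle P_A[\tilde v/\tilde x,\tilde r/\tilde q],\rho\rangle\xrightarrow{\alpha}\Delta$, then $\langle A(\tilde r;\tilde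 v),\rho\rangle\xrightarrow{\alpha}\Delta$. For a relation $\mathcal R$ from states to distributions, $\mathcal R^\circ$ is the least relation between distributions containing $(\overline s,\Theta)$ whenever $s\,\mathcal R\,\Theta$ ($\overline s$ the point distribution) and closed under finite convex combinations; a relation between states is lifted by identifying its right-hand states with point distributions. Write $s\xrightarrow{\hat\tau}\Delta$ if $s\xrightarrow{\tau}\Delta$ or $\Delta=\overline s$. Let $\stackrel{\hat\tau}{\Rightarrow}$ be the reflexive transitive closure of $(\xrightarrow{\hat\tau})^\circ$, and for $\alpha\ne\tau$ let $\stackrel{\hat\alpha}{\Rightarrow}$ be the composite of $\stackrel{\hat\tau}{\Rightarrow}$, $(\xrightarrow{\alpha})^\circ$ and $\stackrel{\hat\tau}{\Rightarrow}$. **Open bisimilarity.** A relation $\mathcal R$ on configurations is an open simulation if $\mathcal C\,\mathcal R\,\mathcal D$ implies $qv(\mathcal C)=qv(\mathcal D)$, $\mathrm{ptr}(\mathcal C)=\mathrm{ptr}(\mathcal D)$ and, for every $\mathcal E\in\mathcal{SO}(\mathcal H_{\overline{qv(\mathcal C)}})$, whenever $\mathcal E(\mathcal C)\xrightarrow{\alpha}\Delta$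 there is $\Theta$ with $\mathcal E(\mathcal D)\stackrel{\hat\alpha}{\Rightarrow}\Theta$ and $\Delta\,\mathcal R^\circ\,\Theta$. It is an open bisimulation if $\mathcal R$ and $\mathcal R^{-1}$ are open simulations; $\approx_o$ is the largest open bisimulation. **Reduction barbed congruence.** Write $\mathcal C\Downarrow_c^{\ge p}$ if $\mathcal C\stackrel{\hat\tau}{\Rightarrow}\Delta$ for some $\Delta$ that gives probability at least $p$ to the configurations which have a transition $\xrightarrow{c!v}$ for some $v$. Then $\approx_r$ is the largest relation $\mathcal R$ on configurations such that $\mathcal C\,\mathcal R\,\mathcal D$ implies: 1. (barb-preserving) $\mathcal C\Downarrow_c^{\ge p}$ iff $\mathcal D\Downarrow_c^{\ge p}$, for all classical channels $c$ and all $p$; 2. (reduction-closed) whenever $\mathcal C\stackrel{\hat\tau}{\Rightarrow}\Delta$ there is $\Theta$ with $\mathcal D\stackrel{\hat\tau}{\Rightarrow}\Theta$ and $\Delta\,\mathcal R^\circ\,\Theta$, and whenever $\mathcal D\stackrel{\hat\tau}{\Rightarrow}\Theta$ there is $\Delta$ with $\mathcal C\stackrel{\hat\tau}{\Rightarrow}\Delta$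 and $\Delta\,\mathcal R^\circ\,\Theta$; 3. (compositional) $(\mathcal C\|R)\,\mathcal R\,(\mathcal D\|R)$ for every legal process $R$ without free classical variables such that $qv(R)$ is disjoint from $qv(\mathcal C)\cup qv(\mathcal D)$, and $\mathcal E(\mathcal C)\,\mathcal R\,\mathcal E(\mathcal D)$ for every $\mathcal E\in\mathcal{SO}(\mathcal H_{\overline{qv(\mathcal C)}})$; 4. $qv(\mathcal C)=qv(\mathcal D)$ and $\mathrm{ptr}(\mathcal C)=\mathrm{ptr}(\mathcal D)$. **Theorem (Soundness).** For all configurations $\mathcal C,\mathcal D$: if $\mathcal C\approx_o\mathcal D$, then $\mathcal C\approx_r\mathcal D$. -/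

import Mathlib

open scoped ComplexOrder

noncomputable section

namespace QCCS

/-! ## Operators, density operators and super-operators

Operators on the Hilbert space `ℓ²(I)` with orthonormal basis `I` are written as matrices indexed
by `I` (possibly infinite).  A matrix is a positive trace-class operator exactly when it is positive
semidefinite with summable diagonal. -/

/-- The trace-class operators on `ℓ²(I)`: the linear span of the positive trace-class operators.
For finite `I` these are all matrices. -/
def TraceClass (I : Type) : Submodule ℂ (Matrix I I ℂ) :=
  Submodule.span ℂ {A | A.PosSemidef ∧ Summable fun i => A i i}

/-- The trace of an operator. -/
def tr {I : Type} (A : Matrix I I ℂ) : ℂ := ∑' i, A i i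

/-- The operator on `ℓ²(I) ⊗ ℓ²(J)` whose block at `(j, j')` is `X j j'`, that is
`∑ X j j' ⊗ |j⟩⟨j'|`. -/
def ofBlocks {I J : Type} (X : J → J → Matrix I I ℂ) : Matrix (I × J) (I × J) ℂ :=
  fun p p' => X p.2 p'.2 p.1 p'.1

/-- Trace-preserving super-operators on `ℓ²(I)`: linear maps on trace-class operators which are
completely positive (positive, and so after trivial extension by any auxiliary space) and
preserve the trace. -/
structure SuperOp (I : Type) where
  map : TraceClass I →ₗ[ℂ] TraceClass I
  completely_positive : ∀ (J : Type) (X : J → J → TraceClass I),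
    (ofBlocks fun j j' => (X j j' : Matrix I I ℂ)).PosSemidef →
      (ofBlocks fun j j' => (map (X j j') : Matrix I I ℂ)).PosSemidef
  trace_preserving : ∀ A : TraceClass I, (A : Matrix I I ℂ).PosSemidef →
    tr (map A : Matrix I I ℂ) = tr (A : Matrix I I ℂ)

/-- Density operators on `ℓ²(I)`: positive operators of trace one. -/
@[ext]
structure Density (I : Type) where
  mat : Matrix I I ℂ
  posSemidef : mat.PosSemidef
  trace_one : HasSum (fun i => mat i i) 1

/-! ### Facts that make the operations on density operators well defined -/

/-- The sesquilinear form of a matrix on finitely supported vectors. -/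
def form {K : Type} (M : Matrix K K ℂ) (y z : K →₀ ℂ) : ℂ :=
  y.sum fun k a => z.sum fun k' b => star a * M k k' * b

theorem form_add_left {K : Type} (M : Matrix K K ℂ) (y y' z : K →₀ ℂ) :
    form M (y + y') z = form M y z + form M y' z := by
  unfold form
  rw [Finsupp.sum_add_index']
  · simp
  · intro k a b
    simp only [star_add, add_mul]
    exact Finsupp.sum_add

theorem form_smul_left {K : Type} (M : Matrix K K ℂ) (c : ℂ) (y z : K →₀ ℂ) :
    form M (c • y) z = star c * form M y z := by
  unfold form
  rw [Finsupp.sum_smul_index (by simp), Finsupp.mul_sum]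
  refine Finsupp.sum_congr fun k _ => ?_
  rw [Finsupp.mul_sum]
  refine Finsupp.sum_congr fun k' _ => ?_
  simp only [star_mul']; ring

theorem form_add_right {K : Type} (M : Matrix K K ℂ) (y z z' : K →₀ ℂ) :
    form M y (z + z') = form M y z + form M y z' := by
  unfold form
  rw [← Finsupp.sum_add]
  refine Finsupp.sum_congr fun k _ => ?_
  rw [Finsupp.sum_add_index'] <;> simp [mul_add]

theorem form_smul_right {K : Type} (M : Matrix K K ℂ) (c : ℂ) (y z : K →₀ ℂ) :
    form M y (c • z) = c * form M y z := by
  unfold form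
  rw [Finsupp.mul_sum]
  refine Finsupp.sum_congr fun k _ => ?_
  rw [Finsupp.sum_smul_index (by simp), Finsupp.mul_sum]
  refine Finsupp.sum_congr fun k' _ => ?_
  ring

theorem form_sum_left {K ι : Type} (M : Matrix K K ℂ) (s : Finset ι) (a : ι → ℂ)
    (f : ι → K →₀ ℂ) (z : K →₀ ℂ) :
    form M (∑ i ∈ s, a i • f i) z = ∑ i ∈ s, star (a i) * form M (f i) z := by
  classical
  induction s using Finset.induction_on with
  | empty => simp [form]
  | insert i s hi ih => rw [Finset.sum_insert hi, Finset.sum_insert hi, form_add_left,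
      form_smul_left, ih]

theorem form_sum_right {K ι : Type} (M : Matrix K K ℂ) (s : Finset ι) (a : ι → ℂ)
    (f : ι → K →₀ ℂ) (y : K →₀ ℂ) :
    form M y (∑ i ∈ s, a i • f i) = ∑ i ∈ s, a i * form M y (f i) := by
  classical
  induction s using Finset.induction_on with
  | empty => simp [form]
  | insert i s hi ih => rw [Finset.sum_insert hi, Finset.sum_insert hi, form_add_right,
      form_smul_right, ih]

theorem star_form {K : Type} {M : Matrix K K ℂ} (hM : M.IsHermitian) (y z : K →₀ ℂ) :
    star (form M y z) = form M z y := by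
  unfold form Finsupp.sum
  rw [star_sum]
  simp_rw [star_sum]
  rw [Finset.sum_comm]
  refine Finset.sum_congr rfl fun k _ => Finset.sum_congr rfl fun k' _ => ?_
  rw [← hM.apply k' k]
  simp only [star_mul', star_star]
  ring

/-- Compressing a positive semidefinite matrix along a family of vectors. -/
theorem posSemidef_compress {K L : Type} {M : Matrix K K ℂ} (hM : M.PosSemidef)
    (v : L → K →₀ ℂ) : Matrix.PosSemidef (fun l l' => form M (v l) (v l') : Matrix L L ℂ) := by
  refine ⟨?_, fun x => ?_⟩
  · ext l l'
    exact star_form hM.1 _ _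
  · have h := hM.2 (∑ l ∈ x.support, x l • v l)
    change 0 ≤ form M _ _ at h
    rw [form_sum_left] at h
    simp_rw [form_sum_right] at h
    unfold Finsupp.sum
    convert h using 2 with l _
    rw [Finset.mul_sum]
    refine Finset.sum_congr rfl fun l' _ => ?_
    ring

theorem form_single {K : Type} (M : Matrix K K ℂ) (k k' : K) (a b : ℂ) :
    form M (Finsupp.single k a) (Finsupp.single k' b) = star a * M k k' * b := by
  simp [form]

theorem norm_entry_le {K : Type} {M : Matrix K K ℂ} (hM : M.PosSemidef) (k k' : K) :
    ‖M k k'‖ ≤ ‖M k k‖ + ‖M k' k'‖ := by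
  have key : ∀ c : ℂ, ‖c‖ = 1 → 0 ≤ (M k k + c * M k k' + star (c * M k k') + M k' k').re := by
    intro c hc
    have hcc : star c * c = 1 := by
      have := Complex.conj_mul' c
      rw [hc] at this
      simpa using this
    have h := hM.2 (Finsupp.single k 1 + Finsupp.single k' c)
    change 0 ≤ form M _ _ at h
    rw [form_add_left, form_add_right, form_add_right] at h
    simp only [form_single, star_one, one_mul, mul_one] at h
    have h2 := (Complex.le_def.1 h).1
    have e : M k k + M k k' * c + (star c * M k' k + star c * M k' k' * c)
        = M k k + c * M k k' + star (c * M k k') + M k' k' := by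
      rw [star_mul', hM.1.apply k' k]
      linear_combination (M k' k') * hcc
    rw [e] at h2
    simpa using h2
  have hd : ∀ i, (M i i).re = ‖M i i‖ := fun i => by
    have := hM.diag_nonneg (i := i)
    rw [Complex.nonneg_iff] at this
    rw [← Complex.re_eq_norm.2 (Complex.nonneg_iff.2 this)]
  by_cases h0 : M k k' = 0
  · rw [h0, norm_zero]; positivity
  · have hn : (‖M k k'‖ : ℂ) ≠ 0 := by simpa using h0
    have := key (-(star (M k k') / ‖M k k'‖)) (by
      rw [norm_neg, norm_div, norm_star, Complex.norm_real, norm_norm]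
      exact div_self (by simpa using h0))
    have e : -(star (M k k') / ‖M k k'‖) * M k k' = -(‖M k k'‖ : ℂ) := by
      have := Complex.conj_mul' (M k k')
      change star (M k k') * M k k' = _ at this
      field_simp
      linear_combination (-1 : ℂ) * this
    rw [e] at this
    simp [hd] at this
    have := norm_nonneg (M k k)
    have := norm_nonneg (M k' k')
    linarith

/-- The block of an operator on `ℓ²(I) ⊗ ℓ²(J)` at `(j, j')`. -/
def blockOf {I J : Type} (M : Matrix (I × J) (I × J) ℂ) (j j' : J) : Matrix I I ℂ :=
  fun i i' => M (i, j) (i', j')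

theorem blockOf_mem {I J : Type} {M : Matrix (I × J) (I × J) ℂ} (hM : M.PosSemidef)
    (hs : Summable fun p => M p p) (j j' : J) : blockOf M j j' ∈ TraceClass I := by
  have hblk : ∀ a b : J, Summable fun i => M (i, a) (i, b) := by
    intro a b
    have ha : ∀ a : J, Summable fun i => ‖M (i, a) (i, a)‖ := fun a =>
      (hs.comp_injective (i := fun i : I => (i, a)) fun x y h => by simpa using h).norm
    exact Summable.of_norm_bounded ((ha a).add (ha b)) fun i => norm_entry_le hM _ _
  have key : ∀ c : ℂ, star c * c = 1 →
      blockOf M j j + c • blockOf M j j' + star c • blockOf M j' j + blockOf M j' j'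
        ∈ TraceClass I := by
    intro c hc
    refine Submodule.subset_span ⟨?_, ?_⟩
    · have h := posSemidef_compress hM
        (fun i : I => Finsupp.single (i, j) 1 + Finsupp.single (i, j') c)
      refine Eq.mp (congrArg Matrix.PosSemidef ?_) h
      symm
      ext i i'
      rw [form_add_left, form_add_right, form_add_right]
      simp only [form_single, star_one, one_mul, mul_one, blockOf, Matrix.add_apply,
        Matrix.smul_apply, smul_eq_mul]
      linear_combination (-(M (i, j') (i', j'))) * hc
    · simp only [blockOf, Matrix.add_apply, Matrix.smul_apply, smul_eq_mul]
      exact ((((hblk j j).add ((hblk j j').mul_left c)).add ((hblk j' j).mul_left _)).add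
        (hblk j' j'))
  have h1 := key 1 (by simp)
  have h2 := key (-1) (by simp)
  have h3 := key Complex.I (by simp)
  have h4 := key (-Complex.I) (by simp)
  have e : blockOf M j j' = (1 / 4 : ℂ) •
      ((blockOf M j j + (1 : ℂ) • blockOf M j j' + star (1 : ℂ) • blockOf M j' j
          + blockOf M j' j')
        - (blockOf M j j + (-1 : ℂ) • blockOf M j j' + star (-1 : ℂ) • blockOf M j' j
          + blockOf M j' j')
        - Complex.I • (blockOf M j j + Complex.I • blockOf M j j'
          + star Complex.I • blockOf M j' j + blockOf M j' j')
        + Complex.I • (blockOf M j j + (-Complex.I) • blockOf M j j'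
          + star (-Complex.I) • blockOf M j' j + blockOf M j' j')) := by
    ext i i'
    simp only [Matrix.smul_apply, Matrix.add_apply, Matrix.sub_apply, smul_eq_mul, star_one,
      star_neg, Complex.star_def, Complex.conj_I]
    linear_combination (-(1 / 2 : ℂ) * blockOf M j j' i i'
      + (1 / 2 : ℂ) * blockOf M j' j i i') * (- Complex.I_mul_I)
  rw [e]
  exact Submodule.smul_mem _ _ (Submodule.add_mem _ (Submodule.sub_mem _
    (Submodule.sub_mem _ h1 h2) (Submodule.smul_mem _ _ h3)) (Submodule.smul_mem _ _ h4))

theorem summable_diag {I : Type} (A : TraceClass I) :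
    Summable fun i => (A : Matrix I I ℂ) i i := by
  obtain ⟨A, hA⟩ := A
  induction hA using Submodule.span_induction with
  | mem x h => exact h.2
  | zero => simp
  | add x y _ _ hx hy => exact hx.add hy
  | smul a x _ hx => exact hx.mul_left a

/-- Nonnegative double series may be summed iteratively. -/
theorem hasSum_of_nonneg_iterated {I J : Type} {f : I × J → ℂ} (hf : ∀ p, 0 ≤ f p)
    {g : J → ℂ} (hg : ∀ j, HasSum (fun i => f (i, j)) (g j)) {a : ℂ} (ha : HasSum g a) :
    HasSum f a := by
  have hre : ∀ p, f p = ((f p).re : ℂ) := fun p => by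
    have := Complex.nonneg_iff.1 (hf p)
    exact Complex.ext (by simp) (by simp [← this.2])
  have hnn : ∀ p, 0 ≤ (f p).re := fun p => (Complex.nonneg_iff.1 (hf p)).1
  have hs : Summable fun p : J × I => (f p.swap).re := by
    rw [summable_prod_of_nonneg fun p => hnn _]
    refine ⟨fun j => ⟨_, Complex.hasSum_re (hg j)⟩, ?_⟩
    have : (fun j => ∑' i, (f (Prod.swap (j, i))).re) = fun j => (g j).re :=
      funext fun j => (Complex.hasSum_re (hg j)).tsum_eq
    rw [this]
    exact ⟨_, Complex.hasSum_re ha⟩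
  have hs' : Summable fun p : J × I => f p.swap := by
    have : (fun p : J × I => f p.swap) = fun p : J × I => (((f p.swap).re : ℝ) : ℂ) :=
      funext fun p => hre _
    rw [this]
    exact (Complex.hasSum_ofReal.2 hs.hasSum).summable
  have h1 := hs'.hasSum.prod_fiberwise fun j => hg j
  have h2 : HasSum (fun p : J × I => f p.swap) a := by
    have := hs'.hasSum
    rwa [h1.unique ha] at this
  exact (Equiv.prodComm J I).hasSum_iff.1 h2

/-- The operator seen through a factorisation of the basis. -/
def factored {K I J : Type} (e : K ≃ I × J) (ρ : Density K) : Matrix (I × J) (I × J) ℂ :=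
  ρ.mat.submatrix e.symm e.symm

theorem factored_posSemidef {K I J : Type} (e : K ≃ I × J) (ρ : Density K) :
    (factored e ρ).PosSemidef := ρ.posSemidef.submatrix _

theorem factored_hasSum {K I J : Type} (e : K ≃ I × J) (ρ : Density K) :
    HasSum (fun p => factored e ρ p p) 1 :=
  e.symm.hasSum_iff.2 ρ.trace_one

/-- The block at `(j, j')` of a density operator on `ℓ²(I) ⊗ ℓ²(J)`. -/
def Density.block {K I J : Type} (e : K ≃ I × J) (ρ : Density K) (j j' : J) : TraceClass I :=
  ⟨blockOf (factored e ρ) j j',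
    blockOf_mem (factored_posSemidef e ρ) (factored_hasSum e ρ).summable j j'⟩

/-- `(E ⊗ id)(ρ)` for a super-operator `E` on the factor `ℓ²(I)` of `ℓ²(K) ≅ ℓ²(I) ⊗ ℓ²(J)`. -/
def SuperOp.extend {K I J : Type} (e : K ≃ I × J) (E : SuperOp I) (ρ : Density K) :
    Density K where
  mat := (ofBlocks fun j j' => (E.map (ρ.block e j j') : Matrix I I ℂ)).submatrix e e
  posSemidef := (E.completely_positive J (ρ.block e) (factored_posSemidef e ρ)).submatrix _
  trace_one := by
    have hpos := E.completely_positive J (ρ.block e) (factored_posSemidef e ρ)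
    refine e.hasSum_iff (f := fun p =>
      (ofBlocks fun j j' => (E.map (ρ.block e j j') : Matrix I I ℂ)) p p).2 ?_
    refine hasSum_of_nonneg_iterated (g := fun j => tr (ρ.block e j j : Matrix I I ℂ))
      (fun p => hpos.diag_nonneg) (fun j => ?_) ?_
    · rw [← E.trace_preserving _ ((factored_posSemidef e ρ).submatrix fun i => (i, j))]
      exact (summable_diag (E.map (ρ.block e j j))).hasSum
    · have h := (Equiv.prodComm J I).hasSum_iff.2 (factored_hasSum e ρ)
      exact h.prod_fiberwise fun j => (summable_diag (ρ.block e j j)).hasSum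

/-! ## Qubits

The quantum variables are the natural numbers.  The computational basis of the state space of the
variables in a set consists of the finite subsets `b`, where `b` stands for the basis vector in which
exactly the qubits in `b` are `|1⟩` and all others are `|0⟩`. -/

/-- The quantum variables. -/
abbrev QVar := ℕ

/-- Density operators on the state space of all quantum variables. -/
abbrev QState := Density (Finset QVar)

/-- The computational basis of the space of all quantum variables outside `S`. -/
abbrev Env (S : Finset QVar) := {b : Finset QVar // Disjoint b S}

/-- The factorisation `H = H_{complement of S} ⊗ H_S`. -/
def splitEquiv (S : Finset QVar) : Finset QVar ≃ Env S × {b : Finset QVar // b ⊆ S} where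
  toFun b := (⟨b \ S, Finset.sdiff_disjoint⟩, ⟨b ∩ S, Finset.inter_subset_right⟩)
  invFun p := p.1.1 ∪ p.2.1
  left_inv b := Finset.sdiff_union_inter b S
  right_inv := by
    rintro ⟨⟨b, hb⟩, ⟨c, hc⟩⟩
    refine Prod.ext (Subtype.ext ?_) (Subtype.ext ?_)
    · ext x
      have := fun h : x ∈ b => Finset.disjoint_left.1 hb h
      have := fun h : x ∈ c => Finset.mem_of_subset hc h
      simp; tauto
    · ext x
      have := fun h : x ∈ b => Finset.disjoint_left.1 hb h
      have := fun h : x ∈ c => Finset.mem_of_subset hc h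
      simp; tauto

/-- The factorisation `H = H_{q₁,…,qₙ} ⊗ H_{rest}` for a tuple of distinct variables, where
`H_{q₁,…,qₙ}` is identified with the space of `n` qubits. -/
def tupleEquiv {n : ℕ} (q : Fin n ↪ QVar) :
    Finset QVar ≃ (Fin n → Bool) × Env (Finset.univ.map q) where
  toFun b := (fun i => decide (q i ∈ b), ⟨b \ Finset.univ.map q, Finset.sdiff_disjoint⟩)
  invFun p := ((Finset.univ.filter fun i => p.1 i = true).map q) ∪ p.2.1
  left_inv b := by
    ext x
    simp only [decide_eq_true_eq, Finset.mem_union, Finset.mem_map, Finset.mem_filter,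
      Finset.mem_univ, true_and, Finset.mem_sdiff]
    constructor
    · rintro (⟨i, hi, rfl⟩ | h)
      · exact hi
      · exact h.1
    · intro h
      by_cases hx : ∃ i, q i = x
      · obtain ⟨i, rfl⟩ := hx
        exact Or.inl ⟨i, h, rfl⟩
      · exact Or.inr ⟨h, hx⟩
  right_inv := by
    rintro ⟨x, ⟨c, hc⟩⟩
    have hc' : ∀ i, q i ∉ c := fun i hi => Finset.disjoint_left.1 hc hi (by simp)
    refine Prod.ext (funext fun i => ?_) (Subtype.ext ?_)
    · simp [hc' i]
    · ext y
      simp only [Finset.mem_sdiff, Finset.mem_union, Finset.mem_map, Finset.mem_filter,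
        Finset.mem_univ, true_and]
      constructor
      · rintro ⟨⟨i, -, rfl⟩ | h, h'⟩
        · exact absurd ⟨i, rfl⟩ h'
        · exact h
      · intro h
        refine ⟨Or.inr h, ?_⟩
        rintro ⟨i, rfl⟩
        exact hc' i h

/-- The partial trace of `ρ` over the variables in `S`, an operator on the space of the variables
outside `S`. -/
def ptr (S : Finset QVar) (ρ : QState) : Matrix (Env S) (Env S) ℂ :=
  fun c c' => ∑ s ∈ S.powerset, ρ.mat (c.1 ∪ s) (c'.1 ∪ s)

/-! ### Non-degenerate projective measurements -/

/-- A non-degenerate projective measurement on `n` qubits: a Hermitian operator whose eigenvalues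
(listed with multiplicity) are pairwise distinct. -/
structure Measurement (n : ℕ) where
  obs : Matrix (Fin n → Bool) (Fin n → Bool) ℂ
  hermitian : obs.IsHermitian
  nondegenerate : Function.Injective hermitian.eigenvalues

/-- The eigenvalue (measurement result) with index `i`. -/
def Measurement.value {n : ℕ} (M : Measurement n) (i : Fin n → Bool) : ℝ :=
  M.hermitian.eigenvalues i

/-- The projector onto the one-dimensional eigenspace of the eigenvalue with index `i`. -/
def Measurement.proj {n : ℕ} (M : Measurement n) (i : Fin n → Bool) :
    Matrix (Fin n → Bool) (Fin n → Bool) ℂ :=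
  Matrix.vecMulVec (M.hermitian.eigenvectorBasis i).ofLp
    (star (M.hermitian.eigenvectorBasis i).ofLp)

/-- The operator `(A ⊗ 1) ρ` for `A` acting on the factor `ℓ²(I)`. -/
def leftMul {K I J : Type} [Fintype I] (e : K ≃ I × J) (A : Matrix I I ℂ) (ρ : Density K) :
    Matrix K K ℂ :=
  (ofBlocks fun j j' => A * blockOf (factored e ρ) j j').submatrix e e

/-- The operator `(A ⊗ 1) ρ (A ⊗ 1)†` for `A` acting on the factor `ℓ²(I)`. -/
def sandwich {K I J : Type} [Fintype I] (e : K ≃ I × J) (A : Matrix I I ℂ) (ρ : Density K) :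
    Matrix K K ℂ :=
  (ofBlocks fun j j' => A * blockOf (factored e ρ) j j' * A.conjTranspose).submatrix e e

/-- The reduced state on a finite-dimensional factor. -/
def reduced {K I J : Type} (e : K ≃ I × J) (ρ : Density K) : Matrix I I ℂ :=
  fun x y => ∑' j, factored e ρ (x, j) (y, j)

theorem hasSum_reduced {K I J : Type} (e : K ≃ I × J) (ρ : Density K) (x y : I) :
    HasSum (fun j => factored e ρ (x, j) (y, j)) (reduced e ρ x y) := by
  have ha : ∀ x : I, Summable fun j => ‖factored e ρ (x, j) (x, j)‖ := fun x =>
    ((factored_hasSum e ρ).summable.comp_injective (i := fun j : J => (x, j))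
      fun a b h => by simpa using h).norm
  exact (Summable.of_norm_bounded ((ha x).add (ha y))
    fun j => norm_entry_le (factored_posSemidef e ρ) _ _).hasSum

theorem hasSum_prod_fintype {I J : Type} [Fintype I] {f : I × J → ℂ} {a : I → ℂ}
    (h : ∀ i, HasSum (fun j => f (i, j)) (a i)) : HasSum f (∑ i, a i) := by
  classical
  have h1 : ∀ i, HasSum (fun p : I × J => if p.1 = i then f p else 0) (a i) := by
    intro i
    have hinj : Function.Injective (fun j : J => (i, j)) := fun x y h => by simpa using h
    refine (hinj.hasSum_iff ?_).1 (by simpa [Function.comp_def] using h i)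
    rintro ⟨i', j⟩ hp
    by_cases hi : i' = i
    · subst hi
      exact absurd ⟨j, rfl⟩ hp
    · simp [hi]
  have h2 := hasSum_sum fun i (_ : i ∈ Finset.univ) => h1 i
  simpa using h2

theorem hasSum_leftMul {K I J : Type} [Fintype I] (e : K ≃ I × J) (A : Matrix I I ℂ)
    (ρ : Density K) : HasSum (fun k => leftMul e A ρ k k) (A * reduced e ρ).trace := by
  refine e.hasSum_iff (f := fun p =>
    (ofBlocks fun j j' => A * blockOf (factored e ρ) j j') p p).2 ?_
  refine hasSum_prod_fintype (a := fun i => (A * reduced e ρ) i i) fun i => ?_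
  simp only [ofBlocks, blockOf, Matrix.mul_apply]
  exact hasSum_sum fun x _ => (hasSum_reduced e ρ x i).mul_left (A i x)

theorem hasSum_sandwich {K I J : Type} [Fintype I] (e : K ≃ I × J) (A : Matrix I I ℂ)
    (ρ : Density K) :
    HasSum (fun k => sandwich e A ρ k k) (A * reduced e ρ * A.conjTranspose).trace := by
  refine e.hasSum_iff (f := fun p =>
    (ofBlocks fun j j' => A * blockOf (factored e ρ) j j' * A.conjTranspose) p p).2 ?_
  refine hasSum_prod_fintype
    (a := fun i => (A * reduced e ρ * A.conjTranspose) i i) fun i => ?_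
  simp only [ofBlocks, blockOf, Matrix.mul_apply]
  exact hasSum_sum fun y _ => (hasSum_sum fun x _ =>
    (hasSum_reduced e ρ x y).mul_left (A i x)).mul_right _

theorem sandwich_posSemidef {K I J : Type} [Fintype I] (e : K ≃ I × J) (A : Matrix I I ℂ)
    (ρ : Density K) : (sandwich e A ρ).PosSemidef := by
  refine Matrix.PosSemidef.submatrix (M := ofBlocks fun j j' =>
    A * blockOf (factored e ρ) j j' * A.conjTranspose) ?_ _
  have h := posSemidef_compress (factored_posSemidef e ρ)
    (fun p : I × J => ∑ x, star (A p.1 x) • Finsupp.single (x, p.2) (1 : ℂ))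
  refine Eq.mp (congrArg Matrix.PosSemidef ?_) h
  symm
  ext p p'
  rw [form_sum_left]
  simp only [form_sum_right, form_single, star_star, ofBlocks, Matrix.mul_apply, blockOf,
    Matrix.conjTranspose_apply, star_one, one_mul, mul_one]
  simp_rw [Finset.mul_sum, Finset.sum_mul]
  rw [Finset.sum_comm]
  refine Finset.sum_congr rfl fun x _ => Finset.sum_congr rfl fun y _ => ?_
  ring

theorem Measurement.proj_conjTranspose {n : ℕ} (M : Measurement n) (i : Fin n → Bool) :
    (M.proj i).conjTranspose = M.proj i := by
  simp [proj, Matrix.conjTranspose_vecMulVec]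

theorem Measurement.proj_mul_self {n : ℕ} (M : Measurement n) (i : Fin n → Bool) :
    M.proj i * M.proj i = M.proj i := by
  have h : star (M.hermitian.eigenvectorBasis i).ofLp ⬝ᵥ (M.hermitian.eigenvectorBasis i).ofLp
      = 1 := by
    have := (M.hermitian.eigenvectorBasis).inner_eq_one i
    rw [EuclideanSpace.inner_eq_star_dotProduct, dotProduct_comm] at this
    exact this
  rw [proj, Matrix.vecMulVec_mul_vecMulVec, h, one_smul]

theorem Measurement.sum_proj {n : ℕ} (M : Measurement n) : ∑ i, M.proj i = 1 := by
  have h := M.hermitian.eigenvectorUnitary.2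
  rw [Matrix.mem_unitaryGroup_iff] at h
  rw [← h]
  ext x y
  rw [Matrix.sum_apply, Matrix.mul_apply]
  refine Finset.sum_congr rfl fun i _ => ?_
  simp [proj, Matrix.vecMulVec_apply, Matrix.star_apply]

/-- The probability `tr(Eⁱ_q ρ)` of the outcome with index `i` when measuring the qubits `q`. -/
def Measurement.prob {n : ℕ} (M : Measurement n) (q : Fin n ↪ QVar) (ρ : QState)
    (i : Fin n → Bool) : ℝ :=
  (tr (leftMul (tupleEquiv q) (M.proj i) ρ)).re

theorem Measurement.hasSum_post {n : ℕ} (M : Measurement n) (q : Fin n ↪ QVar) (ρ : QState)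
    (i : Fin n → Bool) :
    HasSum (fun k => sandwich (tupleEquiv q) (M.proj i) ρ k k) (M.prob q ρ i : ℂ) := by
  have h1 := hasSum_leftMul (tupleEquiv q) (M.proj i) ρ
  have h2 := hasSum_sandwich (tupleEquiv q) (M.proj i) ρ
  rw [Matrix.trace_mul_comm, M.proj_conjTranspose, ← mul_assoc, M.proj_mul_self] at h2
  have hp : 0 ≤ (M.proj i * reduced (tupleEquiv q) ρ).trace :=
    h2.nonneg fun k => (sandwich_posSemidef _ _ _).diag_nonneg
  have e : (M.prob q ρ i : ℂ) = (M.proj i * reduced (tupleEquiv q) ρ).trace := by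
    rw [prob, tr, h1.tsum_eq]
    exact Complex.ext (by simp) (by simp [← (Complex.nonneg_iff.1 hp).2])
  rwa [e]

theorem Measurement.prob_nonneg {n : ℕ} (M : Measurement n) (q : Fin n ↪ QVar) (ρ : QState)
    (i : Fin n → Bool) : 0 ≤ M.prob q ρ i := by
  have h : (0 : ℂ) ≤ (M.prob q ρ i : ℂ) :=
    (M.hasSum_post q ρ i).nonneg fun k => (sandwich_posSemidef _ _ _).diag_nonneg
  simpa using (Complex.nonneg_iff.1 h).1

theorem Measurement.sum_prob {n : ℕ} (M : Measurement n) (q : Fin n ↪ QVar) (ρ : QState) :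
    ∑ i, M.prob q ρ i = 1 := by
  have h : ∀ i, M.prob q ρ i = ((M.proj i * reduced (tupleEquiv q) ρ).trace).re := fun i => by
    rw [prob, tr, (hasSum_leftMul (tupleEquiv q) (M.proj i) ρ).tsum_eq]
  simp_rw [h]
  rw [← Complex.re_sum, ← Matrix.trace_sum, ← Finset.sum_mul, M.sum_proj, one_mul]
  have h1 := hasSum_prod_fintype (f := fun p => factored (tupleEquiv q) ρ p p)
    fun i => hasSum_reduced (tupleEquiv q) ρ i i
  have h2 := h1.unique (factored_hasSum (tupleEquiv q) ρ)
  rw [Matrix.trace]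
  simp only [Matrix.diag_apply]
  rw [h2, Complex.one_re]

/-- The distribution of the index of the measurement outcome. -/
def Measurement.outcome {n : ℕ} (M : Measurement n) (q : Fin n ↪ QVar) (ρ : QState) :
    PMF (Fin n → Bool) :=
  PMF.ofFintype (fun i => ENNReal.ofReal (M.prob q ρ i)) (by
    rw [← ENNReal.ofReal_sum_of_nonneg fun i _ => M.prob_nonneg q ρ i, M.sum_prob,
      ENNReal.ofReal_one])

open Classical in
/-- The state `Eⁱ_q ρ Eⁱ_q / pᵢ` after the outcome with index `i` (when `pᵢ = 0` the outcome does
not occur, and the value is irrelevant). -/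
def Measurement.post {n : ℕ} (M : Measurement n) (q : Fin n ↪ QVar) (ρ : QState)
    (i : Fin n → Bool) : QState :=
  if h : M.prob q ρ i = 0 then ρ else
    { mat := ((M.prob q ρ i : ℂ)⁻¹) • sandwich (tupleEquiv q) (M.proj i) ρ
      posSemidef := (sandwich_posSemidef _ _ _).smul (by
        rw [← Complex.ofReal_inv]
        exact Complex.zero_le_real.2 (inv_nonneg.2 (M.prob_nonneg q ρ i)))
      trace_one := by
        have h1 := (M.hasSum_post q ρ i).mul_left ((M.prob q ρ i : ℂ)⁻¹)
        rwa [inv_mul_cancel₀ (by simpa using h)] at h1 }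

/-! ## Probabilistic labelled transition systems -/

/-- The lifting of a relation from states to distributions to a relation between distributions:
the least linear relation containing the point instances. -/
inductive Lift {St : Type} (R : St → PMF St → Prop) : PMF St → PMF St → Prop
  | point {s : St} {Θ : PMF St} : R s Θ → Lift R (PMF.pure s) Θ
  | linear {n : ℕ} (p : PMF (Fin n)) (Δ Θ : Fin n → PMF St) :
      (∀ i, Lift R (Δ i) (Θ i)) → Lift R (p.bind Δ) (p.bind Θ)

/-- The lifting of a relation between states to a relation between distributions. -/
def LiftState {St : Type} (R : St → St → Prop) : PMF St → PMF St → Prop :=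
  Lift fun s Θ => ∃ t, R s t ∧ Θ = PMF.pure t

theorem LiftState.mono {St : Type} {R R' : St → St → Prop} (h : ∀ s t, R s t → R' s t)
    {Δ Θ : PMF St} (hl : LiftState R Δ Θ) : LiftState R' Δ Θ := by
  unfold LiftState at *
  induction hl with
  | point hs =>
    obtain ⟨t, ht, rfl⟩ := hs
    exact Lift.point ⟨t, h _ _ ht, rfl⟩
  | linear p Δ Θ _ ih => exact Lift.linear p Δ Θ ih

/-! ## Syntax of qCCS -/

/-- The parameters of the language: classical and quantum channels, operation symbols of
the classical data expressions with their interpretation over the reals, and process constants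
`A(q₁,…,q_k; x₁,…,x_m)` with their arities. -/
structure Sig where
  CChan : Type
  QChan : Type
  Fn : ℕ → Type
  fnVal : ∀ {n : ℕ}, Fn n → (Fin n → ℝ) → ℝ
  Const : Type
  qArity : Const → ℕ
  cArity : Const → ℕ

/-- Data expressions over the reals in `m` classical variables. -/
inductive Exp (S : Sig) (m : ℕ) : Type
  | var : Fin m → Exp S m
  | val : ℝ → Exp S m
  | app {n : ℕ} : S.Fn n → (Fin n → Exp S m) → Exp S m

/-- The comparisons `>, <, ≥, ≤, =`. -/
inductive Cmp : Type
  | gt | lt | ge | le | eq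

/-- Boolean expressions in `m` classical variables. -/
inductive BExp (S : Sig) (m : ℕ) : Type
  | tt : BExp S m
  | ff : BExp S m
  | neg : BExp S m → BExp S m
  | conj : BExp S m → BExp S m → BExp S m
  | disj : BExp S m → BExp S m → BExp S m
  | imp : BExp S m → BExp S m → BExp S m
  | cmp : Cmp → Exp S m → Exp S m → BExp S m

/-- Substitution of variables or values for the classical variables. -/
def Exp.inst {S : Sig} {m m' : ℕ} (σ : Fin m → Fin m' ⊕ ℝ) : Exp S m → Exp S m'
  | .var i => Sum.elim Exp.var Exp.val (σ i)
  | .val v => .val v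
  | .app f a => .app f fun i => (a i).inst σ

def BExp.inst {S : Sig} {m m' : ℕ} (σ : Fin m → Fin m' ⊕ ℝ) : BExp S m → BExp S m'
  | .tt => .tt
  | .ff => .ff
  | .neg b => .neg (b.inst σ)
  | .conj b b' => .conj (b.inst σ) (b'.inst σ)
  | .disj b b' => .disj (b.inst σ) (b'.inst σ)
  | .imp b b' => .imp (b.inst σ) (b'.inst σ)
  | .cmp r e e' => .cmp r (e.inst σ) (e'.inst σ)

/-- The value of a closed data expression. -/
def Exp.eval {S : Sig} : Exp S 0 → ℝ
  | .var i => i.elim0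
  | .val v => v
  | .app f a => S.fnVal f fun i => (a i).eval

def Cmp.holds : Cmp → ℝ → ℝ → Prop
  | .gt, x, y => x > y
  | .lt, x, y => x < y
  | .ge, x, y => x ≥ y
  | .le, x, y => x ≤ y
  | .eq, x, y => x = y

/-- Truth of a closed boolean expression. -/
def BExp.holds {S : Sig} : BExp S 0 → Prop
  | .tt => True
  | .ff => False
  | .neg b => ¬ b.holds
  | .conj b b' => b.holds ∧ b'.holds
  | .disj b b' => b.holds ∨ b'.holds
  | .imp b b' => b.holds → b'.holds
  | .cmp r e e' => r.holds e.eval e'.eval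

/-- A relabelling function respects the two kinds of channels. -/
structure Relabel (S : Sig) where
  onC : S.CChan → S.CChan
  onQ : S.QChan → S.QChan

/-- Occurrences of quantum variables: a free variable (`Sum.inl`), or a variable bound by one of
the `k` enclosing binders (`Sum.inr`, de Bruijn index). -/
abbrev QName (k : ℕ) := QVar ⊕ Fin k

/-- Process terms up to `α`-conversion, with `m` classical and `k` quantum variables
bound in the context (de Bruijn indices; the innermost binder has index `0`).
`Proc S 0 0` is the type of closed processes. -/
inductive Proc (S : Sig) : ℕ → ℕ → Type
  /-- `nil` -/
  | nil {m k : ℕ} : Proc S m k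
  /-- `τ.P` -/
  | tau {m k : ℕ} : Proc S m k → Proc S m k
  /-- `c?x.P` -/
  | cin {m k : ℕ} : S.CChan → Proc S (m + 1) k → Proc S m k
  /-- `c!e.P` -/
  | cout {m k : ℕ} : S.CChan → Exp S m → Proc S m k → Proc S m k
  /-- `c?q.P` -/
  | qin {m k : ℕ} : S.QChan → Proc S m (k + 1) → Proc S m k
  /-- `c!q.P` -/
  | qout {m k : ℕ} : S.QChan → QName k → Proc S m k → Proc S m k
  /-- `E[q₁,…,qₙ].P` for a trace-preserving super-operator `E` on `n` qubits, `n ≥ 1` -/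
  | op {m k n : ℕ} : SuperOp (Fin (n + 1) → Bool) → (Fin (n + 1) → QName k) →
      Proc S m k → Proc S m k
  /-- `M[q₁,…,qₙ; x].P` for a non-degenerate projective measurement `M` on `n ≥ 1` qubits -/
  | meas {m k n : ℕ} : Measurement (n + 1) → (Fin (n + 1) → QName k) →
      Proc S (m + 1) k → Proc S m k
  /-- `P + Q` -/
  | sum {m k : ℕ} : Proc S m k → Proc S m k → Proc S m k
  /-- `P ‖ Q` -/
  | par {m k : ℕ} : Proc S m k → Proc S m k → Proc S m k
  /-- `P[f]` -/
  | rel {m k : ℕ} : Relabel S → Proc S m k → Proc S m k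
  /-- `P \ L` -/
  | res {m k : ℕ} : Set (S.CChan ⊕ S.QChan) → Proc S m k → Proc S m k
  /-- `if b then P` -/
  | cond {m k : ℕ} : BExp S m → Proc S m k → Proc S m k
  /-- `A(q₁,…; x₁,…)`, where each classical argument is a variable or (after substitution) a value -/
  | const {m k : ℕ} (A : S.Const) : (Fin (S.qArity A) → QName k) →
      (Fin (S.cArity A) → Fin m ⊕ ℝ) → Proc S m k

/-- A name of the context seen from under one more quantum binder. -/
def QName.weaken {k : ℕ} : QName k → QName (k + 1) := Sum.map id Fin.succ

theorem QName.weaken_injective {k : ℕ} : Function.Injective (QName.weaken (k := k)) :=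
  Sum.map_injective.2 ⟨Function.injective_id, Fin.succ_injective k⟩

/-- Substitution for the bound names of the context. -/
def QName.inst {k k' : ℕ} (θ : Fin k → QName k') : QName k → QName k' := Sum.elim Sum.inl θ

/-- Extension of a classical substitution under a binder. -/
def liftC {m m' : ℕ} (σ : Fin m → Fin m' ⊕ ℝ) : Fin (m + 1) → Fin (m' + 1) ⊕ ℝ :=
  Fin.cons (Sum.inl 0) fun i => Sum.map Fin.succ id (σ i)

/-- Extension of a quantum substitution under a binder. -/
def liftQ {k k' : ℕ} (θ : Fin k → QName k') : Fin (k + 1) → QName (k' + 1) :=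
  Fin.cons (Sum.inr 0) fun i => (θ i).weaken

/-- Simultaneous (capture-avoiding) substitution for the classical and quantum variables of the
context. -/
def Proc.inst {S : Sig} : {m k m' k' : ℕ} → (Fin m → Fin m' ⊕ ℝ) → (Fin k → QName k') →
    Proc S m k → Proc S m' k'
  | _, _, _, _, _, _, .nil => .nil
  | _, _, _, _, σ, θ, .tau P => .tau (P.inst σ θ)
  | _, _, _, _, σ, θ, .cin c P => .cin c (P.inst (liftC σ) θ)
  | _, _, _, _, σ, θ, .cout c e P => .cout c (e.inst σ) (P.inst σ θ)
  | _, _, _, _, σ, θ, .qin c P => .qin c (P.inst σ (liftQ θ))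
  | _, _, _, _, σ, θ, .qout c q P => .qout c (q.inst θ) (P.inst σ θ)
  | _, _, _, _, σ, θ, .op E q P => .op E (fun i => (q i).inst θ) (P.inst σ θ)
  | _, _, _, _, σ, θ, .meas M q P => .meas M (fun i => (q i).inst θ) (P.inst (liftC σ) θ)
  | _, _, _, _, σ, θ, .sum P Q => .sum (P.inst σ θ) (Q.inst σ θ)
  | _, _, _, _, σ, θ, .par P Q => .par (P.inst σ θ) (Q.inst σ θ)
  | _, _, _, _, σ, θ, .rel f P => .rel f (P.inst σ θ)
  | _, _, _, _, σ, θ, .res L P => .res L (P.inst σ θ)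
  | _, _, _, _, σ, θ, .cond b P => .cond (b.inst σ) (P.inst σ θ)
  | _, _, _, _, σ, θ, .const A q x =>
      .const A (fun i => (q i).inst θ) fun j => Sum.elim σ Sum.inr (x j)

/-- `P[v/x]` for the outermost classical variable of a process closed otherwise. -/
def Proc.substC {S : Sig} (P : Proc S 1 0) (v : ℝ) : Proc S 0 0 :=
  P.inst (fun _ => Sum.inr v) Fin.elim0

/-- `P[r/q]` for the outermost quantum variable. -/
def Proc.substQ {S : Sig} (P : Proc S 0 1) (r : QVar) : Proc S 0 0 :=
  P.inst Fin.elim0 fun _ => Sum.inl r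

/-- The free quantum variables of a term (including those bound in its context). -/
def Proc.names {S : Sig} : {m k : ℕ} → Proc S m k → Finset (QName k)
  | _, _, .nil => ∅
  | _, _, .tau P => P.names
  | _, _, .cin _ P => P.names
  | _, _, .cout _ _ P => P.names
  | _, _, .qin _ P => P.names.preimage QName.weaken QName.weaken_injective.injOn
  | _, _, .qout _ q P => P.names ∪ {q}
  | _, _, .op _ q P => P.names ∪ Finset.univ.image q
  | _, _, .meas _ q P => P.names ∪ Finset.univ.image q
  | _, _, .sum P Q => P.names ∪ Q.names
  | _, _, .par P Q => P.names ∪ Q.names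
  | _, _, .rel _ P => P.names
  | _, _, .res _ P => P.names
  | _, _, .cond _ P => P.names
  | _, _, .const _ q _ => Finset.univ.image q

/-- Legality: no quantum variable is used after being sent, parallel components share no quantum
variable, and every tuple of quantum variables consists of distinct variables. -/
def Proc.Legal {S : Sig} : {m k : ℕ} → Proc S m k → Prop
  | _, _, .nil => True
  | _, _, .tau P => P.Legal
  | _, _, .cin _ P => P.Legal
  | _, _, .cout _ _ P => P.Legal
  | _, _, .qin _ P => P.Legal
  | _, _, .qout _ q P => q ∉ P.names ∧ P.Legal
  | _, _, .op _ q P => Function.Injective q ∧ P.Legal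
  | _, _, .meas _ q P => Function.Injective q ∧ P.Legal
  | _, _, .sum P Q => P.Legal ∧ Q.Legal
  | _, _, .par P Q => Disjoint P.names Q.names ∧ P.Legal ∧ Q.Legal
  | _, _, .rel _ P => P.Legal
  | _, _, .res _ P => P.Legal
  | _, _, .cond _ P => P.Legal
  | _, _, .const _ q _ => Function.Injective q

/-- The set `qv(P)` of free quantum variables of a closed process. -/
def Proc.qv {S : Sig} (P : Proc S 0 0) : Finset QVar :=
  P.names.preimage Sum.inl Sum.inl_injective.injOn

/-- The defining equations `A(q₁,…; x₁,…) := P` of the process constants: `P` is a legal term whose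
free variables, classical and quantum, are among the parameters. -/
structure Program (S : Sig) where
  body : ∀ A : S.Const, Proc S (S.cArity A) (S.qArity A)
  legal : ∀ A, (body A).Legal
  names_subset : ∀ (A) (q : QVar), Sum.inl q ∉ (body A).names

/-! ## Operational semantics -/

/-- Actions. -/
inductive Act (S : Sig) : Type
  | tau : Act S
  | cin : S.CChan → ℝ → Act S
  | cout : S.CChan → ℝ → Act S
  | qin : S.QChan → QVar → Act S
  | qout : S.QChan → QVar → Act S

/-- The channel names in an action. -/
def Act.cn {S : Sig} : Act S → Set (S.CChan ⊕ S.QChan)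
  | .tau => ∅
  | .cin c _ => {Sum.inl c}
  | .cout c _ => {Sum.inl c}
  | .qin c _ => {Sum.inr c}
  | .qout c _ => {Sum.inr c}

/-- The quantum variables bound by an action: the one received by a quantum input. -/
def Act.qbv {S : Sig} : Act S → Finset QVar
  | .qin _ r => {r}
  | _ => ∅

/-- The action `f(α)`. -/
def Act.relabel {S : Sig} (f : Relabel S) : Act S → Act S
  | .tau => .tau
  | .cin c v => .cin (f.onC c) v
  | .cout c v => .cout (f.onC c) v
  | .qin c r => .qin (f.onQ c) r
  | .qout c r => .qout (f.onQ c) r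

/-- Pairs of a closed process and a state. The configurations are the legal ones. -/
structure Config (S : Sig) where
  proc : Proc S 0 0
  state : QState

def Config.Legal {S : Sig} (C : Config S) : Prop := C.proc.Legal

def Config.qv {S : Sig} (C : Config S) : Finset QVar := C.proc.qv

/-- `F(C)` for an operation `F` on processes that leaves the state alone. -/
def Config.mapProc {S : Sig} (F : Proc S 0 0 → Proc S 0 0) (C : Config S) : Config S :=
  ⟨F C.proc, C.state⟩

/-- `C ‖ R`. -/
def Config.par {S : Sig} (C : Config S) (R : Proc S 0 0) : Config S :=
  C.mapProc fun P => P.par R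

/-- `E(C)` for a super-operator `E` acting on the variables outside `T`. -/
def Config.applyOutside {S : Sig} (T : Finset QVar) (E : SuperOp (Env T)) (C : Config S) :
    Config S :=
  ⟨C.proc, E.extend (splitEquiv T) C.state⟩

/-- The transitions of the pLTS of qCCS. -/
inductive Step {S : Sig} (D : Program S) : Config S → Act S → PMF (Config S) → Prop
  | tau (P : Proc S 0 0) (ρ : QState) :
      Step D ⟨.tau P, ρ⟩ .tau (PMF.pure ⟨P, ρ⟩)
  | cin (c : S.CChan) (P : Proc S 1 0) (ρ : QState) (v : ℝ) :
      Step D ⟨.cin c P, ρ⟩ (.cin c v) (PMF.pure ⟨P.substC v, ρ⟩)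
  | cout (c : S.CChan) (e : Exp S 0) (P : Proc S 0 0) (ρ : QState) :
      Step D ⟨.cout c e P, ρ⟩ (.cout c e.eval) (PMF.pure ⟨P, ρ⟩)
  | ccomL {P₁ P₁' P₂ P₂' : Proc S 0 0} {ρ : QState} {c : S.CChan} {v : ℝ} :
      Step D ⟨P₁, ρ⟩ (.cin c v) (PMF.pure ⟨P₁', ρ⟩) →
      Step D ⟨P₂, ρ⟩ (.cout c v) (PMF.pure ⟨P₂', ρ⟩) →
      Step D ⟨.par P₁ P₂, ρ⟩ .tau (PMF.pure ⟨.par P₁' P₂', ρ⟩)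
  | ccomR {P₁ P₁' P₂ P₂' : Proc S 0 0} {ρ : QState} {c : S.CChan} {v : ℝ} :
      Step D ⟨P₁, ρ⟩ (.cout c v) (PMF.pure ⟨P₁', ρ⟩) →
      Step D ⟨P₂, ρ⟩ (.cin c v) (PMF.pure ⟨P₂', ρ⟩) →
      Step D ⟨.par P₁ P₂, ρ⟩ .tau (PMF.pure ⟨.par P₁' P₂', ρ⟩)
  | qin (c : S.QChan) (P : Proc S 0 1) (ρ : QState) (r : QVar) :
      r ∉ (Proc.qin c P).qv →
      Step D ⟨.qin c P, ρ⟩ (.qin c r) (PMF.pure ⟨P.substQ r, ρ⟩)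
  | qout (c : S.QChan) (q : QVar) (P : Proc S 0 0) (ρ : QState) :
      Step D ⟨.qout c (Sum.inl q) P, ρ⟩ (.qout c q) (PMF.pure ⟨P, ρ⟩)
  | qcomL {P₁ P₁' P₂ P₂' : Proc S 0 0} {ρ : QState} {c : S.QChan} {r : QVar} :
      Step D ⟨P₁, ρ⟩ (.qin c r) (PMF.pure ⟨P₁', ρ⟩) →
      Step D ⟨P₂, ρ⟩ (.qout c r) (PMF.pure ⟨P₂', ρ⟩) →
      Step D ⟨.par P₁ P₂, ρ⟩ .tau (PMF.pure ⟨.par P₁' P₂', ρ⟩)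
  | qcomR {P₁ P₁' P₂ P₂' : Proc S 0 0} {ρ : QState} {c : S.QChan} {r : QVar} :
      Step D ⟨P₁, ρ⟩ (.qout c r) (PMF.pure ⟨P₁', ρ⟩) →
      Step D ⟨P₂, ρ⟩ (.qin c r) (PMF.pure ⟨P₂', ρ⟩) →
      Step D ⟨.par P₁ P₂, ρ⟩ .tau (PMF.pure ⟨.par P₁' P₂', ρ⟩)
  | op {n : ℕ} (E : SuperOp (Fin (n + 1) → Bool)) (q : Fin (n + 1) ↪ QVar) (P : Proc S 0 0)
      (ρ : QState) :
      Step D ⟨.op E (fun i => Sum.inl (q i)) P, ρ⟩ .tau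
        (PMF.pure ⟨P, E.extend (tupleEquiv q) ρ⟩)
  | meas {n : ℕ} (M : Measurement (n + 1)) (q : Fin (n + 1) ↪ QVar) (P : Proc S 1 0)
      (ρ : QState) :
      Step D ⟨.meas M (fun i => Sum.inl (q i)) P, ρ⟩ .tau
        ((M.outcome q ρ).map fun i => ⟨P.substC (M.value i), M.post q ρ i⟩)
  | intL {P₁ P₂ : Proc S 0 0} {ρ : QState} {α : Act S} {Δ : PMF (Config S)} :
      Step D ⟨P₁, ρ⟩ α Δ → Disjoint α.qbv P₂.qv →
      Step D ⟨.par P₁ P₂, ρ⟩ α (Δ.map (Config.mapProc fun P => .par P P₂))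
  | intR {P₁ P₂ : Proc S 0 0} {ρ : QState} {α : Act S} {Δ : PMF (Config S)} :
      Step D ⟨P₂, ρ⟩ α Δ → Disjoint α.qbv P₁.qv →
      Step D ⟨.par P₁ P₂, ρ⟩ α (Δ.map (Config.mapProc fun P => .par P₁ P))
  | sumL {P₁ P₂ : Proc S 0 0} {ρ : QState} {α : Act S} {Δ : PMF (Config S)} :
      Step D ⟨P₁, ρ⟩ α Δ → Step D ⟨.sum P₁ P₂, ρ⟩ α Δ
  | sumR {P₁ P₂ : Proc S 0 0} {ρ : QState} {α : Act S} {Δ : PMF (Config S)} :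
      Step D ⟨P₂, ρ⟩ α Δ → Step D ⟨.sum P₁ P₂, ρ⟩ α Δ
  | rel {P : Proc S 0 0} {f : Relabel S} {ρ : QState} {α : Act S} {Δ : PMF (Config S)} :
      Step D ⟨P, ρ⟩ α Δ →
      Step D ⟨.rel f P, ρ⟩ (α.relabel f) (Δ.map (Config.mapProc fun P => .rel f P))
  | res {P : Proc S 0 0} {L : Set (S.CChan ⊕ S.QChan)} {ρ : QState} {α : Act S}
      {Δ : PMF (Config S)} :
      Step D ⟨P, ρ⟩ α Δ → Disjoint α.cn L →
      Step D ⟨.res L P, ρ⟩ α (Δ.map (Config.mapProc fun P => .res L P))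
  | cond {P : Proc S 0 0} {b : BExp S 0} {ρ : QState} {α : Act S} {Δ : PMF (Config S)} :
      Step D ⟨P, ρ⟩ α Δ → b.holds → Step D ⟨.cond b P, ρ⟩ α Δ
  | const (A : S.Const) (r : Fin (S.qArity A) → QVar) (v : Fin (S.cArity A) → ℝ) {ρ : QState}
      {α : Act S} {Δ : PMF (Config S)} :
      Step D ⟨(D.body A).inst (fun j => Sum.inr (v j)) (fun i => Sum.inl (r i)), ρ⟩ α Δ →
      Step D ⟨.const A (fun i => Sum.inl (r i)) (fun j => Sum.inr (v j)), ρ⟩ α Δ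

/-- `s --τ̂--> Δ`: a `τ`-step or no step. -/
def HatTau {S : Sig} (D : Program S) (s : Config S) (Δ : PMF (Config S)) : Prop :=
  Step D s .tau Δ ∨ Δ = PMF.pure s

/-- `Δ ==τ̂==> Θ`. -/
def WeakTau {S : Sig} (D : Program S) : PMF (Config S) → PMF (Config S) → Prop :=
  Relation.ReflTransGen (Lift (HatTau D))

/-- `Δ ==α̂==> Θ`. -/
def Weak {S : Sig} (D : Program S) : Act S → PMF (Config S) → PMF (Config S) → Prop
  | .tau, Δ, Θ => WeakTau D Δ Θ
  | α, Δ, Θ => ∃ Δ₁ Δ₂, WeakTau D Δ Δ₁ ∧ Lift (fun s => Step D s α) Δ₁ Δ₂ ∧ WeakTau D Δ₂ Θ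

/-! ## Open bisimilarity -/

/-- `R` relates configurations, i.e. legal pairs. -/
def OnConfigs {S : Sig} (R : Config S → Config S → Prop) : Prop :=
  ∀ C C', R C C' → C.Legal ∧ C'.Legal

/-- `qv(C) = qv(C')` and `ptr(C) = ptr(C')`. -/
def SameEnv {S : Sig} (C C' : Config S) : Prop :=
  C.qv = C'.qv ∧ ptr C.qv C.state = ptr C.qv C'.state

/-- (Weak) open simulations. -/
def IsOpenSimulation {S : Sig} (D : Program S) (R : Config S → Config S → Prop) : Prop :=
  ∀ C C', R C C' → SameEnv C C' ∧
    ∀ (E : SuperOp (Env C.qv)) (α : Act S) (Δ : PMF (Config S)),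
      Step D (C.applyOutside C.qv E) α Δ →
        ∃ Θ, Weak D α (PMF.pure (C'.applyOutside C.qv E)) Θ ∧ LiftState R Δ Θ

/-- (Weak) open bisimulations. -/
def IsOpenBisimulation {S : Sig} (D : Program S) (R : Config S → Config S → Prop) : Prop :=
  OnConfigs R ∧ IsOpenSimulation D R ∧ IsOpenSimulation D fun C C' => R C' C

/-- Open bisimilarity `≈ₒ`, the largest open bisimulation. -/
def OpenBisimilar {S : Sig} (D : Program S) (C C' : Config S) : Prop :=
  ∃ R, IsOpenBisimulation D R ∧ R C C'

theorem isGreatest_openBisimilar {S : Sig} (D : Program S) :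
    IsGreatest {R | IsOpenBisimulation D R} (OpenBisimilar D) := by
  refine ⟨⟨?_, ?_, ?_⟩, fun R hR C C' h => ⟨R, hR, h⟩⟩
  · rintro C C' ⟨R, hR, h⟩
    exact hR.1 C C' h
  · rintro C C' ⟨R, hR, h⟩
    refine ⟨(hR.2.1 C C' h).1, fun E α Δ hs => ?_⟩
    obtain ⟨Θ, h1, h2⟩ := (hR.2.1 C C' h).2 E α Δ hs
    exact ⟨Θ, h1, h2.mono fun s t hst => ⟨R, hR, hst⟩⟩
  · rintro C C' ⟨R, hR, h⟩
    refine ⟨(hR.2.2 C C' h).1, fun E α Δ hs => ?_⟩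
    obtain ⟨Θ, h1, h2⟩ := (hR.2.2 C C' h).2 E α Δ hs
    exact ⟨Θ, h1, h2.mono fun s t hst => ⟨R, hR, hst⟩⟩

/-! ## Reduction barbed congruence -/

open Classical in
/-- `V_c(Δ)`: the probability that the classical channel `c` is ready for output. -/
def barbValue {S : Sig} (D : Program S) (c : S.CChan) (Δ : PMF (Config S)) : ENNReal :=
  ∑' C, if ∃ v Θ, Step D C (.cout c v) Θ then Δ C else 0

/-- `C ⇓_c^{≥ p}`. -/
def Barb {S : Sig} (D : Program S) (C : Config S) (c : S.CChan) (p : ENNReal) : Prop :=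
  ∃ Δ, WeakTau D (PMF.pure C) Δ ∧ p ≤ barbValue D c Δ

def BarbPreserving {S : Sig} (D : Program S) (R : Config S → Config S → Prop) : Prop :=
  ∀ C C', R C C' → ∀ (c : S.CChan) (p : ENNReal), Barb D C c p ↔ Barb D C' c p

def ReductionClosed {S : Sig} (D : Program S) (R : Config S → Config S → Prop) : Prop :=
  ∀ C C', R C C' →
    (∀ Δ, WeakTau D (PMF.pure C) Δ → ∃ Θ, WeakTau D (PMF.pure C') Θ ∧ LiftState R Δ Θ) ∧
    (∀ Θ, WeakTau D (PMF.pure C') Θ → ∃ Δ, WeakTau D (PMF.pure C) Δ ∧ LiftState R Δ Θ)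

/-- Closure under application of super-operators to the variables outside `qv(C)`. -/
def SuperOpClosed {S : Sig} (R : Config S → Config S → Prop) : Prop :=
  ∀ C C', R C C' → ∀ E : SuperOp (Env C.qv),
    R (C.applyOutside C.qv E) (C'.applyOutside C.qv E)

def Compositional {S : Sig} (R : Config S → Config S → Prop) : Prop :=
  (∀ C C', R C C' → ∀ T : Proc S 0 0, T.Legal → Disjoint T.qv (C.qv ∪ C'.qv) →
    R (C.par T) (C'.par T)) ∧ SuperOpClosed R

/-- The requirements of which reduction barbed congruence is the largest solution. -/
def IsReductionBarbed {S : Sig} (D : Program S) (R : Config S → Config S → Prop) : Prop :=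
  OnConfigs R ∧ BarbPreserving D R ∧ ReductionClosed D R ∧ Compositional R ∧
    ∀ C C', R C C' → SameEnv C C'

/-- Reduction barbed congruence `≈ᵣ`. -/
def ReductionBarbedCongruent {S : Sig} (D : Program S) (C C' : Config S) : Prop :=
  ∃ R, IsReductionBarbed D R ∧ R C C'

theorem isGreatest_reductionBarbedCongruent {S : Sig} (D : Program S) :
    IsGreatest {R | IsReductionBarbed D R} (ReductionBarbedCongruent D) := by
  refine ⟨⟨?_, ?_, ?_, ⟨?_, ?_⟩, ?_⟩, fun R hR C C' h => ⟨R, hR, h⟩⟩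
  · rintro C C' ⟨R, hR, h⟩
    exact hR.1 C C' h
  · rintro C C' ⟨R, hR, h⟩
    exact hR.2.1 C C' h
  · rintro C C' ⟨R, hR, h⟩
    refine ⟨fun Δ hΔ => ?_, fun Θ hΘ => ?_⟩
    · obtain ⟨Θ, h1, h2⟩ := (hR.2.2.1 C C' h).1 Δ hΔ
      exact ⟨Θ, h1, h2.mono fun s t hst => ⟨R, hR, hst⟩⟩
    · obtain ⟨Δ, h1, h2⟩ := (hR.2.2.1 C C' h).2 Θ hΘ
      exact ⟨Δ, h1, h2.mono fun s t hst => ⟨R, hR, hst⟩⟩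
  · rintro C C' ⟨R, hR, h⟩ T hT hd
    exact ⟨R, hR, hR.2.2.2.1.1 C C' h T hT hd⟩
  · rintro C C' ⟨R, hR, h⟩ E
    exact ⟨R, hR, hR.2.2.2.1.2 C C' h E⟩
  · rintro C C' ⟨R, hR, h⟩
    exact hR.2.2.2.2 C C' h

end QCCS

end

/-! It suffices to show that `OpenBisimilar` itself satisfies all the requirements in
`IsReductionBarbed`. Most of them are soft. Simulation of single steps extends to distributions and
to weak transitions, which gives reduction closure; a barb is matched after some further τ-steps;
super-operators compose, which gives closure under them. The substance is closure under parallel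
composition with a process `T`.

A transition of `C ‖ T` comes from `C`, from `T`, or from a communication. Moves of `C` and
communications are matched by running the answer of `C'` next to `T`. If `T` applies a
super-operator, it acts outside `qv(C)`, and open bisimilarity allows for that. If `T` measures,
however, the state passes to one branch of the measurement, which is not a trace-preserving
operation, whereas open bisimilarity speaks only of trace-preserving ones.

The remedy is conditioning. Take an injection `v` of the variables that fixes `qv(C)` and misses
some variable. A trace-preserving isometric evolution of the environment moves its qubits along `v`
and records in the freed qubit whether outcome `i` occurred; that there are infinitely many
variables provides the room. The state after outcome `i` is then the normalised minor of the new
density matrix along `v`, which is the state conditioned on the freed qubit being `|0⟩`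
(`exists_condState_eq_post`).

It remains to see that conditioning preserves open bisimilarity (`CondBisimilar.openBisimilar`).
Transitions do not inspect the state: their effect is a function of the state that touches only
qubits of the process (`Step.exists_effect`). A move of the conditioned configuration is therefore
the conditioned form of a move of the original one, and the latter has a matching weak transition.
Conditioning that weak transition multiplies the weight of every branch by the probability of the
condition there; since this probability is preserved on average by every transition, the result is a
weak transition again (`Weak.cond`). Related configurations give the condition the same probability
because the partial trace determines it (`condProb_congr`).

Two adjustments are needed. A super-operator applied after conditioning is moved in front of it
(`extend_condState`), and if a quantum input may receive a variable that `v` moves, then `v` is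
first changed to fix that variable (`exists_fixes_insert`). -/

noncomputable section

namespace QCCS

/-! ## Conditioning of distributions -/

section Reweight

variable {α β γ : Type}

/-- The expectation of `w` under `p`. -/
def expect (p : PMF α) (w : α → ENNReal) : ENNReal := ∑' a, p a * w a

theorem expect_pure (a : α) (w : α → ENNReal) : expect (PMF.pure a) w = w a := by
  classical
  unfold expect
  rw [tsum_eq_single a (by intro b hb; rw [PMF.pure_apply_of_ne _ _ hb, zero_mul])]
  rw [PMF.pure_apply_self, one_mul]

theorem expect_bind (p : PMF α) (f : α → PMF β) (w : β → ENNReal) :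
    expect (p.bind f) w = expect p fun a => expect (f a) w := by
  unfold expect
  simp_rw [PMF.bind_apply, ← ENNReal.tsum_mul_right, ← ENNReal.tsum_mul_left]
  rw [ENNReal.tsum_comm]
  simp_rw [mul_assoc]

theorem expect_map (p : PMF α) (f : α → β) (w : β → ENNReal) :
    expect (p.map f) w = expect p (w ∘ f) := by
  rw [PMF.map, expect_bind]
  simp only [Function.comp_def, expect_pure]

theorem expect_congr {p : PMF α} {w w' : α → ENNReal} (h : ∀ a ∈ p.support, w a = w' a) :
    expect p w = expect p w' := by
  refine tsum_congr fun a => ?_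
  by_cases ha : p a = 0
  · rw [ha, zero_mul, zero_mul]
  · rw [h a ((p.mem_support_iff a).2 ha)]

theorem expect_mono {p : PMF α} {w w' : α → ENNReal} (h : ∀ a ∈ p.support, w a ≤ w' a) :
    expect p w ≤ expect p w' := by
  refine ENNReal.tsum_le_tsum fun a => ?_
  by_cases ha : p a = 0
  · rw [ha, zero_mul, zero_mul]
  · gcongr
    exact h a ((p.mem_support_iff a).2 ha)

theorem expect_const (p : PMF α) (c : ENNReal) : expect p (fun _ => c) = c := by
  unfold expect
  rw [ENNReal.tsum_mul_right, p.tsum_coe, one_mul]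

theorem expect_ne_top {p : PMF α} {w : α → ENNReal} (hw : ∀ a, w a ≤ 1) : expect p w ≠ ⊤ := by
  have h : expect p w ≤ expect p fun _ => 1 := expect_mono fun a _ => hw a
  rw [expect_const] at h
  exact ne_top_of_le_ne_top ENNReal.one_ne_top h

theorem expect_ne_zero_iff {p : PMF α} {w : α → ENNReal} :
    expect p w ≠ 0 ↔ ∃ a ∈ p.support, w a ≠ 0 := by
  simp [expect, ENNReal.tsum_eq_zero]

open Classical in
/-- The distribution with weights proportional to `p a * w a` (and `p` if this makes no sense). -/
def reweight (p : PMF α) (w : α → ENNReal) : PMF α :=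
  if h : expect p w ≠ 0 ∧ expect p w ≠ ⊤ then PMF.normalize (fun a => p a * w a) h.1 h.2 else p

theorem reweight_apply {p : PMF α} {w : α → ENNReal} (h0 : expect p w ≠ 0)
    (h1 : expect p w ≠ ⊤) (a : α) : reweight p w a = p a * w a * (expect p w)⁻¹ := by
  rw [reweight, dif_pos ⟨h0, h1⟩]
  exact PMF.normalize_apply h0 h1 a

theorem mem_support_reweight {p : PMF α} {w : α → ENNReal} (h0 : expect p w ≠ 0)
    (h1 : expect p w ≠ ⊤) (a : α) : a ∈ (reweight p w).support ↔ a ∈ p.support ∧ w a ≠ 0 := by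
  simp [PMF.mem_support_iff, reweight_apply h0 h1, h1]

theorem support_reweight_subset (p : PMF α) (w : α → ENNReal) :
    (reweight p w).support ⊆ p.support := by
  by_cases h : expect p w ≠ 0 ∧ expect p w ≠ ⊤
  · exact fun a ha => ((mem_support_reweight h.1 h.2 a).1 ha).1
  · rw [reweight, dif_neg h]

theorem reweight_pure (a : α) (w : α → ENNReal) : reweight (PMF.pure a) w = PMF.pure a := by
  classical
  by_cases h : expect (PMF.pure a) w ≠ 0 ∧ expect (PMF.pure a) w ≠ ⊤
  · ext b
    rw [reweight_apply h.1 h.2]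
    by_cases hb : b = a
    · subst hb
      rw [PMF.pure_apply_self, one_mul, expect_pure] at *
      exact ENNReal.mul_inv_cancel h.1 h.2
    · rw [PMF.pure_apply_of_ne _ _ hb, zero_mul, zero_mul]
  · rw [reweight, dif_neg h]

/-- Bayes' rule for mixtures: conditioning a mixture conditions each component and shifts the mixing
weights towards the components in which the condition is likely. -/
theorem reweight_bind {p : PMF α} {f : α → PMF β} {w : β → ENNReal} (hw : ∀ b, w b ≤ 1)
    (h0 : expect (p.bind f) w ≠ 0) :
    reweight (p.bind f) w
      = (reweight p fun a => expect (f a) w).bind fun a => reweight (f a) w := by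
  have h1 : expect (p.bind f) w ≠ ⊤ := expect_ne_top hw
  ext b
  rw [PMF.bind_apply, reweight_apply h0 h1, PMF.bind_apply]
  rw [expect_bind] at h0 h1 ⊢
  simp_rw [reweight_apply h0 h1]
  simp_rw [← ENNReal.tsum_mul_right]
  refine tsum_congr fun a => ?_
  -- Here `reweight (f a) w` has its default value, but the component `a` has weight zero on both
  -- sides.
  by_cases h : expect (f a) w = 0
  · have hb : f a b * w b = 0 := ENNReal.tsum_eq_zero.1 h b
    rw [h, mul_assoc (p a), hb]
    simp
  · rw [reweight_apply h (expect_ne_top hw)]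
    calc _ = p a * (f a b * w b) * (expect p fun a => expect (f a) w)⁻¹
          * (expect (f a) w * (expect (f a) w)⁻¹) := by
          rw [ENNReal.mul_inv_cancel h (expect_ne_top hw)]; ring
      _ = _ := by ring

theorem reweight_map {p : PMF α} {f : α → β} {w : β → ENNReal} (hw : ∀ b, w b ≤ 1)
    (h0 : expect (p.map f) w ≠ 0) : reweight (p.map f) w = (reweight p (w ∘ f)).map f := by
  rw [PMF.map, reweight_bind hw h0]
  simp only [Function.comp_def, expect_pure, reweight_pure]
  rfl

theorem reweight_congr {p : PMF α} {w w' : α → ENNReal} (h : ∀ a ∈ p.support, w a = w' a) :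
    reweight p w = reweight p w' := by
  have he := expect_congr h
  by_cases hp : expect p w ≠ 0 ∧ expect p w ≠ ⊤
  · ext a
    rw [reweight_apply hp.1 hp.2, reweight_apply (he ▸ hp.1) (he ▸ hp.2), he]
    by_cases ha : p a = 0
    · simp only [ha, zero_mul]
    · rw [h a ((p.mem_support_iff a).2 ha)]
  · rw [reweight, reweight, dif_neg hp, dif_neg (he ▸ hp)]

theorem bind_congr_support {p : PMF α} {f g : α → PMF β} (h : ∀ a ∈ p.support, f a = g a) :
    p.bind f = p.bind g := by
  ext b
  rw [PMF.bind_apply, PMF.bind_apply]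
  refine tsum_congr fun a => ?_
  by_cases ha : p a = 0
  · rw [ha, zero_mul, zero_mul]
  · rw [h a ((p.mem_support_iff a).2 ha)]

theorem map_congr_support {p : PMF α} {f g : α → β} (h : ∀ a ∈ p.support, f a = g a) :
    p.map f = p.map g :=
  bind_congr_support fun a ha => congrArg PMF.pure (h a ha)

open Classical in
/-- Disintegration of a distribution along a map. -/
theorem bind_reweight_fiber (p : PMF α) (f : α → β) :
    ((p.map f).bind fun b => reweight p fun a => if f a = b then 1 else 0) = p := by
  have he : ∀ b, expect p (fun a => if f a = b then 1 else 0) = p.map f b := by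
    intro b
    rw [PMF.map_apply]
    refine tsum_congr fun a => ?_
    simp [eq_comm]
  ext a
  rw [PMF.bind_apply, tsum_eq_single (f a)]
  · by_cases ha : p a = 0
    · have : reweight p (fun a' => if f a' = f a then 1 else 0) a = 0 := by
        by_contra h
        exact support_reweight_subset _ _ ((PMF.mem_support_iff _ _).2 h) ha
      rw [this, ha, mul_zero]
    · have h0 : p.map f (f a) ≠ 0 :=
        (PMF.mem_support_iff _ _).1 ((PMF.mem_support_map_iff _ _ _).2
          ⟨a, (p.mem_support_iff a).2 ha, rfl⟩)
      have h1 : p.map f (f a) ≠ ⊤ := PMF.apply_ne_top _ _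
      rw [reweight_apply (by rwa [he]) (by rwa [he]), he, if_pos rfl, mul_one, mul_comm,
        mul_assoc, ENNReal.inv_mul_cancel h0 h1, mul_one]
  · intro b hb
    by_cases h0 : p.map f b = 0
    · rw [h0, zero_mul]
    · rw [reweight_apply (by rwa [he]) (by rw [he]; exact PMF.apply_ne_top _ _), if_neg hb.symm]
      simp

/-- A finitely supported distribution is indexed by a finite type. -/
theorem exists_fin_map {p : PMF α} (hp : p.support.Finite) :
    ∃ (n : ℕ) (q : PMF (Fin n)) (g : Fin n → α), (∀ i, g i ∈ p.support) ∧ q.map g = p := by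
  classical
  have := hp.fintype
  let e := (Fintype.equivFin p.support).symm
  have hs : ∑ i, p (e i) = 1 := by
    rw [e.sum_comp fun a : p.support => p a, ← tsum_fintype (L := .unconditional _)]
    rw [← p.tsum_coe]
    exact tsum_subtype_eq_of_support_subset (f := fun a => p a) (s := p.support)
      fun a ha => (p.mem_support_iff a).2 ha
  refine ⟨_, PMF.ofFintype (fun i => p (e i)) hs, fun i => e i, fun i => (e i).2, ?_⟩
  ext a
  rw [PMF.map_apply]
  by_cases ha : a ∈ p.support
  · rw [tsum_eq_single (e.symm ⟨a, ha⟩)]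
    · simp
    · intro i hi
      rw [if_neg]
      rintro h
      refine hi ?_
      rw [Equiv.eq_symm_apply]
      exact Subtype.ext h.symm
  · rw [(p.apply_eq_zero_iff a).2 ha]
    refine ENNReal.tsum_eq_zero.2 fun i => if_neg ?_
    rintro rfl
    exact ha (e i).2

end Reweight

/-! ## Lifting -/

section Lifting

variable {St : Type} {X : Type}

theorem finite_support_bind {p : PMF X} {f : X → PMF St} (hp : p.support.Finite)
    (hf : ∀ x ∈ p.support, (f x).support.Finite) : (p.bind f).support.Finite := by
  rw [PMF.support_bind]
  exact hp.biUnion hf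

theorem finite_support_map {p : PMF X} (f : X → St) (hp : p.support.Finite) :
    (p.map f).support.Finite := by
  rw [PMF.support_map]
  exact hp.image f

theorem finite_support_pure (s : St) : (PMF.pure s).support.Finite := by
  rw [PMF.support_pure]
  exact Set.finite_singleton s

/-- The constructor `Lift.linear` only mixes over `Fin n`, so a mixture over another type is
reindexed by its finite support. This is why finiteness of supports is tracked throughout. -/
theorem Lift.bind {R : St → PMF St → Prop} {p : PMF X} (hp : p.support.Finite)
    {f g : X → PMF St} (h : ∀ x ∈ p.support, Lift R (f x) (g x)) :
    Lift R (p.bind f) (p.bind g) := by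
  obtain ⟨n, q, i, hi, rfl⟩ := exists_fin_map hp
  rw [PMF.bind_map, PMF.bind_map]
  exact Lift.linear q _ _ fun k => h _ (hi k)

/-- Lifted pairs are convex combinations of point instances. -/
theorem Lift.exists_coupling {R : St → PMF St → Prop} {Δ Θ : PMF St} (h : Lift R Δ Θ) :
    ∃ ω : PMF (St × PMF St), ω.support.Finite ∧ (∀ x ∈ ω.support, R x.1 x.2) ∧
      ω.map Prod.fst = Δ ∧ ω.bind Prod.snd = Θ := by
  induction h with
  | @point s Θ hs =>
    refine ⟨PMF.pure (s, Θ), finite_support_pure _, ?_, PMF.pure_map _ _, PMF.pure_bind _ _⟩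
    intro x hx
    rw [PMF.mem_support_pure_iff] at hx
    subst hx
    exact hs
  | linear p Δ Θ _ ih =>
    choose ω h1 h2 h3 h4 using ih
    refine ⟨p.bind ω, finite_support_bind (Set.toFinite _) fun i _ => h1 i, ?_, ?_, ?_⟩
    · intro x hx
      obtain ⟨i, _, hi⟩ := (PMF.mem_support_bind_iff _ _ _).1 hx
      exact h2 i x hi
    · rw [PMF.map_bind]
      simp only [h3]
    · rw [PMF.bind_bind]
      simp only [h4]

theorem LiftState.exists_coupling {R : St → St → Prop} {Δ Θ : PMF St} (h : LiftState R Δ Θ) :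
    ∃ ω : PMF (St × St), ω.support.Finite ∧ (∀ x ∈ ω.support, R x.1 x.2) ∧
      ω.map Prod.fst = Δ ∧ ω.map Prod.snd = Θ := by
  obtain ⟨ω, h1, h2, rfl, rfl⟩ := Lift.exists_coupling h
  have h2' : ∀ x : St × PMF St, ∃ t, x ∈ ω.support → R x.1 t ∧ x.2 = PMF.pure t := fun x => by
    by_cases hx : x ∈ ω.support
    · obtain ⟨t, ht⟩ := h2 x hx
      exact ⟨t, fun _ => ht⟩
    · exact ⟨x.1, fun h => absurd h hx⟩
  choose t ht using h2'
  refine ⟨ω.map fun x => (x.1, t x), finite_support_map _ h1, ?_, ?_, ?_⟩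
  · intro y hy
    obtain ⟨x, hx, rfl⟩ := (PMF.mem_support_map_iff _ _ _).1 hy
    exact (ht x hx).1
  · rw [PMF.map_comp]; rfl
  · rw [PMF.map_comp]
    exact bind_congr_support fun x hx => (ht x hx).2.symm

theorem LiftState.of_coupling {R : St → St → Prop} {ω : PMF X} (hf : ω.support.Finite)
    (f g : X → St) (h : ∀ x ∈ ω.support, R (f x) (g x)) : LiftState R (ω.map f) (ω.map g) :=
  Lift.bind hf fun x hx => Lift.point ⟨g x, h x hx, rfl⟩

/-- A coupling can be read in either direction, although `Lift` is generated asymmetrically. -/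
theorem LiftState.symm {R : St → St → Prop} {Δ Θ : PMF St} (h : LiftState R Δ Θ) :
    LiftState (fun s t => R t s) Θ Δ := by
  obtain ⟨ω, h1, h2, rfl, rfl⟩ := h.exists_coupling
  exact LiftState.of_coupling h1 _ _ h2

theorem Lift.finite_right {R : St → PMF St → Prop} (hR : ∀ s Θ, R s Θ → Θ.support.Finite)
    {Δ Θ : PMF St} (h : Lift R Δ Θ) : Θ.support.Finite := by
  obtain ⟨ω, h1, h2, _, rfl⟩ := h.exists_coupling
  exact finite_support_bind h1 fun x hx => hR _ _ (h2 x hx)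

theorem Lift.refl {R : St → PMF St → Prop} (hR : ∀ s, R s (PMF.pure s)) {Δ : PMF St}
    (h : Δ.support.Finite) : Lift R Δ Δ := by
  have := Lift.bind (R := R) h (f := PMF.pure) (g := PMF.pure) fun s _ => Lift.point (hR s)
  rwa [PMF.bind_pure] at this

/-- Transport of a lifted pair along maps of the states. -/
theorem Lift.map {St' : Type} {R : St → PMF St → Prop} {R' : St' → PMF St' → Prop} (f g : St → St')
    {Δ Θ : PMF St} (h : Lift R Δ Θ)
    (hR : ∀ s ∈ Δ.support, ∀ Ψ, R s Ψ → R' (f s) (Ψ.map g)) : Lift R' (Δ.map f) (Θ.map g) := by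
  obtain ⟨ω, h1, h2, rfl, rfl⟩ := h.exists_coupling
  rw [PMF.map_comp, PMF.map_bind]
  refine Lift.bind h1 fun x hx => Lift.point (hR _ ?_ _ (h2 x hx))
  exact (PMF.mem_support_map_iff _ _ _).2 ⟨x, hx, rfl⟩

/-- A lifted pair arises from choosing a convex combination of successors of every state. -/
theorem Lift.exists_kernel {R : St → PMF St → Prop} {Δ Θ : PMF St} (h : Lift R Δ Θ) :
    ∃ k : St → PMF St, Δ.bind k = Θ ∧ ∀ s ∈ Δ.support, Lift R (PMF.pure s) (k s) := by
  classical
  obtain ⟨ω, h1, h2, rfl, rfl⟩ := h.exists_coupling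
  -- The successor chosen at `s` is the average of the second components of `ω`, conditioned on the
  -- first component being `s`.
  refine ⟨fun s => (reweight ω fun x => if x.1 = s then 1 else 0).bind Prod.snd, ?_, ?_⟩
  · rw [← PMF.bind_bind, bind_reweight_fiber]
  · intro s hs
    obtain ⟨x, hx, rfl⟩ := (PMF.mem_support_map_iff _ _ _).1 hs
    set w : St × PMF St → ENNReal := fun y => if y.1 = x.1 then 1 else 0
    have h0 : expect ω w ≠ 0 := expect_ne_zero_iff.2 ⟨x, hx, by simp [w]⟩
    have ht : expect ω w ≠ ⊤ := expect_ne_top fun y => by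
      simp only [w]; split_ifs <;> simp
    have hm := mem_support_reweight h0 ht
    have e : PMF.pure x.1 = (reweight ω w).bind fun _ => PMF.pure x.1 :=
      (PMF.bind_const _ _).symm
    rw [e]
    refine Lift.bind (h1.subset (support_reweight_subset _ _)) fun y hy => Lift.point ?_
    obtain ⟨hy1, hy2⟩ := (hm y).1 hy
    have : y.1 = x.1 := by
      by_contra hne
      exact hy2 (if_neg hne)
    exact this ▸ h2 y hy1

/-- Conditioning a lifted pair. -/
theorem Lift.reweight {R R' : St → PMF St → Prop} {w : St → ENNReal} (hw : ∀ s, w s ≤ 1)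
    {c : St → St} {Δ Θ : PMF St} (h : Lift R Δ Θ)
    (h1 : ∀ s ∈ Δ.support, ∀ Ψ, R s Ψ → expect Ψ w = w s)
    (h2 : ∀ s ∈ Δ.support, ∀ Ψ, R s Ψ → w s ≠ 0 → R' (c s) ((QCCS.reweight Ψ w).map c)) :
    expect Θ w = expect Δ w ∧
      (expect Δ w ≠ 0 → Lift R' ((QCCS.reweight Δ w).map c) ((QCCS.reweight Θ w).map c)) := by
  obtain ⟨ω, hf, hR, rfl, rfl⟩ := h.exists_coupling
  have hs : ∀ x ∈ ω.support, x.1 ∈ (ω.map Prod.fst).support := fun x hx =>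
    (PMF.mem_support_map_iff _ _ _).2 ⟨x, hx, rfl⟩
  have hwe : ∀ x ∈ ω.support, expect x.2 w = (w ∘ Prod.fst) x := fun x hx =>
    h1 _ (hs x hx) _ (hR x hx)
  have he : expect (ω.bind Prod.snd) w = expect (ω.map Prod.fst) w := by
    rw [expect_bind, expect_map]
    exact expect_congr hwe
  refine ⟨he, fun h0 => ?_⟩
  -- By `h1` a pair in `ω` has the same weight whether it is read off the state or off its successor
  -- distribution. Both sides thus become mixtures over the same reweighted coupling.
  rw [reweight_map hw h0, reweight_bind hw (he ▸ h0), reweight_congr hwe, PMF.map_comp,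
    PMF.map_bind]
  have h0' : expect ω (w ∘ Prod.fst) ≠ 0 := by rwa [expect_map] at h0
  have ht : expect ω (w ∘ Prod.fst) ≠ ⊤ := expect_ne_top fun x => hw x.1
  refine Lift.bind (hf.subset (support_reweight_subset _ _)) fun x hx => Lift.point ?_
  obtain ⟨hx1, hx2⟩ := (mem_support_reweight h0' ht x).1 hx
  exact h2 _ (hs x hx1) _ (hR x hx1) hx2

end Lifting

/-! ## Weak transitions -/

section WeakTransitions

variable {St : Type} {X : Type}

theorem finite_of_reflTransGen {R : St → PMF St → Prop} (hR : ∀ s Θ, R s Θ → Θ.support.Finite)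
    {Δ Θ : PMF St} (h : Relation.ReflTransGen (Lift R) Δ Θ) (hΔ : Δ.support.Finite) :
    Θ.support.Finite := by
  induction h with
  | refl => exact hΔ
  | tail _ h _ => exact h.finite_right hR

/-- The components may need different numbers of steps, so they are moved one after another while
all the others idle, which `hr` permits. Since `p` has finite support, this takes finitely many
rounds. -/
theorem reflTransGen_bind {R : St → PMF St → Prop} (hR : ∀ s Θ, R s Θ → Θ.support.Finite)
    (hr : ∀ s, R s (PMF.pure s)) {p : PMF X} (hp : p.support.Finite) {f g : X → PMF St}
    (hf : ∀ x ∈ p.support, (f x).support.Finite)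
    (h : ∀ x ∈ p.support, Relation.ReflTransGen (Lift R) (f x) (g x)) :
    Relation.ReflTransGen (Lift R) (p.bind f) (p.bind g) := by
  classical
  have hg : ∀ x ∈ p.support, (g x).support.Finite := fun x hx =>
    finite_of_reflTransGen hR (h x hx) (hf x hx)
  have key : ∀ s : Finset X, ↑s ⊆ p.support → Relation.ReflTransGen (Lift R) (p.bind f)
      (p.bind fun x => if x ∈ s then g x else f x) := by
    intro s
    induction s using Finset.induction_on with
    | empty => intro _; simpa using Relation.ReflTransGen.refl
    | insert a s ha ih =>
      intro hs
      have has : a ∈ p.support := hs (by simp)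
      refine (ih fun x hx => hs (by simp [Finset.mem_coe.1 hx])).trans ?_
      let F : PMF St → PMF St := fun Ψ =>
        p.bind (Function.update (fun x => if x ∈ s then g x else f x) a Ψ)
      have e1 : (p.bind fun x => if x ∈ s then g x else f x) = F (f a) := by
        congr 1
        funext x
        by_cases hx : x = a
        · subst hx; simp [ha]
        · simp [hx]
      have e2 : (p.bind fun x => if x ∈ insert a s then g x else f x) = F (g a) := by
        congr 1
        funext x
        by_cases hx : x = a
        · subst hx; simp
        · simp [hx]
      rw [e1, e2]
      refine (h a has).lift F (fun Ψ Ψ' hΨ => ?_)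
      refine Lift.bind hp fun x hx => ?_
      by_cases hxa : x = a
      · subst hxa; simpa using hΨ
      · rw [Function.update_of_ne hxa, Function.update_of_ne hxa]
        refine Lift.refl hr ?_
        split_ifs
        exacts [hg x hx, hf x hx]
  have h1 := key hp.toFinset (by simp)
  have e : (p.bind fun x => if x ∈ hp.toFinset then g x else f x) = p.bind g :=
    bind_congr_support fun x hx => if_pos (hp.mem_toFinset.2 hx)
  rwa [e] at h1

/-- Simulation of single transitions extends to distributions. -/
theorem LiftState.simulate {R : St → St → Prop} {H : St → PMF St → Prop}
    {W : PMF St → PMF St → Prop}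
    (hW : ∀ {X : Type} (p : PMF X) (f g : X → PMF St), p.support.Finite →
      (∀ x ∈ p.support, (f x).support.Finite) → (∀ x ∈ p.support, W (f x) (g x)) →
      W (p.bind f) (p.bind g))
    (h : ∀ s t, R s t → ∀ Δ, H s Δ → ∃ Θ, W (PMF.pure t) Θ ∧ LiftState R Δ Θ)
    {Δ Δ' Θ : PMF St} (hl : LiftState R Δ Θ) (hH : Lift H Δ Δ') :
    ∃ Θ', W Θ Θ' ∧ LiftState R Δ' Θ' := by
  -- A lifted transition may let a single state follow a convex combination of its moves; each move
  -- is answered separately and the answers are mixed.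
  have key : ∀ s t, R s t → ∀ Ψ, Lift H (PMF.pure s) Ψ →
      ∃ Θ, W (PMF.pure t) Θ ∧ LiftState R Ψ Θ := by
    intro s t hst Ψ hΨ
    obtain ⟨ω, h1, h2, h3, rfl⟩ := hΨ.exists_coupling
    have : ∀ x : St × PMF St, ∃ Θ, x ∈ ω.support → W (PMF.pure t) Θ ∧ LiftState R x.2 Θ := by
      intro x
      by_cases hx : x ∈ ω.support
      · have hs : x.1 ∈ (PMF.pure s).support := by
          rw [← h3]
          exact (PMF.mem_support_map_iff _ _ _).2 ⟨x, hx, rfl⟩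
        rw [PMF.mem_support_pure_iff] at hs
        obtain ⟨Θ, hΘ⟩ := h s t hst x.2 (hs ▸ h2 x hx)
        exact ⟨Θ, fun _ => hΘ⟩
      · exact ⟨x.2, fun h => absurd h hx⟩
    choose k hk using this
    refine ⟨ω.bind k, ?_, Lift.bind h1 fun x hx => (hk x hx).2⟩
    have := hW ω (fun _ => PMF.pure t) k h1 (fun _ _ => finite_support_pure t)
      fun x hx => (hk x hx).1
    rwa [PMF.bind_const] at this
  obtain ⟨ω, h1, h2, rfl, rfl⟩ := hl.exists_coupling
  -- The relation `R` and the transition may decompose `Δ` differently. A kernel assigns successors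
  -- to states, so they can be distributed over the pairs of the coupling `ω`.
  obtain ⟨k, rfl, hk⟩ := hH.exists_kernel
  have : ∀ x : St × St, ∃ Θ, x ∈ ω.support → W (PMF.pure x.2) Θ ∧ LiftState R (k x.1) Θ := by
    intro x
    by_cases hx : x ∈ ω.support
    · obtain ⟨Θ, hΘ⟩ := key x.1 x.2 (h2 x hx) (k x.1)
        (hk x.1 ((PMF.mem_support_map_iff _ _ _).2 ⟨x, hx, rfl⟩))
      exact ⟨Θ, fun _ => hΘ⟩
    · exact ⟨PMF.pure x.1, fun h => absurd h hx⟩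
  choose m hm using this
  refine ⟨ω.bind m, hW ω _ m h1 (fun _ _ => finite_support_pure _) fun x hx => (hm x hx).1, ?_⟩
  rw [PMF.bind_map]
  exact Lift.bind h1 fun x hx => (hm x hx).2

end WeakTransitions

/-! ## Constructions of super-operators -/

section SuperOps

variable {I J K L M Z : Type}

theorem traceClass_of_posSemidef {A : Matrix K K ℂ} (hA : A.PosSemidef)
    (hs : Summable fun k => A k k) : A ∈ TraceClass K :=
  Submodule.subset_span ⟨hA, hs⟩

/-- Positivity is complete positivity with a one-dimensional auxiliary space. -/
theorem SuperOp.map_posSemidef (E : SuperOp K) {A : TraceClass K}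
    (hA : (A : Matrix K K ℂ).PosSemidef) : (E.map A : Matrix K K ℂ).PosSemidef :=
  (E.completely_positive Unit (fun _ _ => A) (hA.submatrix Prod.fst)).submatrix fun k => (k, ())

/-- The identity super-operator. -/
def SuperOp.id (K : Type) : SuperOp K where
  map := LinearMap.id
  completely_positive _ _ h := h
  trace_preserving _ _ := rfl

/-- The composite of two super-operators. -/
def SuperOp.comp (E F : SuperOp K) : SuperOp K where
  map := E.map ∘ₗ F.map
  completely_positive J X h :=
    E.completely_positive J (fun j j' => F.map (X j j')) (F.completely_positive J X h)
  trace_preserving A hA :=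
    (E.trace_preserving _ (F.map_posSemidef hA)).trans (F.trace_preserving A hA)

theorem SuperOp.extend_mat (e : K ≃ I × J) (E : SuperOp I) (ρ : Density K) (k k' : K) :
    (E.extend e ρ).mat k k'
      = (E.map (ρ.block e (e k).2 (e k').2) : Matrix I I ℂ) (e k).1 (e k').1 := rfl

theorem Density.block_apply (e : K ≃ I × J) (ρ : Density K) (j j' : J) (i i' : I) :
    (ρ.block e j j' : Matrix I I ℂ) i i' = ρ.mat (e.symm (i, j)) (e.symm (i', j')) := rfl

theorem SuperOp.id_extend (e : K ≃ I × J) (ρ : Density K) : (SuperOp.id I).extend e ρ = ρ := by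
  ext k k'
  rw [SuperOp.extend_mat]
  change (ρ.block e _ _ : Matrix I I ℂ) _ _ = _
  rw [Density.block_apply]
  simp

theorem SuperOp.block_extend (e : K ≃ I × J) (E : SuperOp I) (ρ : Density K) (j j' : J) :
    (E.extend e ρ).block e j j' = E.map (ρ.block e j j') := by
  ext i i'
  rw [Density.block_apply, SuperOp.extend_mat]
  simp

theorem SuperOp.comp_extend (e : K ≃ I × J) (E F : SuperOp I) (ρ : Density K) :
    (E.comp F).extend e ρ = E.extend e (F.extend e ρ) := by
  ext k k'
  rw [SuperOp.extend_mat, SuperOp.extend_mat, SuperOp.block_extend]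
  rfl

/-- Extensions of a super-operator along compatible factorisations, on states one of which is a
multiple of a minor of the other. -/
theorem SuperOp.extend_minor {K' : Type} (e : K ≃ I × J) (g : K' ≃ I × M) (φ : K → K') (ι : J → M)
    (hφ : ∀ k, g (φ k) = ((e k).1, ι (e k).2)) (E : SuperOp I) {ρ : Density K} {ρ' : Density K'}
    {c : ℂ} (h : ∀ k k', ρ.mat k k' = c * ρ'.mat (φ k) (φ k')) (k k' : K) :
    (E.extend e ρ).mat k k' = c * (E.extend g ρ').mat (φ k) (φ k') := by
  have hs : ∀ i j, g.symm (i, ι j) = φ (e.symm (i, j)) := fun i j => by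
    rw [Equiv.symm_apply_eq, hφ]
    simp
  -- The map `φ` changes only the coordinate on which `E` does not act, so the hypothesis passes to
  -- whole blocks and linearity of `E` finishes.
  have hb : ∀ j j', ρ.block e j j' = c • ρ'.block g (ι j) (ι j') := fun j j' => by
    ext i i'
    change (ρ.block e j j' : Matrix I I ℂ) i i' = c * (ρ'.block g _ _ : Matrix I I ℂ) i i'
    rw [Density.block_apply, Density.block_apply, h, hs, hs]
  rw [SuperOp.extend_mat, SuperOp.extend_mat, hφ, hφ, hb, map_smul]
  rfl

theorem SuperOp.extend_congr (e : K ≃ I × J) (g : K ≃ I × M) (ι : J → M)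
    (hφ : ∀ k, g k = ((e k).1, ι (e k).2)) (E : SuperOp I) (ρ : Density K) :
    E.extend e ρ = E.extend g ρ := by
  ext k k'
  rw [SuperOp.extend_minor e g (fun k => k) ι hφ E (c := 1) (ρ := ρ) (ρ' := ρ) (by simp), one_mul]

theorem minor_mem {A : Matrix K K ℂ} (hA : A ∈ TraceClass K) (e : K ≃ I × J) (j j' : J) :
    (fun i i' => A (e.symm (i, j)) (e.symm (i', j')) : Matrix I I ℂ) ∈ TraceClass I := by
  induction hA using Submodule.span_induction with
  | mem A h =>
    exact blockOf_mem (M := A.submatrix e.symm e.symm) (h.1.submatrix _)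
      (e.symm.summable_iff.2 h.2) j j'
  | zero => exact Submodule.zero_mem _
  | add A B _ _ hA hB => exact Submodule.add_mem _ hA hB
  | smul c A _ hA => exact Submodule.smul_mem _ c hA

/-- The blocks of a trace-class operator along a factorisation of the space. -/
def TraceClass.block (e : K ≃ I × J) (j j' : J) : TraceClass K →ₗ[ℂ] TraceClass I where
  toFun A := ⟨_, minor_mem A.2 e j j'⟩
  map_add' _ _ := rfl
  map_smul' _ _ := rfl

/-- The operator `(E ⊗ id)(A)`. -/
def SuperOp.amplMatrix (e : K ≃ I × J) (E : SuperOp I) (A : TraceClass K) : Matrix K K ℂ :=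
  (ofBlocks fun j j' => (E.map (TraceClass.block e j j' A) : Matrix I I ℂ)).submatrix e e

theorem SuperOp.amplMatrix_posSemidef (e : K ≃ I × J) (E : SuperOp I) {A : TraceClass K}
    (hA : (A : Matrix K K ℂ).PosSemidef) : (E.amplMatrix e A).PosSemidef :=
  (E.completely_positive J (fun j j' => TraceClass.block e j j' A)
    (hA.submatrix e.symm)).submatrix _

theorem SuperOp.amplMatrix_hasSum (e : K ≃ I × J) (E : SuperOp I) {A : TraceClass K}
    (hA : (A : Matrix K K ℂ).PosSemidef) :
    HasSum (fun k => E.amplMatrix e A k k) (tr (A : Matrix K K ℂ)) := by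
  have hpos := E.completely_positive J (fun j j' => TraceClass.block e j j' A)
    (hA.submatrix e.symm)
  refine e.hasSum_iff (f := fun p =>
    (ofBlocks fun j j' => (E.map (TraceClass.block e j j' A) : Matrix I I ℂ)) p p).2 ?_
  refine hasSum_of_nonneg_iterated
    (g := fun j => tr (TraceClass.block e j j A : Matrix I I ℂ))
    (fun p => hpos.diag_nonneg) (fun j => ?_) ?_
  · rw [← E.trace_preserving _ (hA.submatrix fun i => e.symm (i, j))]
    exact (summable_diag (E.map (TraceClass.block e j j A))).hasSum
  · have h := ((Equiv.prodComm J I).trans e.symm).hasSum_iff.2 (summable_diag A).hasSum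
    exact h.prod_fiberwise fun j => (summable_diag (TraceClass.block e j j A)).hasSum

/-- As `TraceClass` is a span, linearity reduces the claim to positive operators, where
`amplMatrix_hasSum` gives a summable diagonal. -/
theorem SuperOp.amplMatrix_mem (e : K ≃ I × J) (E : SuperOp I) (A : TraceClass K) :
    E.amplMatrix e A ∈ TraceClass K := by
  have hadd : ∀ A B : TraceClass K,
      E.amplMatrix e (A + B) = E.amplMatrix e A + E.amplMatrix e B := fun A B => by
    ext k k'; simp [amplMatrix, ofBlocks]
  have hsmul : ∀ (c : ℂ) (A : TraceClass K),
      E.amplMatrix e (c • A) = c • E.amplMatrix e A := fun c A => by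
    ext k k'; simp [amplMatrix, ofBlocks]
  obtain ⟨A, hA⟩ := A
  induction hA using Submodule.span_induction with
  | mem A h =>
    exact traceClass_of_posSemidef (E.amplMatrix_posSemidef e h.1)
      (E.amplMatrix_hasSum e h.1).summable
  | zero =>
    have := hsmul 0 0
    rw [zero_smul, zero_smul] at this
    rw [show (⟨0, _⟩ : TraceClass K) = 0 from rfl, this]
    exact Submodule.zero_mem _
  | add A B hA hB ihA ihB =>
    rw [show (⟨A + B, _⟩ : TraceClass K) = ⟨A, hA⟩ + ⟨B, hB⟩ from rfl, hadd]
    exact Submodule.add_mem _ ihA ihB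
  | smul c A hA ih =>
    rw [show (⟨c • A, _⟩ : TraceClass K) = c • ⟨A, hA⟩ from rfl, hsmul]
    exact Submodule.smul_mem _ c ih

/-- The super-operator `E ⊗ id`. -/
def SuperOp.ampl (e : K ≃ I × J) (E : SuperOp I) : SuperOp K where
  map :=
    { toFun := fun A => ⟨E.amplMatrix e A, E.amplMatrix_mem e A⟩
      map_add' := fun A B => by ext k k'; simp [amplMatrix, ofBlocks]
      map_smul' := fun c A => by ext k k'; simp [amplMatrix, ofBlocks] }
  completely_positive L X h :=
    (E.completely_positive (J × L) (fun p p' => TraceClass.block e p.1 p'.1 (X p.2 p'.2))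
      (h.submatrix fun p : I × (J × L) => (e.symm (p.1, p.2.1), p.2.2))).submatrix
      fun p : K × L => ((e p.1).1, ((e p.1).2, p.2))
  trace_preserving A hA := (E.amplMatrix_hasSum e hA).tsum_eq

/-- Associativity of `E ⊗ id ⊗ id`: a block of a block is a block of the combined factorisation. It
allows a super-operator to be viewed as acting on a larger part of the system. -/
theorem SuperOp.ampl_extend (e : K ≃ I × J) (e' : L ≃ K × M) (E : SuperOp I) (ρ : Density L) :
    (E.ampl e).extend e' ρ = E.extend
      ((e'.trans (e.prodCongr (Equiv.refl M))).trans (Equiv.prodAssoc I J M)) ρ := rfl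

/-! ### Super-operators given by isometries. -/

theorem form_add_mat (A B : Matrix K K ℂ) (y z : K →₀ ℂ) :
    form (A + B) y z = form A y z + form B y z := by
  simp only [form, Finsupp.sum, Matrix.add_apply, mul_add, add_mul, Finset.sum_add_distrib]

theorem form_smul_mat (c : ℂ) (A : Matrix K K ℂ) (y z : K →₀ ℂ) :
    form (c • A) y z = c * form A y z := by
  simp only [form, Finsupp.sum, Matrix.smul_apply, smul_eq_mul, Finset.mul_sum]
  refine Finset.sum_congr rfl fun k _ => Finset.sum_congr rfl fun k' _ => ?_
  ring

theorem form_mapDomain (A : Matrix L L ℂ) (f g : K → L) (y z : K →₀ ℂ) :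
    form A (y.mapDomain f) (z.mapDomain g) = form (fun k k' => A (f k) (g k')) y z := by
  unfold form
  rw [Finsupp.sum_mapDomain_index (by simp)
    (fun k a b => by simp only [star_add, add_mul]; exact Finsupp.sum_add)]
  refine Finsupp.sum_congr fun k _ => ?_
  rw [Finsupp.sum_mapDomain_index (by simp) (fun k a b => by simp only [mul_add])]

/-- The super-operator `A ↦ V A V†` for an isometry `V` with finitely supported rows. -/
def SuperOp.ofRows (v : K → K →₀ ℂ)
    (h : ∀ A : Matrix K K ℂ, A.PosSemidef → (Summable fun k => A k k) →
      HasSum (fun k => form A (v k) (v k)) (tr A)) : SuperOp K where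
  map :=
    { toFun := fun A => ⟨fun k k' => form (A : Matrix K K ℂ) (v k) (v k'), by
        obtain ⟨A, hA⟩ := A
        induction hA using Submodule.span_induction with
        | mem A hA =>
          exact traceClass_of_posSemidef (posSemidef_compress hA.1 v) (h A hA.1 hA.2).summable
        | zero =>
          refine cast (congrArg (fun B : Matrix K K ℂ => B ∈ TraceClass K) ?_)
            (Submodule.zero_mem (TraceClass K))
          ext k k'
          have := form_smul_mat 0 (0 : Matrix K K ℂ) (v k) (v k')
          simp only [zero_smul, zero_mul] at this
          exact this.symm
        | add A B _ _ hA hB =>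
          refine cast (congrArg (fun B : Matrix K K ℂ => B ∈ TraceClass K) ?_)
            (Submodule.add_mem _ hA hB)
          ext k k'
          exact (form_add_mat _ _ _ _).symm
        | smul c A _ hA =>
          refine cast (congrArg (fun B : Matrix K K ℂ => B ∈ TraceClass K) ?_)
            (Submodule.smul_mem _ c hA)
          ext k k'
          exact (form_smul_mat _ _ _ _).symm⟩
      map_add' := fun A B => Subtype.ext (by ext k k'; exact form_add_mat _ _ _ _)
      map_smul' := fun c A => Subtype.ext (by ext k k'; exact form_smul_mat _ _ _ _) }
  completely_positive J X hX := by
    have := posSemidef_compress hX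
      fun p : K × J => (v p.1).mapDomain fun k => (k, p.2)
    refine Eq.mp (congrArg Matrix.PosSemidef ?_) this
    ext p p'
    rw [form_mapDomain]
    rfl
  trace_preserving A hA := (h _ hA (summable_diag A)).tsum_eq

theorem SuperOp.ofRows_extend (v : K → K →₀ ℂ) (h) (e : L ≃ K × M) (ρ : Density L) (l l' : L) :
    ((SuperOp.ofRows v h).extend e ρ).mat l l'
      = form (ρ.block e (e l).2 (e l').2 : Matrix K K ℂ) (v (e l).1) (v (e l').1) := rfl

/-- The super-operator permuting the basis. -/
def SuperOp.perm (π : K ≃ K) : SuperOp K :=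
  SuperOp.ofRows (fun k => Finsupp.single (π k) 1) fun A _ hs => by
    simp only [form_single, star_one, one_mul, mul_one]
    exact π.hasSum_iff.2 hs.hasSum

theorem SuperOp.perm_extend (π : K ≃ K) (e : L ≃ K × M) (ρ : Density L) (l l' : L) :
    ((SuperOp.perm π).extend e ρ).mat l l'
      = ρ.mat (e.symm (π (e l).1, (e l).2)) (e.symm (π (e l').1, (e l').2)) := by
  rw [SuperOp.perm, SuperOp.ofRows_extend, form_single, Density.block_apply]
  simp

/-! ### A measurement that records its outcome -/

/-- The row of the operator `C ⊗ 1`. -/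
def kroneckerRow [Fintype I] (f : K ≃ I × J) (C : Matrix I I ℂ) (k : K) : K →₀ ℂ :=
  ∑ a, star (C (f k).1 a) • Finsupp.single (f.symm (a, (f k).2)) 1

/-- The coefficients in `kroneckerRow` are conjugated because `form` is conjugate-linear in its
first argument: the conjugations cancel on the left and produce the adjoint on the right. -/
theorem form_kroneckerRow [Fintype I] (f : K ≃ I × J) (A : Matrix K K ℂ) (C C' : Matrix I I ℂ)
    (k k' : K) : form A (kroneckerRow f C k) (kroneckerRow f C' k')
      = (C * blockOf (A.submatrix f.symm f.symm) (f k).2 (f k').2 * C'.conjTranspose)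
        (f k).1 (f k').1 := by
  rw [kroneckerRow, kroneckerRow, form_sum_left]
  simp only [form_sum_right, form_single, star_star, Matrix.mul_apply, blockOf,
    Matrix.submatrix_apply, Matrix.conjTranspose_apply, star_one, one_mul, mul_one]
  simp_rw [Finset.mul_sum, Finset.sum_mul]
  rw [Finset.sum_comm]
  refine Finset.sum_congr rfl fun x _ => Finset.sum_congr rfl fun y _ => ?_
  ring

/-- The partial trace over the second factor. -/
def partialTrace (f : K ≃ I × J) (A : Matrix K K ℂ) : Matrix I I ℂ :=
  fun x y => ∑' j, A (f.symm (x, j)) (f.symm (y, j))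

theorem hasSum_partialTrace (f : K ≃ I × J) {A : Matrix K K ℂ} (hA : A.PosSemidef)
    (hs : Summable fun k => A k k) (x y : I) :
    HasSum (fun j => A (f.symm (x, j)) (f.symm (y, j))) (partialTrace f A x y) := by
  have ha : ∀ x : I, Summable fun j => ‖A (f.symm (x, j)) (f.symm (x, j))‖ := fun x =>
    (hs.comp_injective (i := fun j : J => f.symm (x, j)) fun a b h => by simpa using h).norm
  exact (Summable.of_norm_bounded ((ha x).add (ha y)) fun j => norm_entry_le hA _ _).hasSum

theorem trace_partialTrace [Fintype I] (f : K ≃ I × J) {A : Matrix K K ℂ} (hA : A.PosSemidef)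
    (hs : Summable fun k => A k k) : (partialTrace f A).trace = tr A := by
  have h := hasSum_prod_fintype (f := fun p : I × J => A (f.symm p) (f.symm p))
    fun i => hasSum_partialTrace f hA hs i i
  exact h.unique (f.symm.hasSum_iff.2 hs.hasSum)

theorem hasSum_kroneckerRow [Fintype I] (f : K ≃ I × J) {A : Matrix K K ℂ} (hA : A.PosSemidef)
    (hs : Summable fun k => A k k) (C : Matrix I I ℂ) :
    HasSum (fun k => form A (kroneckerRow f C k) (kroneckerRow f C k))
      (C * partialTrace f A * C.conjTranspose).trace := by
  simp only [form_kroneckerRow]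
  refine f.hasSum_iff (f := fun p : I × J =>
    (C * blockOf (A.submatrix f.symm f.symm) p.2 p.2 * C.conjTranspose) p.1 p.1).2 ?_
  refine hasSum_prod_fintype
    (a := fun i => (C * partialTrace f A * C.conjTranspose) i i) fun i => ?_
  simp only [blockOf, Matrix.mul_apply]
  exact hasSum_sum fun y _ => (hasSum_sum fun x _ =>
    (hasSum_partialTrace f hA hs x y).mul_left (C i x)).mul_right _

open Classical in
/-- The Kraus operators of the binary measurement of a projection `P`. -/
def recordMatrix [DecidableEq I] (z₀ z₁ : Z) (P : Matrix I I ℂ) (z : Z) : Matrix I I ℂ :=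
  if z = z₀ then P else if z = z₁ then 1 - P else 0

/-- The rows of the isometry that writes `z₀` to a fresh register where the projection `P ⊗ 1`
applies, and `z₁` elsewhere. -/
def recordRow [Fintype I] [DecidableEq I] (f : K ≃ I × J) (g : K ≃ K × Z) (z₀ z₁ : Z) (P : Matrix I I ℂ) (k : K) :
    K →₀ ℂ :=
  kroneckerRow f (recordMatrix z₀ z₁ P (g k).2) (g k).1

/-- The only nonzero Kraus operators are the complementary projections `P` and `1 - P`; by cyclicity
of the trace, idempotence leaves `P + (1 - P) = 1`. Register values other than `z₀` and `z₁`
contribute nothing. -/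
theorem hasSum_recordMatrix [Fintype I] [DecidableEq I] {z₀ z₁ : Z} (hz : z₁ ≠ z₀)
    {P : Matrix I I ℂ} (h1 : P.conjTranspose = P) (h2 : P * P = P) (R : Matrix I I ℂ) :
    HasSum (fun z => (recordMatrix z₀ z₁ P z * R * (recordMatrix z₀ z₁ P z).conjTranspose).trace)
      R.trace := by
  classical
  have e0 : recordMatrix z₀ z₁ P z₀ = P := if_pos rfl
  have e1 : recordMatrix z₀ z₁ P z₁ = 1 - P := by simp [recordMatrix, hz]
  have h3 : (1 - P) * (1 - P) = 1 - P := by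
    rw [sub_mul, mul_sub, mul_sub, h2]; simp
  have h4 : R.trace = ∑ z ∈ {z₀, z₁},
      (recordMatrix z₀ z₁ P z * R * (recordMatrix z₀ z₁ P z).conjTranspose).trace := by
    rw [Finset.sum_pair hz.symm, e0, e1, Matrix.conjTranspose_sub, Matrix.conjTranspose_one, h1,
      Matrix.trace_mul_comm, ← mul_assoc, h2, Matrix.trace_mul_comm (_ * _) (1 - P),
      ← mul_assoc, h3, ← Matrix.trace_add, ← add_mul, add_sub_cancel, one_mul]
  rw [h4]
  refine hasSum_sum_of_ne_finset_zero fun z hz => ?_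
  simp only [Finset.mem_insert, Finset.mem_singleton, not_or] at hz
  simp [recordMatrix, hz.1, hz.2]

/-- The terms are nonnegative, so the sum over `K` may be taken first. It depends only on the
partial trace over the untouched factor, which reduces trace preservation to the finite-dimensional
identity `hC`. -/
theorem hasSum_kroneckerRow_prod [Fintype I] (f : K ≃ I × J) (C : Z → Matrix I I ℂ)
    (hC : ∀ R : Matrix I I ℂ, HasSum (fun z => (C z * R * (C z).conjTranspose).trace) R.trace)
    (A : Matrix K K ℂ) (hA : A.PosSemidef) (hs : Summable fun k => A k k) :
    HasSum (fun p : K × Z => form A (kroneckerRow f (C p.2) p.1) (kroneckerRow f (C p.2) p.1))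
      (tr A) := by
  have hpos : ∀ p : K × Z,
      0 ≤ form A (kroneckerRow f (C p.2) p.1) (kroneckerRow f (C p.2) p.1) := fun p =>
    (posSemidef_compress hA fun p : K × Z => kroneckerRow f (C p.2) p.1).diag_nonneg (i := p)
  have hg : ∀ z, HasSum (fun k => form A (kroneckerRow f (C (k, z).2) (k, z).1)
      (kroneckerRow f (C (k, z).2) (k, z).1))
      (C z * partialTrace f A * (C z).conjTranspose).trace := fun z =>
    hasSum_kroneckerRow f hA hs (C z)
  have ht := hC (partialTrace f A)
  rw [trace_partialTrace f hA hs] at ht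
  exact hasSum_of_nonneg_iterated hpos hg ht

theorem hasSum_recordRow [Fintype I] [DecidableEq I] (f : K ≃ I × J) (g : K ≃ K × Z) {z₀ z₁ : Z}
    (hz : z₁ ≠ z₀) {P : Matrix I I ℂ} (h1 : P.conjTranspose = P) (h2 : P * P = P)
    (A : Matrix K K ℂ) (hA : A.PosSemidef) (hs : Summable fun k => A k k) :
    HasSum (fun k => form A (recordRow f g z₀ z₁ P k) (recordRow f g z₀ z₁ P k)) (tr A) := by
  have h := hasSum_kroneckerRow_prod f (recordMatrix z₀ z₁ P) (hasSum_recordMatrix hz h1 h2) A hA hs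
  simp only [recordRow]
  exact (g.hasSum_iff (f := fun p : K × Z => form A (kroneckerRow f (recordMatrix z₀ z₁ P p.2) p.1)
    (kroneckerRow f (recordMatrix z₀ z₁ P p.2) p.1))).2 h

/-- The isometric evolution that performs a binary projective measurement and records the
outcome. -/
def SuperOp.record [Fintype I] [DecidableEq I] (f : K ≃ I × J) (g : K ≃ K × Z) {z₀ z₁ : Z} (hz : z₁ ≠ z₀)
    {P : Matrix I I ℂ} (h1 : P.conjTranspose = P) (h2 : P * P = P) : SuperOp K :=
  SuperOp.ofRows (recordRow f g z₀ z₁ P) (hasSum_recordRow f g hz h1 h2)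

/-- At entries whose register reads `z₀` on both sides, the Kraus operator is `P`, so the evolved
state shows the unnormalised state after the outcome `P`. -/
theorem SuperOp.record_extend [Fintype I] [DecidableEq I] (f : K ≃ I × J) (g : K ≃ K × Z) {z₀ z₁ : Z} (hz : z₁ ≠ z₀)
    {P : Matrix I I ℂ} (h1 : P.conjTranspose = P) (h2 : P * P = P) (e : L ≃ K × M)
    (ρ : Density L) {l l' : L} {x x' : K} (hl : g (e l).1 = (x, z₀)) (hl' : g (e l').1 = (x', z₀)) :
    ((SuperOp.record f g hz h1 h2).extend e ρ).mat l l' = (P * blockOf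
      ((ρ.block e (e l).2 (e l').2 : Matrix K K ℂ).submatrix f.symm f.symm) (f x).2 (f x').2 * P)
        (f x).1 (f x').1 := by
  rw [SuperOp.record, SuperOp.ofRows_extend, recordRow, recordRow, hl, hl', recordMatrix, if_pos rfl,
    form_kroneckerRow, h1]

end SuperOps

/-! ## Conditioning on the state of the environment -/

section Conditioning

/-- The probability that the qubits outside the range of `v` are all in state `|0⟩`. -/
def condProb (v : QVar ↪ QVar) (ρ : QState) : ℝ := ∑' k : Finset QVar, (ρ.mat (k.map v) (k.map v)).re

theorem summable_minor (v : QVar ↪ QVar) (ρ : QState) :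
    Summable fun k : Finset QVar => ρ.mat (k.map v) (k.map v) :=
  ρ.trace_one.summable.comp_injective (Finset.map_injective v)

theorem diag_eq_ofReal (ρ : QState) (k : Finset QVar) : ρ.mat k k = ((ρ.mat k k).re : ℂ) := by
  have := Complex.nonneg_iff.1 (ρ.posSemidef.diag_nonneg (i := k))
  exact Complex.ext (by simp) (by simp [← this.2])

theorem hasSum_condProb (v : QVar ↪ QVar) (ρ : QState) :
    HasSum (fun k : Finset QVar => ρ.mat (k.map v) (k.map v)) (condProb v ρ : ℂ) := by
  have h := (Complex.hasSum_re (summable_minor v ρ).hasSum).summable.hasSum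
  have h' := Complex.hasSum_ofReal.2 h
  simpa only [← diag_eq_ofReal, condProb] using h'

theorem condProb_nonneg (v : QVar ↪ QVar) (ρ : QState) : 0 ≤ condProb v ρ :=
  tsum_nonneg fun _ => (Complex.nonneg_iff.1 ρ.posSemidef.diag_nonneg).1

theorem condProb_le_one (v : QVar ↪ QVar) (ρ : QState) : condProb v ρ ≤ 1 := by
  have h1 : HasSum (fun k => (ρ.mat k k).re) (1 : ℝ) := Complex.hasSum_re ρ.trace_one
  have h2 : HasSum (fun k : Finset QVar => (ρ.mat (k.map v) (k.map v)).re) (condProb v ρ) :=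
    Complex.hasSum_re (hasSum_condProb v ρ)
  have h3 : ∀ k, 0 ≤ (ρ.mat k k).re := fun k =>
    (Complex.nonneg_iff.1 (ρ.posSemidef.diag_nonneg (i := k))).1
  exact hasSum_le_inj (g := fun k => (ρ.mat k k).re) (fun k : Finset QVar => k.map v)
    (Finset.map_injective v) (fun k _ => h3 k) (fun _ => le_rfl) h2 h1

open Classical in
/-- The state conditioned on the qubits outside the range of `v` being in state `|0⟩`, with
the remaining qubits renamed along the inverse of `v`. -/
def condState (v : QVar ↪ QVar) (ρ : QState) : QState :=
  if h : condProb v ρ = 0 then ρ else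
    { mat := ((condProb v ρ : ℂ)⁻¹) • ρ.mat.submatrix (fun k => k.map v) (fun k => k.map v)
      posSemidef := (ρ.posSemidef.submatrix _).smul (by
        rw [← Complex.ofReal_inv]
        exact Complex.zero_le_real.2 (inv_nonneg.2 (condProb_nonneg v ρ)))
      trace_one := by
        have h1 := (hasSum_condProb v ρ).mul_left ((condProb v ρ : ℂ)⁻¹)
        rwa [inv_mul_cancel₀ (by simpa using h)] at h1 }

theorem condState_mat {v : QVar ↪ QVar} {ρ : QState} (h : condProb v ρ ≠ 0) (k k' : Finset QVar) :
    (condState v ρ).mat k k' = (condProb v ρ : ℂ)⁻¹ * ρ.mat (k.map v) (k'.map v) := by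
  rw [condState, dif_neg h]
  rfl

/-- A state proportional to a minor is the conditioned state. -/
theorem condState_unique {v : QVar ↪ QVar} {ρ ρ' : QState} {t : ℝ} (ht : t ≠ 0)
    (h : ∀ k k', ρ'.mat k k' = (t : ℂ)⁻¹ * ρ.mat (k.map v) (k'.map v)) :
    condProb v ρ = t ∧ condState v ρ = ρ' := by
  have htc : (t : ℂ) ≠ 0 := by exact_mod_cast ht
  -- Since `ρ'` has trace one, the factor `t` is forced to be the trace of the minor.
  have h1 := ρ'.trace_one.mul_left (t : ℂ)
  simp only [h, ← mul_assoc, mul_inv_cancel₀ htc, one_mul, mul_one] at h1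
  have h2 : condProb v ρ = t := by exact_mod_cast (hasSum_condProb v ρ).unique h1
  refine ⟨h2, ?_⟩
  ext k k'
  rw [condState_mat (h2 ▸ ht), h2, h]

/-- `v` leaves the variables in `S` alone. -/
def Fixes (v : QVar ↪ QVar) (S : Finset QVar) : Prop := ∀ x ∈ S, v x = x

theorem Fixes.mono {v : QVar ↪ QVar} {S T : Finset QVar} (h : Fixes v T) (hS : S ⊆ T) : Fixes v S :=
  fun x hx => h x (hS hx)

theorem Fixes.mem_iff {v : QVar ↪ QVar} {S : Finset QVar} (h : Fixes v S) {x : QVar} (hx : x ∈ S)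
    (b : Finset QVar) : x ∈ b.map v ↔ x ∈ b := by
  rw [← Finset.mem_map' v (s := b), h x hx]

theorem Fixes.apply_mem_iff {v : QVar ↪ QVar} {S : Finset QVar} (h : Fixes v S) (x : QVar) :
    v x ∈ S ↔ x ∈ S := by
  constructor
  · intro hx
    have := v.injective (h _ hx)
    rwa [this] at hx
  · intro hx
    rwa [h x hx]

theorem Fixes.disjoint_map {v : QVar ↪ QVar} {S : Finset QVar} (h : Fixes v S) {b : Finset QVar}
    (hb : Disjoint b S) : Disjoint (b.map v) S := by
  rw [Finset.disjoint_right] at hb ⊢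
  intro x hx
  rw [h.mem_iff hx]
  exact hb hx

/-- The action of `v` on the basis of the environment. -/
def Fixes.env {v : QVar ↪ QVar} {S : Finset QVar} (h : Fixes v S) (c : Env S) : Env S :=
  ⟨c.1.map v, h.disjoint_map c.2⟩

theorem Fixes.map_inter {v : QVar ↪ QVar} {S : Finset QVar} (h : Fixes v S) (b : Finset QVar) :
    b.map v ∩ S = b ∩ S := by
  ext x
  simp only [Finset.mem_inter]
  constructor
  · rintro ⟨h1, h2⟩; exact ⟨(h.mem_iff h2 b).1 h1, h2⟩
  · rintro ⟨h1, h2⟩; exact ⟨(h.mem_iff h2 b).2 h1, h2⟩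

theorem Fixes.map_sdiff {v : QVar ↪ QVar} {S : Finset QVar} (h : Fixes v S) (b : Finset QVar) :
    b.map v \ S = (b \ S).map v := by
  ext x
  simp only [Finset.mem_sdiff, Finset.mem_map]
  constructor
  · rintro ⟨⟨a, ha, rfl⟩, h2⟩
    exact ⟨a, ⟨ha, fun h' => h2 ((h.apply_mem_iff a).2 h')⟩, rfl⟩
  · rintro ⟨a, ⟨ha, h2⟩, rfl⟩
    exact ⟨⟨a, ha, rfl⟩, fun h' => h2 ((h.apply_mem_iff a).1 h')⟩

theorem Fixes.splitEquiv_map {v : QVar ↪ QVar} {S : Finset QVar} (h : Fixes v S) (b : Finset QVar) :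
    splitEquiv S (b.map v) = (h.env (splitEquiv S b).1, (splitEquiv S b).2) :=
  Prod.ext (Subtype.ext (h.map_sdiff b)) (Subtype.ext (h.map_inter b))

theorem Fixes.tupleEquiv_map {v : QVar ↪ QVar} {n : ℕ} {q : Fin n ↪ QVar}
    (h : Fixes v (Finset.univ.map q)) (b : Finset QVar) :
    tupleEquiv q (b.map v) = ((tupleEquiv q b).1, h.env (tupleEquiv q b).2) := by
  refine Prod.ext (funext fun i => ?_) (Subtype.ext (h.map_sdiff b))
  exact decide_eq_decide.2 (h.mem_iff (x := q i) (by simp) b)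

theorem Fixes.map_union {v : QVar ↪ QVar} {S s : Finset QVar} (h : Fixes v S) (hs : s ⊆ S)
    (b : Finset QVar) : (b ∪ s).map v = b.map v ∪ s := by
  rw [Finset.map_union]
  congr 1
  ext x
  rw [Finset.mem_map]
  constructor
  · rintro ⟨a, ha, rfl⟩
    rwa [h a (hs ha)]
  · intro hx
    exact ⟨x, hx, h x (hs hx)⟩

/-! ### Partial traces -/

theorem ptr_eq_sum_block (S : Finset QVar) (ρ : QState) :
    ptr S ρ = ((∑ s ∈ S.powerset.attach, ρ.block (splitEquiv S) ⟨s.1, Finset.mem_powerset.1 s.2⟩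
      ⟨s.1, Finset.mem_powerset.1 s.2⟩ : TraceClass (Env S)) : Matrix (Env S) (Env S) ℂ) := by
  ext c c'
  rw [Submodule.coe_sum, Matrix.sum_apply, ptr, ← Finset.sum_attach]
  rfl

/-- The partial trace is a sum of diagonal blocks, and `E` acts on each block linearly; hence `E`
commutes with the partial trace. -/
theorem ptr_extend (S : Finset QVar) (E : SuperOp (Env S)) {ρ σ : QState}
    (h : ptr S ρ = ptr S σ) :
    ptr S (E.extend (splitEquiv S) ρ) = ptr S (E.extend (splitEquiv S) σ) := by
  rw [ptr_eq_sum_block, ptr_eq_sum_block] at h ⊢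
  simp only [SuperOp.block_extend]
  rw [← map_sum, ← map_sum, Subtype.ext h]

/-- Tracing out `S ∪ T` is tracing out `S` and then `T`: a subset of the disjoint union splits
uniquely into its parts in `T` and in `S`. -/
theorem ptr_union {S T : Finset QVar} (hd : Disjoint S T) {ρ σ : QState} (h : ptr S ρ = ptr S σ) :
    ptr (S ∪ T) ρ = ptr (S ∪ T) σ := by
  have key : ∀ ρ : QState, ∀ c c' : Env (S ∪ T), ptr (S ∪ T) ρ c c'
      = ∑ t ∈ T.powerset.attach,
        ptr S ρ ⟨c.1 ∪ t.1, Finset.disjoint_union_left.2 ⟨(Finset.disjoint_union_right.1 c.2).1,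
            (hd.mono_right (Finset.mem_powerset.1 t.2)).symm⟩⟩
          ⟨c'.1 ∪ t.1, Finset.disjoint_union_left.2 ⟨(Finset.disjoint_union_right.1 c'.2).1,
            (hd.mono_right (Finset.mem_powerset.1 t.2)).symm⟩⟩ := by
    intro ρ c c'
    simp only [ptr]
    rw [Finset.sum_attach T.powerset fun t =>
      ∑ s ∈ S.powerset, ρ.mat (c.1 ∪ t ∪ s) (c'.1 ∪ t ∪ s), ← Finset.sum_product']
    refine Finset.sum_nbij' (fun u => (u ∩ T, u ∩ S)) (fun p => p.1 ∪ p.2) ?_ ?_ ?_ ?_ ?_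
    · intro u _
      simp [Finset.inter_subset_right]
    · intro p hp
      simp only [Finset.mem_product, Finset.mem_powerset] at hp ⊢
      exact Finset.union_subset (hp.1.trans Finset.subset_union_right)
        (hp.2.trans Finset.subset_union_left)
    · intro u hu
      rw [Finset.mem_powerset] at hu
      change u ∩ T ∪ u ∩ S = u
      rw [← Finset.inter_union_distrib_left, Finset.union_comm T S]
      exact Finset.inter_eq_left.2 hu
    · rintro ⟨t, s⟩ hp
      simp only [Finset.mem_product, Finset.mem_powerset] at hp
      refine Prod.ext ?_ ?_
      · change (t ∪ s) ∩ T = t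
        rw [Finset.union_inter_distrib_right, Finset.inter_eq_left.2 hp.1,
          Finset.disjoint_iff_inter_eq_empty.1 (hd.mono_left hp.2), Finset.union_empty]
      · change (t ∪ s) ∩ S = s
        rw [Finset.union_inter_distrib_right, Finset.inter_eq_left.2 hp.2,
          Finset.disjoint_iff_inter_eq_empty.1 (hd.symm.mono_left hp.1), Finset.empty_union]
    · intro u hu
      rw [Finset.mem_powerset] at hu
      have : u ∩ T ∪ u ∩ S = u := by
        rw [← Finset.inter_union_distrib_left, Finset.union_comm T S]
        exact Finset.inter_eq_left.2 hu
      change _ = ρ.mat (c.1 ∪ (u ∩ T) ∪ (u ∩ S)) (c'.1 ∪ (u ∩ T) ∪ (u ∩ S))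
      rw [Finset.union_assoc, Finset.union_assoc, this]
  ext c c'
  rw [key, key, h]

/-- As `v` fixes `S`, renaming `c ∪ s` along `v` moves only `c`. Summing over `s` first therefore
turns the trace of the minor into a sum of diagonal entries of the partial trace, and the
probability of the condition depends only on what the environment sees. -/
theorem hasSum_ptr {v : QVar ↪ QVar} {S : Finset QVar} (hv : Fixes v S) (ρ : QState) :
    HasSum (fun c => ptr S ρ (hv.env c) (hv.env c)) (condProb v ρ : ℂ) := by
  have h := (splitEquiv S).symm.hasSum_iff.2 (hasSum_condProb v ρ)
  have hfib : ∀ c, HasSum (fun s => ((fun k : Finset QVar => ρ.mat (k.map v) (k.map v)) ∘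
      (splitEquiv S).symm) (c, s)) (ptr S ρ (hv.env c) (hv.env c)) := by
    intro c
    let inst : Fintype {b : Finset QVar // b ⊆ S} := Fintype.subtype S.powerset (by simp)
    have e : ptr S ρ (hv.env c) (hv.env c) = ∑ s : {b : Finset QVar // b ⊆ S},
        ρ.mat ((c.1 ∪ s.1).map v) ((c.1 ∪ s.1).map v) := by
      refine (Finset.sum_subtype (p := fun b => b ⊆ S) (F := inst) S.powerset (by simp)
        fun s => ρ.mat ((hv.env c).1 ∪ s) ((hv.env c).1 ∪ s)).trans ?_
      refine Finset.sum_congr rfl fun s _ => ?_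
      rw [hv.map_union s.2]
      rfl
    rw [e]
    exact hasSum_fintype (fun s : {b : Finset QVar // b ⊆ S} =>
      ρ.mat ((c.1 ∪ s.1).map v) ((c.1 ∪ s.1).map v))
  exact h.prod_fiberwise hfib

theorem condProb_congr {v : QVar ↪ QVar} {S : Finset QVar} (hv : Fixes v S) {ρ σ : QState}
    (h : ptr S ρ = ptr S σ) : condProb v ρ = condProb v σ := by
  have h1 := hasSum_ptr hv ρ
  rw [h] at h1
  exact_mod_cast h1.unique (hasSum_ptr hv σ)

theorem ptr_condState {v : QVar ↪ QVar} {S : Finset QVar} (hv : Fixes v S) {ρ σ : QState}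
    (h : ptr S ρ = ptr S σ) (h0 : condProb v ρ ≠ 0) :
    ptr S (condState v ρ) = ptr S (condState v σ) := by
  have key : ∀ ρ : QState, condProb v ρ ≠ 0 → ∀ c c', ptr S (condState v ρ) c c'
      = (condProb v ρ : ℂ)⁻¹ * ptr S ρ (hv.env c) (hv.env c') := by
    intro ρ h0 c c'
    rw [ptr, ptr, Finset.mul_sum]
    refine Finset.sum_congr rfl fun s hs => ?_
    rw [Finset.mem_powerset] at hs
    rw [condState_mat h0, hv.map_union hs, hv.map_union hs]
    rfl
  have hp := condProb_congr hv h
  ext c c'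
  rw [key ρ h0, key σ (hp ▸ h0), hp, h]

/-! ### Super-operators and conditioning -/

/-- Super-operators on qubits left alone by `v` commute with conditioning. -/
theorem condState_extend_tuple {v : QVar ↪ QVar} {n : ℕ} {q : Fin n ↪ QVar}
    (hv : Fixes v (Finset.univ.map q)) (E : SuperOp (Fin n → Bool)) {ρ : QState}
    (h0 : condProb v ρ ≠ 0) :
    condProb v (E.extend (tupleEquiv q) ρ) = condProb v ρ ∧
      condState v (E.extend (tupleEquiv q) ρ) = E.extend (tupleEquiv q) (condState v ρ) :=
  condState_unique h0 <| SuperOp.extend_minor (tupleEquiv q) (tupleEquiv q) (fun k => k.map v) hv.env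
    hv.tupleEquiv_map E (condState_mat h0)

/-- The factorisation of the environment into the range of `v` and the rest. -/
def Fixes.rangeEquiv {v : QVar ↪ QVar} {S : Finset QVar} (hv : Fixes v S) :
    Env S ≃ Env S × {z : Finset QVar // ∀ x ∈ z, x ∉ Set.range v} where
  toFun b := (⟨b.1.preimage v v.injective.injOn, Finset.disjoint_left.2 fun x hx hS => by
      rw [Finset.mem_preimage, hv x hS] at hx
      exact Finset.disjoint_left.1 b.2 hx hS⟩,
    ⟨by classical exact b.1.filter fun x => x ∉ Set.range v, fun x hx => by
      classical exact (Finset.mem_filter.1 hx).2⟩)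
  invFun p := ⟨p.1.1.map v ∪ p.2.1, Finset.disjoint_union_left.2 ⟨hv.disjoint_map p.1.2,
    Finset.disjoint_left.2 fun x hx hS => p.2.2 x hx ⟨x, hv x hS⟩⟩⟩
  left_inv b := by
    classical
    refine Subtype.ext (Finset.ext fun x => ?_)
    simp only [Finset.mem_union, Finset.mem_map, Finset.mem_preimage, Finset.mem_filter,
      Set.mem_range]
    constructor
    · rintro (⟨a, ha, rfl⟩ | h)
      exacts [ha, h.1]
    · intro h
      by_cases hx : ∃ y, v y = x
      · obtain ⟨y, rfl⟩ := hx
        exact Or.inl ⟨y, h, rfl⟩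
      · exact Or.inr ⟨h, hx⟩
  right_inv := by
    classical
    rintro ⟨⟨x, hx⟩, ⟨z, hz⟩⟩
    refine Prod.ext (Subtype.ext (Finset.ext fun a => ?_)) (Subtype.ext (Finset.ext fun a => ?_))
    · simp only [Finset.mem_preimage, Finset.mem_union, Finset.mem_map']
      exact ⟨fun h => h.resolve_right fun h' => hz _ h' ⟨a, rfl⟩, Or.inl⟩
    · simp only [Finset.mem_filter, Finset.mem_union, Finset.mem_map]
      constructor
      · rintro ⟨⟨y, _, rfl⟩ | h, h'⟩
        exacts [absurd ⟨y, rfl⟩ h', h]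
      · exact fun h => ⟨Or.inr h, hz a h⟩

theorem Fixes.rangeEquiv_env {v : QVar ↪ QVar} {S : Finset QVar} (hv : Fixes v S) (c : Env S) :
    hv.rangeEquiv (hv.env c) = (c, ⟨∅, by simp⟩) := by
  rw [← Equiv.eq_symm_apply]
  refine Subtype.ext ?_
  exact (Finset.union_empty _).symm

/-- A super-operator applied after conditioning may be applied before it. -/
theorem extend_condState {v : QVar ↪ QVar} {S : Finset QVar} (hv : Fixes v S) (E : SuperOp (Env S))
    {ρ : QState} (h0 : condProb v ρ ≠ 0) :
    condProb v ((E.ampl hv.rangeEquiv).extend (splitEquiv S) ρ) = condProb v ρ ∧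
      condState v ((E.ampl hv.rangeEquiv).extend (splitEquiv S) ρ)
        = E.extend (splitEquiv S) (condState v ρ) := by
  rw [SuperOp.ampl_extend]
  -- The minor along `v` consists of the entries where the part outside the range of `v` is `∅`. The
  -- amplified operator leaves that part alone, so it restricts to `E` on the minor.
  refine condState_unique h0 <| SuperOp.extend_minor (splitEquiv S) _ (fun k => k.map v)
    (fun s => (⟨∅, by simp⟩, s)) (fun k => ?_) E (condState_mat h0)
  simp only [Equiv.trans_apply, hv.splitEquiv_map, Equiv.prodCongr_apply, Prod.map_apply,
    hv.rangeEquiv_env]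
  rfl

/-- The permutation of the environment induced by a permutation of the variables. -/
def envPerm {π : QVar ≃ QVar} {S : Finset QVar} (hπ : ∀ x ∈ S, π x = x) : Env S ≃ Env S where
  toFun c := ⟨c.1.map π.toEmbedding,
    Fixes.disjoint_map (v := π.toEmbedding) (fun x hx => hπ x hx) c.2⟩
  invFun c := ⟨c.1.map π.symm.toEmbedding, Fixes.disjoint_map (v := π.symm.toEmbedding)
    (fun x hx => by simpa using (congrArg π.symm (hπ x hx)).symm) c.2⟩
  left_inv c := Subtype.ext (by ext; simp)
  right_inv c := Subtype.ext (by ext; simp)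

/-- Exchanging a qubit of the environment for one on which `v` is the identity. -/
theorem exists_fixes_insert {v : QVar ↪ QVar} {S : Finset QVar} (hv : Fixes v S) (r : QVar) :
    ∃ (v' : QVar ↪ QVar) (E : SuperOp (Env S)), Fixes v' (insert r S) ∧ ∀ ρ : QState,
      condProb v' (E.extend (splitEquiv S) ρ) = condProb v ρ ∧
      (condProb v ρ ≠ 0 → condState v' (E.extend (splitEquiv S) ρ) = condState v ρ) := by
  -- The new injection is `v` followed by the swap of `r` and `v r`, so that `r` goes to itself. If
  -- either of the swapped variables lies in `S`, then they coincide; hence the swap acts only on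
  -- the environment, where a permutation of the qubits compensates it.
  have hπ : ∀ x ∈ S, Equiv.swap r (v r) x = x := by
    intro x hx
    by_cases hr : r = x
    · subst hr
      rw [hv r hx, Equiv.swap_self, Equiv.refl_apply]
    · refine Equiv.swap_apply_of_ne_of_ne (Ne.symm hr) fun h => hr ?_
      have : v r ∈ S := h ▸ hx
      exact (v.injective (hv _ this)).symm.trans h.symm
  have hS : Fixes (v.trans (Equiv.swap r (v r)).toEmbedding) (insert r S) := by
    intro x hx
    rw [Finset.mem_insert] at hx
    rcases hx with rfl | hx
    · simp
    · simp [hv x hx, hπ x hx]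
  refine ⟨_, SuperOp.perm (envPerm hπ), hS, fun ρ => ?_⟩
  have hf : Fixes (Equiv.swap r (v r)).toEmbedding S := fun x hx => hπ x hx
  have hmat : ∀ k k' : Finset QVar, ((SuperOp.perm (envPerm hπ)).extend (splitEquiv S) ρ).mat
      (k.map (v.trans (Equiv.swap r (v r)).toEmbedding))
      (k'.map (v.trans (Equiv.swap r (v r)).toEmbedding)) = ρ.mat (k.map v) (k'.map v) := by
    have hk : ∀ k : Finset QVar, (splitEquiv S).symm (envPerm hπ (splitEquiv S k).1,
        (splitEquiv S k).2) = k.map (Equiv.swap r (v r)).toEmbedding := by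
      intro k
      rw [Equiv.symm_apply_eq, hf.splitEquiv_map]
      rfl
    intro k k'
    rw [SuperOp.perm_extend, hk, hk, Finset.map_map, Finset.map_map]
    have : (v.trans (Equiv.swap r (v r)).toEmbedding).trans (Equiv.swap r (v r)).toEmbedding = v := by
      ext x; simp
    rw [this]
  have h1 : condProb (v.trans (Equiv.swap r (v r)).toEmbedding)
      ((SuperOp.perm (envPerm hπ)).extend (splitEquiv S) ρ) = condProb v ρ := by
    unfold condProb
    simp only [hmat]
  refine ⟨h1, fun h0 => ?_⟩
  ext k k'
  rw [condState_mat (h1 ▸ h0), condState_mat h0, h1, hmat]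

/-- Super-operators outside `S ∪ T` act outside `S`. -/
theorem exists_extend_union (S T : Finset QVar) (E : SuperOp (Env (S ∪ T))) :
    ∃ F : SuperOp (Env S), ∀ ρ : QState,
      F.extend (splitEquiv S) ρ = E.extend (splitEquiv (S ∪ T)) ρ := by
  let f : Env S ≃ Env (S ∪ T) × {b : Finset QVar // b ⊆ T ∧ Disjoint b S} :=
    { toFun := fun b => (⟨b.1 \ T, Finset.disjoint_union_right.2
          ⟨b.2.mono_left Finset.sdiff_subset, Finset.sdiff_disjoint⟩⟩,
        ⟨b.1 ∩ T, Finset.inter_subset_right, b.2.mono_left Finset.inter_subset_left⟩)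
      invFun := fun p => ⟨p.1.1 ∪ p.2.1, Finset.disjoint_union_left.2
        ⟨(Finset.disjoint_union_right.1 p.1.2).1, p.2.2.2⟩⟩
      left_inv := fun b => Subtype.ext (Finset.sdiff_union_inter b.1 T)
      right_inv := by
        rintro ⟨⟨b, hb⟩, ⟨c, hc, hc'⟩⟩
        have hb := (Finset.disjoint_union_right.1 hb).2
        refine Prod.ext (Subtype.ext ?_) (Subtype.ext ?_)
        · ext x
          have := fun h : x ∈ b => Finset.disjoint_left.1 hb h
          have := fun h : x ∈ c => hc h
          simp; tauto
        · ext x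
          have := fun h : x ∈ b => Finset.disjoint_left.1 hb h
          have := fun h : x ∈ c => hc h
          simp; tauto }
  refine ⟨E.ampl f, fun ρ => ?_⟩
  rw [SuperOp.ampl_extend]
  refine (SuperOp.extend_congr (splitEquiv (S ∪ T)) _ (fun b => (⟨(b.1 ∩ T) \ S,
    Finset.sdiff_subset.trans Finset.inter_subset_right, Finset.sdiff_disjoint⟩,
    ⟨b.1 ∩ S, Finset.inter_subset_right⟩)) (fun k => ?_) E ρ).symm
  refine Prod.ext (Subtype.ext ?_) (Prod.ext (Subtype.ext ?_) (Subtype.ext ?_))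
  · change (k \ S) \ T = k \ (S ∪ T)
    rw [Finset.sdiff_sdiff_left']
    ext; simp; tauto
  · change (k \ S) ∩ T = ((k ∩ (S ∪ T)) ∩ T) \ S
    ext; simp; tauto
  · change k ∩ S = (k ∩ (S ∪ T)) ∩ S
    ext; simp

/-- The factorisation of the environment of `S` given by a tuple of variables outside `S`. -/
def envTupleEquiv {n : ℕ} (q : Fin n ↪ QVar) {S : Finset QVar}
    (hd : Disjoint (Finset.univ.map q) S) :
    Env S ≃ (Fin n → Bool) × {c : Env (Finset.univ.map q) // Disjoint c.1 S} where
  toFun b := ((tupleEquiv q b.1).1, ⟨(tupleEquiv q b.1).2, b.2.mono_left Finset.sdiff_subset⟩)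
  invFun p := ⟨(tupleEquiv q).symm (p.1, p.2.1), by
    refine Finset.disjoint_union_left.2 ⟨?_, p.2.2⟩
    exact hd.mono_left (Finset.map_subset_map.2 (Finset.filter_subset _ _))⟩
  left_inv b := Subtype.ext ((tupleEquiv q).symm_apply_apply b.1)
  right_inv p := by
    have := (tupleEquiv q).apply_symm_apply (p.1, p.2.1)
    exact Prod.ext (congrArg (fun x => x.1) this) (Subtype.ext (congrArg (fun x => x.2) this))

theorem envTupleEquiv_split {n : ℕ} (q : Fin n ↪ QVar) {S : Finset QVar}
    (hd : Disjoint (Finset.univ.map q) S) (k : Finset QVar) :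
    (envTupleEquiv q hd (splitEquiv S k).1).1 = (tupleEquiv q k).1 ∧
    ((envTupleEquiv q hd (splitEquiv S k).1).2.1.1 : Finset QVar) = (tupleEquiv q k).2.1 \ S := by
  constructor
  · funext i
    have : q i ∉ S := Finset.disjoint_left.1 hd (by simp)
    change decide (q i ∈ k \ S) = decide (q i ∈ k)
    simp [this]
  · change (k \ S) \ Finset.univ.map q = (k \ Finset.univ.map q) \ S
    exact sdiff_right_comm _ _ _

/-- Super-operators on a tuple of variables outside `S` act outside `S`. -/
theorem exists_extend_tuple {n : ℕ} (q : Fin n ↪ QVar) {S : Finset QVar}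
    (hd : Disjoint (Finset.univ.map q) S) (E : SuperOp (Fin n → Bool)) :
    ∃ F : SuperOp (Env S), ∀ ρ : QState,
      F.extend (splitEquiv S) ρ = E.extend (tupleEquiv q) ρ := by
  refine ⟨E.ampl (envTupleEquiv q hd), fun ρ => ?_⟩
  rw [SuperOp.ampl_extend]
  refine (SuperOp.extend_congr (tupleEquiv q) _ (fun b => (⟨⟨b.1 \ S,
    b.2.mono_left Finset.sdiff_subset⟩, Finset.sdiff_disjoint⟩,
    ⟨b.1 ∩ S, Finset.inter_subset_right⟩)) (fun k => ?_) E ρ).symm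
  obtain ⟨h1, h2⟩ := envTupleEquiv_split q hd k
  refine Prod.ext h1 (Prod.ext (Subtype.ext (Subtype.ext h2)) (Subtype.ext ?_))
  change k ∩ S = (k \ Finset.univ.map q) ∩ S
  ext x
  have := fun h : x ∈ S => Finset.disjoint_right.1 hd h
  simp only [Finset.mem_inter, Finset.mem_sdiff]
  tauto

/-! ### Measurements and conditioning -/

theorem Measurement.post_mat {n : ℕ} (M : Measurement n) (q : Fin n ↪ QVar) (ρ : QState)
    (i : Fin n → Bool) (h : M.prob q ρ i ≠ 0) (k k' : Finset QVar) :
    (M.post q ρ i).mat k k'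
      = (M.prob q ρ i : ℂ)⁻¹ * sandwich (tupleEquiv q) (M.proj i) ρ k k' := by
  rw [Measurement.post, dif_neg h]
  rfl

/-- Shift by one from a bound `m` of `S` upwards; this frees `m`. -/
theorem exists_fixes_notMem_range (S : Finset QVar) :
    ∃ (v : QVar ↪ QVar) (r : QVar), Fixes v S ∧ r ∉ Set.range v := by
  obtain ⟨m, hm⟩ : ∃ m : ℕ, ∀ x ∈ S, x < m :=
    ⟨S.sup id + 1, fun x hx => Nat.lt_succ_of_le (Finset.le_sup (f := id) hx)⟩
  refine ⟨⟨fun x : ℕ => if x < m then x else x + 1, fun (x y : ℕ) h => ?_⟩, m, fun x hx => ?_, ?_⟩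
  · change (if x < m then x else x + 1 : ℕ) = if y < m then y else y + 1 at h
    change x = y
    split_ifs at h <;> omega
  · exact if_pos (hm x hx)
  · rintro ⟨(x : ℕ), hx⟩
    change (if x < m then x else x + 1) = m at hx
    split_ifs at hx <;> omega

/-- Measuring variables outside `S` amounts to conditioning after a super-operator. -/
theorem exists_condState_eq_post {n : ℕ} (M : Measurement n) (q : Fin n ↪ QVar) {S : Finset QVar}
    (hd : Disjoint (Finset.univ.map q) S) (i : Fin n → Bool) :
    ∃ (v : QVar ↪ QVar) (F : SuperOp (Env S)), Fixes v S ∧ ∀ ρ : QState,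
      condProb v (F.extend (splitEquiv S) ρ) = M.prob q ρ i ∧
      (M.prob q ρ i ≠ 0 → condState v (F.extend (splitEquiv S) ρ) = M.post q ρ i) := by
  obtain ⟨v, r, hv, hr⟩ := exists_fixes_notMem_range S
  -- The qubit `r` freed by `v` is the register. Outcome `i` is written as `∅`, the all-`|0⟩` value
  -- selected by `condState v`, and every other outcome as `{r}`.
  let z₀ : {z : Finset QVar // ∀ x ∈ z, x ∉ Set.range v} := ⟨∅, by simp⟩
  let z₁ : {z : Finset QVar // ∀ x ∈ z, x ∉ Set.range v} := ⟨{r}, by simpa using hr⟩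
  have hz : z₁ ≠ z₀ := fun h => Finset.singleton_ne_empty r (congrArg Subtype.val h)
  let F := SuperOp.record (envTupleEquiv q hd) hv.rangeEquiv hz (M.proj_conjTranspose i)
    (M.proj_mul_self i)
  have hmat : ∀ ρ : QState, ∀ k k' : Finset QVar,
      (F.extend (splitEquiv S) ρ).mat (k.map v) (k'.map v)
        = sandwich (tupleEquiv q) (M.proj i) ρ k k' := by
    intro ρ k k'
    have hg : ∀ k : Finset QVar, hv.rangeEquiv (splitEquiv S (k.map v)).1
        = ((splitEquiv S k).1, z₀) := fun k => by
      rw [hv.splitEquiv_map]; exact hv.rangeEquiv_env _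
    rw [SuperOp.record_extend _ _ hz _ _ _ ρ (hg k) (hg k'), sandwich, Matrix.submatrix_apply,
      ofBlocks, M.proj_conjTranspose, hv.splitEquiv_map, hv.splitEquiv_map,
      (envTupleEquiv_split q hd k).1, (envTupleEquiv_split q hd k').1]
    have hk : ∀ (k : Finset QVar) (a : Fin n → Bool), (splitEquiv S).symm
        ((envTupleEquiv q hd).symm (a, (envTupleEquiv q hd (splitEquiv S k).1).2),
          (splitEquiv S k).2) = (tupleEquiv q).symm (a, (tupleEquiv q k).2) := by
      intro k a
      change ((Finset.univ.filter fun i => a i = true).map q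
        ∪ (k \ S) \ Finset.univ.map q) ∪ k ∩ S
        = (Finset.univ.filter fun i => a i = true).map q ∪ k \ Finset.univ.map q
      rw [Finset.union_assoc]
      congr 1
      ext x
      have := fun h : x ∈ S => Finset.disjoint_right.1 hd h
      simp only [Finset.mem_union, Finset.mem_inter, Finset.mem_sdiff]
      tauto
    have hb : blockOf ((ρ.block (splitEquiv S) (splitEquiv S k).2 (splitEquiv S k').2 :
          Matrix (Env S) (Env S) ℂ).submatrix (envTupleEquiv q hd).symm (envTupleEquiv q hd).symm)
          (envTupleEquiv q hd (splitEquiv S k).1).2 (envTupleEquiv q hd (splitEquiv S k').1).2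
        = blockOf (factored (tupleEquiv q) ρ) (tupleEquiv q k).2 (tupleEquiv q k').2 := by
      ext a b
      change ρ.mat ((splitEquiv S).symm (_, _)) ((splitEquiv S).symm (_, _))
        = ρ.mat ((tupleEquiv q).symm _) ((tupleEquiv q).symm _)
      rw [hk, hk]
    rw [← hb]
  have hprob : ∀ ρ : QState, condProb v (F.extend (splitEquiv S) ρ) = M.prob q ρ i := by
    intro ρ
    have h1 := hasSum_condProb v (F.extend (splitEquiv S) ρ)
    simp only [hmat] at h1
    exact_mod_cast h1.unique (M.hasSum_post q ρ i)
  refine ⟨v, F, hv, fun ρ => ⟨hprob ρ, fun h0 => ?_⟩⟩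
  ext k k'
  rw [condState_mat (by rwa [hprob]), M.post_mat q ρ i h0, hprob, hmat]

theorem sandwich_condState {v : QVar ↪ QVar} {n : ℕ} {q : Fin n ↪ QVar}
    (hv : Fixes v (Finset.univ.map q)) (A : Matrix (Fin n → Bool) (Fin n → Bool) ℂ) {ρ : QState}
    (h0 : condProb v ρ ≠ 0) (k k' : Finset QVar) :
    sandwich (tupleEquiv q) A (condState v ρ) k k'
      = (condProb v ρ : ℂ)⁻¹ * sandwich (tupleEquiv q) A ρ (k.map v) (k'.map v) := by
  have hs : ∀ a j, (tupleEquiv q).symm (a, hv.env j) = ((tupleEquiv q).symm (a, j)).map v := by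
    intro a j
    rw [Equiv.symm_apply_eq, hv.tupleEquiv_map]
    simp
  have hb : blockOf (factored (tupleEquiv q) (condState v ρ)) (tupleEquiv q k).2 (tupleEquiv q k').2
      = (condProb v ρ : ℂ)⁻¹ • blockOf (factored (tupleEquiv q) ρ)
        (hv.env (tupleEquiv q k).2) (hv.env (tupleEquiv q k').2) := by
    ext a b
    change (condState v ρ).mat _ _ = _ * ρ.mat _ _
    rw [condState_mat h0, hs, hs]
  rw [sandwich, Matrix.submatrix_apply, ofBlocks, hb, sandwich, Matrix.submatrix_apply, ofBlocks,
    hv.tupleEquiv_map, hv.tupleEquiv_map, Matrix.mul_smul, Matrix.smul_mul]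
  rfl

theorem hasSum_sandwich_minor {v : QVar ↪ QVar} {n : ℕ} (M : Measurement n) (q : Fin n ↪ QVar)
    (ρ : QState) (i : Fin n → Bool) :
    HasSum (fun k : Finset QVar => sandwich (tupleEquiv q) (M.proj i) ρ (k.map v) (k.map v))
      (M.prob q ρ i * condProb v (M.post q ρ i) : ℝ) := by
  by_cases h0 : M.prob q ρ i = 0
  · have h := M.hasSum_post q ρ i
    rw [h0, Complex.ofReal_zero] at h
    have hz := (hasSum_zero_iff_of_nonneg fun k =>
      (sandwich_posSemidef (tupleEquiv q) (M.proj i) ρ).diag_nonneg).1 h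
    have : (fun k : Finset QVar => sandwich (tupleEquiv q) (M.proj i) ρ (k.map v) (k.map v))
        = fun _ => 0 := funext fun k => congrFun hz (k.map v)
    rw [this, h0, zero_mul, Complex.ofReal_zero]
    exact hasSum_zero
  · have hc : (M.prob q ρ i : ℂ) ≠ 0 := by exact_mod_cast h0
    have := (hasSum_condProb v (M.post q ρ i)).mul_left (M.prob q ρ i : ℂ)
    simp only [M.post_mat q ρ i h0, ← mul_assoc, mul_inv_cancel₀ hc, one_mul] at this
    rwa [Complex.ofReal_mul]

/-- Measurement outcomes after conditioning. -/
theorem prob_condState {v : QVar ↪ QVar} {n : ℕ} {q : Fin n ↪ QVar}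
    (hv : Fixes v (Finset.univ.map q)) (M : Measurement n) {ρ : QState} (h0 : condProb v ρ ≠ 0)
    (i : Fin n → Bool) :
    M.prob q (condState v ρ) i = (condProb v ρ)⁻¹ * (M.prob q ρ i * condProb v (M.post q ρ i)) := by
  have h1 := M.hasSum_post q (condState v ρ) i
  simp only [sandwich_condState hv _ h0] at h1
  have h2 := (hasSum_sandwich_minor (v := v) M q ρ i).mul_left ((condProb v ρ : ℂ)⁻¹)
  exact_mod_cast h1.unique h2

/-- Both sides normalise the same minor of `sandwich`, since projecting the qubits `q` does not
interfere with a minor along an injection fixing them. The normalising constants agree by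
`prob_condState`. -/
theorem post_condState {v : QVar ↪ QVar} {n : ℕ} {q : Fin n ↪ QVar}
    (hv : Fixes v (Finset.univ.map q)) (M : Measurement n) {ρ : QState} (h0 : condProb v ρ ≠ 0)
    (i : Fin n → Bool) (h1 : M.prob q ρ i ≠ 0) (h2 : condProb v (M.post q ρ i) ≠ 0) :
    condState v (M.post q ρ i) = M.post q (condState v ρ) i := by
  refine (condState_unique h2 fun k k' => ?_).2
  have hp := prob_condState hv M h0 i
  have h0c : (condProb v ρ : ℂ) ≠ 0 := by exact_mod_cast h0
  have h1c : (M.prob q ρ i : ℂ) ≠ 0 := by exact_mod_cast h1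
  have h2c : (condProb v (M.post q ρ i) : ℂ) ≠ 0 := by exact_mod_cast h2
  have hne : M.prob q (condState v ρ) i ≠ 0 := by
    rw [hp]
    exact mul_ne_zero (inv_ne_zero h0) (mul_ne_zero h1 h2)
  rw [M.post_mat _ _ _ hne, sandwich_condState hv _ h0, hp, M.post_mat _ _ _ h1]
  push_cast
  field_simp

/-! ### The case of probability zero -/

/-- The minor is positive with trace zero, so its diagonal vanishes and with it every entry. -/
theorem mat_map_eq_zero {v : QVar ↪ QVar} {ρ : QState} (h0 : condProb v ρ = 0)
    (k k' : Finset QVar) : ρ.mat (k.map v) (k'.map v) = 0 := by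
  have h := hasSum_condProb v ρ
  rw [h0, Complex.ofReal_zero] at h
  have hz := (hasSum_zero_iff_of_nonneg fun k : Finset QVar =>
    ρ.posSemidef.diag_nonneg (i := k.map v)).1 h
  have hd : ∀ k : Finset QVar, ρ.mat (k.map v) (k.map v) = 0 := fun k => congrFun hz k
  have := norm_entry_le ρ.posSemidef (k.map v) (k'.map v)
  rw [hd, hd, norm_zero, add_zero] at this
  exact norm_le_zero_iff.1 this

theorem Fixes.tupleEquiv_symm_env {v : QVar ↪ QVar} {n : ℕ} {q : Fin n ↪ QVar}
    (hv : Fixes v (Finset.univ.map q)) (a : Fin n → Bool) (j : Env (Finset.univ.map q)) :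
    (tupleEquiv q).symm (a, hv.env j) = ((tupleEquiv q).symm (a, j)).map v := by
  rw [Equiv.symm_apply_eq, hv.tupleEquiv_map]
  simp

/-- When the probability is zero, `condState` is only a default and cannot be used. Instead all
blocks of `ρ` at indices moved by `v` vanish, and so do their images under `E`. -/
theorem condProb_extend_tuple {v : QVar ↪ QVar} {n : ℕ} {q : Fin n ↪ QVar}
    (hv : Fixes v (Finset.univ.map q)) (E : SuperOp (Fin n → Bool)) (ρ : QState) :
    condProb v (E.extend (tupleEquiv q) ρ) = condProb v ρ := by
  by_cases h0 : condProb v ρ = 0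
  · have hb : ∀ j j', ρ.block (tupleEquiv q) (hv.env j) (hv.env j') = 0 := fun j j' => by
      ext a b
      rw [Density.block_apply, hv.tupleEquiv_symm_env, hv.tupleEquiv_symm_env, mat_map_eq_zero h0]
      rfl
    have hm : ∀ k : Finset QVar, (E.extend (tupleEquiv q) ρ).mat (k.map v) (k.map v) = 0 := by
      intro k
      rw [SuperOp.extend_mat, hv.tupleEquiv_map, hb, map_zero]
      rfl
    rw [h0, condProb]
    simp only [hm, Complex.zero_re, tsum_zero]
  · exact (condState_extend_tuple hv E h0).1

/-- The law of total probability. For a nonzero right-hand side it says, after division, that the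
outcome probabilities in the conditioned state add up to one. -/
theorem sum_prob_mul_condProb {v : QVar ↪ QVar} {n : ℕ} {q : Fin n ↪ QVar}
    (hv : Fixes v (Finset.univ.map q)) (M : Measurement n) (ρ : QState) :
    ∑ i, M.prob q ρ i * condProb v (M.post q ρ i) = condProb v ρ := by
  by_cases h0 : condProb v ρ = 0
  · rw [h0]
    refine Finset.sum_eq_zero fun i _ => ?_
    have h := hasSum_sandwich_minor (v := v) M q ρ i
    have hb : ∀ j j', blockOf (factored (tupleEquiv q) ρ) (hv.env j) (hv.env j') = 0 :=
        fun j j' => by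
      ext a b
      change ρ.mat ((tupleEquiv q).symm _) ((tupleEquiv q).symm _) = 0
      rw [hv.tupleEquiv_symm_env, hv.tupleEquiv_symm_env, mat_map_eq_zero h0]
    have hm : ∀ k : Finset QVar,
        sandwich (tupleEquiv q) (M.proj i) ρ (k.map v) (k.map v) = 0 := by
      intro k
      rw [sandwich, Matrix.submatrix_apply, ofBlocks, hv.tupleEquiv_map, hb, mul_zero, zero_mul]
      rfl
    simp only [hm] at h
    exact_mod_cast h.unique hasSum_zero
  · have h := M.sum_prob q (condState v ρ)
    simp only [prob_condState hv M h0] at h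
    rw [← Finset.mul_sum] at h
    field_simp at h
    exact h

end Conditioning

/-! ## Substitution, free variables and legality -/

section Processes

variable {S : Sig}

theorem QName.inst_liftQ_weaken {k k' : ℕ} (θ : Fin k → QName k') (x : QName k) :
    QName.inst (liftQ θ) x.weaken = (QName.inst θ x).weaken := by
  rcases x with x | i <;> rfl

theorem QName.eq_zero_or_weaken {k : ℕ} (x : QName (k + 1)) :
    x = Sum.inr 0 ∨ ∃ y : QName k, x = y.weaken := by
  rcases x with x | i
  · exact Or.inr ⟨Sum.inl x, rfl⟩
  · refine Fin.cases (Or.inl rfl) (fun j => Or.inr ⟨Sum.inr j, rfl⟩) i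

theorem QName.weaken_ne_zero {k : ℕ} (x : QName k) : x.weaken ≠ Sum.inr 0 := by
  rcases x with x | i
  · simp [QName.weaken]
  · simp [QName.weaken]

theorem Proc.names_inst {m k : ℕ} (P : Proc S m k) : ∀ {m' k' : ℕ} (σ : Fin m → Fin m' ⊕ ℝ)
    (θ : Fin k → QName k'), (P.inst σ θ).names ⊆ P.names.image (QName.inst θ) := by
  induction P with
  | nil => intro m' k' σ θ; simp [inst, names]
  | tau P ih => intro m' k' σ θ; simpa [inst, names] using ih σ θ
  | cin c P ih => intro m' k' σ θ; simpa [inst, names] using ih _ θ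
  | cout c e P ih => intro m' k' σ θ; simpa [inst, names] using ih _ θ
  | qin c P ih =>
    intro m' k' σ θ x hx
    simp only [inst, names, Finset.mem_preimage] at hx
    obtain ⟨y, hy, hyx⟩ := Finset.mem_image.1 (ih _ _ hx)
    rcases y.eq_zero_or_weaken with rfl | ⟨y, rfl⟩
    · exact absurd hyx.symm (QName.weaken_ne_zero x)
    · rw [QName.inst_liftQ_weaken] at hyx
      refine Finset.mem_image.2 ⟨y, ?_, QName.weaken_injective hyx⟩
      simpa [names] using hy
  | qout c q P ih =>
    intro m' k' σ θ
    simp only [inst, names, Finset.image_union, Finset.image_singleton]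
    exact Finset.union_subset_union (ih σ θ) subset_rfl
  | op E q P ih =>
    intro m' k' σ θ
    simp only [inst, names, Finset.image_union, Finset.image_image]
    exact Finset.union_subset_union (ih σ θ) subset_rfl
  | meas M q P ih =>
    intro m' k' σ θ
    simp only [inst, names, Finset.image_union, Finset.image_image]
    exact Finset.union_subset_union (ih _ θ) subset_rfl
  | sum P Q ih1 ih2 =>
    intro m' k' σ θ
    simp only [inst, names, Finset.image_union]
    exact Finset.union_subset_union (ih1 σ θ) (ih2 σ θ)
  | par P Q ih1 ih2 =>
    intro m' k' σ θ
    simp only [inst, names, Finset.image_union]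
    exact Finset.union_subset_union (ih1 σ θ) (ih2 σ θ)
  | rel f P ih => intro m' k' σ θ; simpa [inst, names] using ih σ θ
  | res L P ih => intro m' k' σ θ; simpa [inst, names] using ih σ θ
  | cond b P ih => intro m' k' σ θ; simpa [inst, names] using ih σ θ
  | const A q x =>
    intro m' k' σ θ
    simp only [inst, names, Finset.image_image]
    exact subset_rfl

/-- Legality consists of non-membership, disjointness and distinctness conditions on names, and
these survive a substitution that identifies no two occurring names. A newly bound name is never
identified with a weakened one. -/
theorem Proc.legal_inst {m k : ℕ} (P : Proc S m k) : ∀ {m' k' : ℕ} (σ : Fin m → Fin m' ⊕ ℝ)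
    (θ : Fin k → QName k'), P.Legal → Set.InjOn (QName.inst θ) (P.names : Set (QName k)) →
      (P.inst σ θ).Legal := by
  have hinj : ∀ {n k k' : ℕ} {q : Fin n → QName k} {s : Finset (QName k)} {θ : Fin k → QName k'},
      Function.Injective q → Set.InjOn (QName.inst θ) ↑(s ∪ Finset.univ.image q) →
      Function.Injective fun i => (q i).inst θ := fun hq h i j hij =>
    hq (h (by simp) (by simp) hij)
  induction P with
  | nil => intro m' k' σ θ h hi; trivial
  | tau P ih => intro m' k' σ θ h hi; exact ih σ θ h hi
  | cin c P ih => intro m' k' σ θ h hi; exact ih _ θ h hi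
  | cout c e P ih => intro m' k' σ θ h hi; exact ih _ θ h hi
  | qin c P ih =>
    intro m' k' σ θ h hi
    refine ih _ _ h fun x hx y hy hxy => ?_
    rcases x.eq_zero_or_weaken with rfl | ⟨x, rfl⟩ <;>
      rcases y.eq_zero_or_weaken with rfl | ⟨y, rfl⟩
    · rfl
    · rw [QName.inst_liftQ_weaken] at hxy
      exact absurd hxy.symm (QName.weaken_ne_zero _)
    · rw [QName.inst_liftQ_weaken] at hxy
      exact absurd hxy (QName.weaken_ne_zero _)
    · rw [QName.inst_liftQ_weaken, QName.inst_liftQ_weaken] at hxy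
      rw [hi (by simpa [names] using hx) (by simpa [names] using hy)
        (QName.weaken_injective hxy)]
  | qout c q P ih =>
    intro m' k' σ θ h hi
    refine ⟨fun hq => ?_, ih σ θ h.2 (hi.mono (by simp [names]))⟩
    obtain ⟨y, hy, hyq⟩ := Finset.mem_image.1 (P.names_inst σ θ hq)
    have : y = q := hi (by simp [names, hy]) (by simp [names]) hyq
    exact h.1 (this ▸ hy)
  | op E q P ih =>
    intro m' k' σ θ h hi
    exact ⟨hinj h.1 hi, ih σ θ h.2 (hi.mono (by simp [names]))⟩
  | meas M q P ih =>
    intro m' k' σ θ h hi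
    exact ⟨hinj h.1 hi, ih _ θ h.2 (hi.mono (by simp [names]))⟩
  | sum P Q ih1 ih2 =>
    intro m' k' σ θ h hi
    exact ⟨ih1 σ θ h.1 (hi.mono (by simp [names])), ih2 σ θ h.2 (hi.mono (by simp [names]))⟩
  | par P Q ih1 ih2 =>
    intro m' k' σ θ h hi
    refine ⟨?_, ih1 σ θ h.2.1 (hi.mono (by simp [names])),
      ih2 σ θ h.2.2 (hi.mono (by simp [names]))⟩
    refine Finset.disjoint_left.2 fun x hx hy => ?_
    obtain ⟨a, ha, rfl⟩ := Finset.mem_image.1 (P.names_inst σ θ hx)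
    obtain ⟨b, hb, hab⟩ := Finset.mem_image.1 (Q.names_inst σ θ hy)
    have : b = a := hi (by simp [names, hb]) (by simp [names, ha]) hab
    exact Finset.disjoint_left.1 h.1 ha (this ▸ hb)
  | rel f P ih => intro m' k' σ θ h hi; exact ih σ θ h hi
  | res L P ih => intro m' k' σ θ h hi; exact ih σ θ h hi
  | cond b P ih => intro m' k' σ θ h hi; exact ih σ θ h hi
  | const A q x =>
    intro m' k' σ θ h hi
    exact hinj (s := ∅) h (by simpa [names] using hi)

/-! ### Free variables and legality of closed processes. -/

theorem Proc.mem_qv {P : Proc S 0 0} {x : QVar} : x ∈ P.qv ↔ Sum.inl x ∈ P.names := by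
  simp [qv]

theorem Proc.names_eq (P : Proc S 0 0) : P.names = P.qv.image Sum.inl := by
  ext x
  rcases x with x | i
  · simp [mem_qv]
  · exact i.elim0

theorem Proc.disjoint_names {P Q : Proc S 0 0} :
    Disjoint P.names Q.names ↔ Disjoint P.qv Q.qv := by
  rw [names_eq, names_eq, Finset.disjoint_image Sum.inl_injective]

theorem Proc.qv_par (P Q : Proc S 0 0) : (P.par Q).qv = P.qv ∪ Q.qv := by
  ext x; simp [mem_qv, names]

theorem Proc.legal_par {P Q : Proc S 0 0} :
    (P.par Q).Legal ↔ Disjoint P.qv Q.qv ∧ P.Legal ∧ Q.Legal := by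
  rw [← disjoint_names]; rfl

theorem QName.inst_elim0 (θ : Fin 0 → QName 0) (x : QName 0) : QName.inst θ x = x := by
  rcases x with x | i
  · rfl
  · exact i.elim0

theorem Proc.qv_substC (P : Proc S 1 0) (v : ℝ) {x : QVar} (hx : x ∈ (P.substC v).qv) :
    Sum.inl x ∈ P.names := by
  rw [mem_qv] at hx
  obtain ⟨y, hy, h⟩ := Finset.mem_image.1 (P.names_inst _ _ hx)
  rw [QName.inst_elim0] at h
  exact h ▸ hy

theorem Proc.legal_substC (P : Proc S 1 0) (v : ℝ) (h : P.Legal) : (P.substC v).Legal :=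
  P.legal_inst _ _ h fun x _ y _ hxy => by rwa [QName.inst_elim0, QName.inst_elim0] at hxy

theorem Proc.qv_substQ (c : S.QChan) (P : Proc S 0 1) (r : QVar) :
    (P.substQ r).qv ⊆ (Proc.qin c P).qv ∪ {r} := by
  intro x hx
  rw [mem_qv] at hx
  obtain ⟨y, hy, h⟩ := Finset.mem_image.1 (P.names_inst _ _ hx)
  rcases y with y | i
  · have : y = x := Sum.inl_injective h
    subst this
    rw [Finset.mem_union, mem_qv]
    left
    simpa [names, QName.weaken] using hy
  · have : r = x := Sum.inl_injective h
    simp [this]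

theorem Proc.legal_substQ (c : S.QChan) (P : Proc S 0 1) (r : QVar) (h : P.Legal)
    (hr : r ∉ (Proc.qin c P).qv) : (P.substQ r).Legal := by
  have hr' : (Sum.inl r : QName 1) ∉ P.names := by
    rw [mem_qv] at hr
    simpa [names, QName.weaken] using hr
  refine P.legal_inst _ _ h fun x hx y hy hxy => ?_
  rcases x with x | i <;> rcases y with y | j
  · exact congrArg Sum.inl (Sum.inl_injective hxy)
  · have : x = r := Sum.inl_injective hxy
    exact absurd (this ▸ hx) hr'
  · have : r = y := Sum.inl_injective hxy
    exact absurd (this ▸ hy) hr'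
  · exact congrArg Sum.inr (Subsingleton.elim i j)

end Processes

/-! ## The effect of a transition as a function of the state -/

section Effects

variable {S : Sig}

/-- Effects of transitions: the resulting process, preceded by the application of a super-operator
or a measurement of a tuple of qubits. -/
inductive Effect (S : Sig) : Type
  | ret : Proc S 0 0 → Effect S
  | op {n : ℕ} : SuperOp (Fin (n + 1) → Bool) → (Fin (n + 1) ↪ QVar) → Proc S 0 0 → Effect S
  | meas {n : ℕ} : Measurement (n + 1) → (Fin (n + 1) ↪ QVar) →
      ((Fin (n + 1) → Bool) → Proc S 0 0) → Effect S

/-- The distribution resulting from an effect. -/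
def Effect.run : Effect S → QState → PMF (Config S)
  | .ret P, ρ => PMF.pure ⟨P, ρ⟩
  | .op E q P, ρ => PMF.pure ⟨P, E.extend (tupleEquiv q) ρ⟩
  | .meas M q P, ρ => (M.outcome q ρ).map fun i => ⟨P i, M.post q ρ i⟩

/-- Application of an operation to the resulting processes. -/
def Effect.mapProc (F : Proc S 0 0 → Proc S 0 0) : Effect S → Effect S
  | .ret P => .ret (F P)
  | .op E q P => .op E q (F P)
  | .meas M q P => .meas M q fun i => F (P i)

/-- The qubits operated on. -/
def Effect.qubits : Effect S → Finset QVar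
  | .ret _ => ∅
  | .op _ q _ => Finset.univ.map q
  | .meas _ q _ => Finset.univ.map q

/-- The possible resulting processes. -/
def Effect.targets : Effect S → Set (Proc S 0 0)
  | .ret P => {P}
  | .op _ _ P => {P}
  | .meas _ _ P => Set.range P

theorem Effect.run_mapProc (F : Proc S 0 0 → Proc S 0 0) (e : Effect S) (ρ : QState) :
    (e.mapProc F).run ρ = (e.run ρ).map (Config.mapProc F) := by
  cases e with
  | ret P => rw [run, PMF.pure_map]; rfl
  | op E q P => rw [run, PMF.pure_map]; rfl
  | meas M q P => rw [run, PMF.map_comp]; rfl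

theorem Effect.qubits_mapProc (F : Proc S 0 0 → Proc S 0 0) (e : Effect S) :
    (e.mapProc F).qubits = e.qubits := by
  cases e <;> rfl

theorem Effect.targets_mapProc (F : Proc S 0 0 → Proc S 0 0) (e : Effect S) :
    (e.mapProc F).targets = F '' e.targets := by
  cases e with
  | ret P => exact Set.image_singleton.symm
  | op E q P => exact Set.image_singleton.symm
  | meas M q P => exact Set.range_comp F P

theorem Effect.proc_mem_targets {e : Effect S} {ρ : QState} {C : Config S}
    (h : C ∈ (e.run ρ).support) : C.proc ∈ e.targets := by
  cases e with
  | ret P =>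
    rw [run, PMF.mem_support_pure_iff] at h
    exact h ▸ rfl
  | op E q P =>
    rw [run, PMF.mem_support_pure_iff] at h
    exact h ▸ rfl
  | meas M q P =>
    obtain ⟨i, _, rfl⟩ := (PMF.mem_support_map_iff _ _ _).1 h
    exact ⟨i, rfl⟩

theorem Effect.finite_support (e : Effect S) (ρ : QState) : (e.run ρ).support.Finite := by
  cases e with
  | ret P => exact finite_support_pure _
  | op E q P => exact finite_support_pure _
  | meas M q P => exact finite_support_map _ (Set.toFinite _)

theorem Act.qbv_relabel (f : Relabel S) (α : Act S) : (α.relabel f).qbv = α.qbv := by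
  cases α <;> rfl

/-- `P` has a transition with action `α` and effect `e` in every state. -/
structure Realizes (D : Program S) (P : Proc S 0 0) (α : Act S) (e : Effect S) : Prop where
  step : ∀ ρ, Step D ⟨P, ρ⟩ α (e.run ρ)
  qubits : e.qubits ⊆ P.qv
  ret : α ≠ .tau → ∃ P', e = .ret P'
  qv : ∀ P' ∈ e.targets, P'.qv ⊆ P.qv ∪ α.qbv
  out_mem : ∀ c r, α = .qout c r → r ∈ P.qv
  legal : P.Legal → ∀ P' ∈ e.targets, P'.Legal
  out_notMem : P.Legal → ∀ c r, α = .qout c r → ∀ P' ∈ e.targets, r ∉ P'.qv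

/-- Serves the premises of communication rules: a visible action leaves the state alone, so its
target process can be read off the distribution. -/
theorem Realizes.eq_ret {D : Program S} {P P' : Proc S 0 0} {α : Act S} {e : Effect S} {ρ : QState}
    (h : Realizes D P α e) (hα : α ≠ .tau) (he : PMF.pure ⟨P', ρ⟩ = e.run ρ) : e = .ret P' := by
  obtain ⟨Q, rfl⟩ := h.ret hα
  have : (⟨Q, ρ⟩ : Config S) ∈ (PMF.pure (⟨P', ρ⟩ : Config S)).support := by
    rw [he]
    exact (PMF.mem_support_pure_iff _ _).2 rfl
  rw [PMF.mem_support_pure_iff] at this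
  injection this with h1
  rw [h1]

/-- Transitions of `P` are transitions of processes with more free variables whose legality
implies that of `P`. -/
theorem Realizes.weaken {D : Program S} {P Q : Proc S 0 0} {α : Act S} {e : Effect S}
    (h : Realizes D P α e) (hs : ∀ ρ Δ, Step D ⟨P, ρ⟩ α Δ → Step D ⟨Q, ρ⟩ α Δ)
    (hq : P.qv ⊆ Q.qv) (hl : Q.Legal → P.Legal) : Realizes D Q α e where
  step ρ := hs _ _ (h.step ρ)
  qubits := h.qubits.trans hq
  ret := h.ret
  qv P' hP' := (h.qv P' hP').trans (Finset.union_subset_union hq subset_rfl)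
  out_mem c r hr := hq (h.out_mem c r hr)
  legal hQ := h.legal (hl hQ)
  out_notMem hQ := h.out_notMem (hl hQ)

/-- Common treatment of the rules that keep an operator around the target. `T` holds the free
variables contributed by the operator: those of the idle component for interleaving, none for
relabelling and restriction. -/
theorem Realizes.mapProc {D : Program S} {P Q : Proc S 0 0} {α β : Act S} {e : Effect S}
    {F : Proc S 0 0 → Proc S 0 0}
    (h : Realizes D P α e)
    (hs : ∀ ρ Δ, Step D ⟨P, ρ⟩ α Δ → Step D ⟨Q, ρ⟩ β (Δ.map (Config.mapProc F)))
    (hqbv : β.qbv = α.qbv) (hτ : β ≠ .tau → α ≠ .tau)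
    (hout : ∀ c r, β = .qout c r → ∃ c', α = .qout c' r) (T : Finset QVar)
    (hq : Q.qv = P.qv ∪ T) (hF : ∀ P', (F P').qv = P'.qv ∪ T)
    (hl : Q.Legal → P.Legal ∧ Disjoint P.qv T ∧
      ∀ P', P'.Legal → P'.qv ⊆ P.qv ∪ α.qbv → (F P').Legal) :
    Realizes D Q β (e.mapProc F) where
  step ρ := by
    rw [Effect.run_mapProc]
    exact hs _ _ (h.step ρ)
  qubits := by
    rw [Effect.qubits_mapProc, hq]
    exact h.qubits.trans Finset.subset_union_left
  ret hβ := by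
    obtain ⟨P', rfl⟩ := h.ret (hτ hβ)
    exact ⟨F P', rfl⟩
  qv := by
    rw [Effect.targets_mapProc]
    rintro _ ⟨P', hP', rfl⟩
    rw [hF, hq, hqbv]
    have := h.qv P' hP'
    intro x hx
    have := fun h => @this x h
    simp only [Finset.mem_union] at *
    tauto
  out_mem c r hr := by
    obtain ⟨c', hc'⟩ := hout c r hr
    rw [hq]
    exact Finset.mem_union_left _ (h.out_mem c' r hc')
  legal hQ := by
    rw [Effect.targets_mapProc]
    rintro _ ⟨P', hP', rfl⟩
    exact (hl hQ).2.2 P' (h.legal (hl hQ).1 P' hP') (h.qv P' hP')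
  out_notMem hQ c r hr := by
    rw [Effect.targets_mapProc]
    rintro _ ⟨P', hP', rfl⟩
    obtain ⟨c', hc'⟩ := hout c r hr
    rw [hF, Finset.mem_union, not_or]
    exact ⟨h.out_notMem (hl hQ).1 c' r hc' P' hP',
      Finset.disjoint_left.1 (hl hQ).2.1 (h.out_mem c' r hc')⟩

/-- Transitions to a single process without an effect on the state. -/
theorem Realizes.of_ret {D : Program S} {P P' : Proc S 0 0} {α : Act S}
    (hs : ∀ ρ, Step D ⟨P, ρ⟩ α (PMF.pure ⟨P', ρ⟩)) (hqv : P'.qv ⊆ P.qv ∪ α.qbv)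
    (hout : ∀ c r, α = .qout c r → r ∈ P.qv ∧ (P.Legal → r ∉ P'.qv))
    (hl : P.Legal → P'.Legal) : Realizes D P α (.ret P') where
  step := hs
  qubits := Finset.empty_subset _
  ret _ := ⟨P', rfl⟩
  qv := by rintro _ rfl; exact hqv
  out_mem c r hr := (hout c r hr).1
  legal h := by rintro _ rfl; exact hl h
  out_notMem h c r hr := by rintro _ rfl; exact (hout c r hr).2 h

/-- No rule inspects the state, so a transition seen in one state is available in every state with
the same effect. The facts on free variables and legality in `Realizes` are proved along with it
because the cases of quantum communication depend on them. -/
theorem Step.exists_effect {D : Program S} {C : Config S} {α : Act S} {Δ : PMF (Config S)}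
    (h : Step D C α Δ) : ∃ e : Effect S, Δ = e.run C.state ∧ Realizes D C.proc α e := by
  induction h with
  | tau P ρ =>
    refine ⟨.ret P, rfl, .of_ret (fun ρ => .tau P ρ) ?_ (by simp) id⟩
    exact Finset.subset_union_left
  | cin c P ρ v =>
    refine ⟨.ret _, rfl, .of_ret (fun ρ => .cin c P ρ v) ?_ (by simp) (P.legal_substC v)⟩
    intro x hx
    have := P.qv_substC v hx
    simpa [Proc.mem_qv, Proc.names, Act.qbv] using this
  | cout c x P ρ =>
    refine ⟨.ret P, rfl, .of_ret (fun ρ => .cout c x P ρ) ?_ (by simp) id⟩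
    exact Finset.subset_union_left
  | qin c P ρ r hr =>
    exact ⟨.ret _, rfl, .of_ret (fun ρ => .qin c P ρ r hr) (Proc.qv_substQ c P r) (by simp)
      fun h => Proc.legal_substQ c P r h hr⟩
  | qout c q P ρ =>
    refine ⟨.ret P, rfl, .of_ret (fun ρ => .qout c q P ρ) ?_ ?_ fun h => h.2⟩
    · intro x hx
      rw [Proc.mem_qv] at hx
      simp [Proc.mem_qv, Proc.names, hx]
    · intro c' r h
      injection h with _ h
      subst h
      refine ⟨by simp [Proc.mem_qv, Proc.names], fun h => ?_⟩
      rw [Proc.mem_qv]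
      exact h.1
  | @ccomL P₁ P₁' P₂ P₂' ρ c v _ _ ih1 ih2 =>
    obtain ⟨e1, he1, h1⟩ := ih1
    obtain ⟨e2, he2, h2⟩ := ih2
    obtain rfl := h1.eq_ret (by simp) he1
    obtain rfl := h2.eq_ret (by simp) he2
    have q1 := h1.qv P₁' rfl
    have q2 := h2.qv P₂' rfl
    simp only [Act.qbv, Finset.union_empty] at q1 q2
    refine ⟨.ret (.par P₁' P₂'), rfl, .of_ret (fun ρ => .ccomL (h1.step ρ) (h2.step ρ)) ?_
      (by simp) fun h => ?_⟩
    · simp only [Proc.qv_par, Act.qbv, Finset.union_empty]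
      exact Finset.union_subset_union q1 q2
    · rw [Proc.legal_par] at h ⊢
      exact ⟨h.1.mono q1 q2, h1.legal h.2.1 _ rfl, h2.legal h.2.2 _ rfl⟩
  | @ccomR P₁ P₁' P₂ P₂' ρ c v _ _ ih1 ih2 =>
    obtain ⟨e1, he1, h1⟩ := ih1
    obtain ⟨e2, he2, h2⟩ := ih2
    obtain rfl := h1.eq_ret (by simp) he1
    obtain rfl := h2.eq_ret (by simp) he2
    have q1 := h1.qv P₁' rfl
    have q2 := h2.qv P₂' rfl
    simp only [Act.qbv, Finset.union_empty] at q1 q2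
    refine ⟨.ret (.par P₁' P₂'), rfl, .of_ret (fun ρ => .ccomR (h1.step ρ) (h2.step ρ)) ?_
      (by simp) fun h => ?_⟩
    · simp only [Proc.qv_par, Act.qbv, Finset.union_empty]
      exact Finset.union_subset_union q1 q2
    · rw [Proc.legal_par] at h ⊢
      exact ⟨h.1.mono q1 q2, h1.legal h.2.1 _ rfl, h2.legal h.2.2 _ rfl⟩
  | @qcomL P₁ P₁' P₂ P₂' ρ c r _ _ ih1 ih2 =>
    obtain ⟨e1, he1, h1⟩ := ih1
    obtain ⟨e2, he2, h2⟩ := ih2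
    obtain rfl := h1.eq_ret (by simp) he1
    obtain rfl := h2.eq_ret (by simp) he2
    have q1 := h1.qv P₁' rfl
    have q2 := h2.qv P₂' rfl
    have o := h2.out_mem c r rfl
    simp only [Act.qbv, Finset.union_empty] at q1 q2
    refine ⟨.ret (.par P₁' P₂'), rfl, .of_ret (fun ρ => .qcomL (h1.step ρ) (h2.step ρ)) ?_
      (by simp) fun h => ?_⟩
    · simp only [Proc.qv_par, Act.qbv, Finset.union_empty]
      refine Finset.union_subset (q1.trans ?_) (q2.trans Finset.subset_union_right)
      exact Finset.union_subset_union subset_rfl (Finset.singleton_subset_iff.2 o)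
    · rw [Proc.legal_par] at h ⊢
      -- The receiver gains `r`, and by legality the sender no longer has it after the output.
      refine ⟨Finset.disjoint_of_subset_left q1 ?_, h1.legal h.2.1 _ rfl, h2.legal h.2.2 _ rfl⟩
      rw [Finset.disjoint_union_left, Finset.disjoint_singleton_left]
      exact ⟨h.1.mono_right q2, h2.out_notMem h.2.2 c r rfl _ rfl⟩
  | @qcomR P₁ P₁' P₂ P₂' ρ c r _ _ ih1 ih2 =>
    obtain ⟨e1, he1, h1⟩ := ih1
    obtain ⟨e2, he2, h2⟩ := ih2
    obtain rfl := h1.eq_ret (by simp) he1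
    obtain rfl := h2.eq_ret (by simp) he2
    have q1 := h1.qv P₁' rfl
    have q2 := h2.qv P₂' rfl
    have o := h1.out_mem c r rfl
    simp only [Act.qbv, Finset.union_empty] at q1 q2
    refine ⟨.ret (.par P₁' P₂'), rfl, .of_ret (fun ρ => .qcomR (h1.step ρ) (h2.step ρ)) ?_
      (by simp) fun h => ?_⟩
    · simp only [Proc.qv_par, Act.qbv, Finset.union_empty]
      refine Finset.union_subset (q1.trans Finset.subset_union_left) (q2.trans ?_)
      exact Finset.union_subset Finset.subset_union_right
        (Finset.singleton_subset_iff.2 (Finset.mem_union_left _ o))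
    · rw [Proc.legal_par] at h ⊢
      refine ⟨Finset.disjoint_of_subset_right q2 ?_, h1.legal h.2.1 _ rfl, h2.legal h.2.2 _ rfl⟩
      rw [Finset.disjoint_union_right, Finset.disjoint_singleton_right]
      exact ⟨h.1.mono_left q1, h1.out_notMem h.2.1 c r rfl _ rfl⟩
  | op E q P ρ =>
    have hsub : Finset.univ.map q ⊆ (Proc.op E (fun i => Sum.inl (q i)) P : Proc S 0 0).qv := by
      intro x hx
      obtain ⟨i, _, rfl⟩ := Finset.mem_map.1 hx
      simp [Proc.mem_qv, Proc.names]
    refine ⟨.op E q P, rfl, fun ρ => .op E q P ρ, hsub, by simp, ?_, by simp, ?_, by simp⟩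
    · rintro _ rfl x hx
      rw [Proc.mem_qv] at hx
      simp [Proc.mem_qv, Proc.names, hx]
    · rintro h _ rfl
      exact h.2
  | meas M q P ρ =>
    have hsub : Finset.univ.map q ⊆ (Proc.meas M (fun i => Sum.inl (q i)) P : Proc S 0 0).qv := by
      intro x hx
      obtain ⟨i, _, rfl⟩ := Finset.mem_map.1 hx
      simp [Proc.mem_qv, Proc.names]
    refine ⟨.meas M q fun i => P.substC (M.value i), rfl, fun ρ => .meas M q P ρ, hsub, by simp, ?_,
      by simp, ?_, by simp⟩
    · rintro _ ⟨i, rfl⟩ x hx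
      have := P.qv_substC _ hx
      simp [Proc.mem_qv, Proc.names, this]
    · rintro h _ ⟨i, rfl⟩
      exact P.legal_substC _ h.2
  | @intL P₁ P₂ ρ α Δ _ hd ih =>
    obtain ⟨e, rfl, he⟩ := ih
    refine ⟨e.mapProc fun P => .par P P₂, (Effect.run_mapProc _ _ _).symm,
      he.mapProc (fun ρ Δ h => .intL h hd) rfl id (fun c r h => ⟨c, h⟩) P₂.qv
      (Proc.qv_par _ _) (fun P' => Proc.qv_par _ _) fun h => ?_⟩
    rw [Proc.legal_par] at h
    refine ⟨h.2.1, h.1, fun P' hP' hq => Proc.legal_par.2 ⟨?_, hP', h.2.2⟩⟩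
    exact Finset.disjoint_of_subset_left hq (Finset.disjoint_union_left.2 ⟨h.1, hd⟩)
  | @intR P₁ P₂ ρ α Δ _ hd ih =>
    obtain ⟨e, rfl, he⟩ := ih
    refine ⟨e.mapProc fun P => .par P₁ P, (Effect.run_mapProc _ _ _).symm,
      he.mapProc (fun ρ Δ h => .intR h hd) rfl id (fun c r h => ⟨c, h⟩) P₁.qv
      ((Proc.qv_par _ _).trans (Finset.union_comm _ _))
      (fun P' => (Proc.qv_par _ _).trans (Finset.union_comm _ _)) fun h => ?_⟩
    rw [Proc.legal_par] at h
    refine ⟨h.2.2, h.1.symm, fun P' hP' hq => Proc.legal_par.2 ⟨?_, h.2.1, hP'⟩⟩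
    exact Finset.disjoint_of_subset_right hq (Finset.disjoint_union_right.2 ⟨h.1, hd.symm⟩)
  | sumL _ ih =>
    obtain ⟨e, rfl, he⟩ := ih
    exact ⟨e, rfl, he.weaken (fun ρ Δ h => .sumL h)
      (fun x hx => by rw [Proc.mem_qv] at *; simp [Proc.names, hx]) fun h => h.1⟩
  | sumR _ ih =>
    obtain ⟨e, rfl, he⟩ := ih
    exact ⟨e, rfl, he.weaken (fun ρ Δ h => .sumR h)
      (fun x hx => by rw [Proc.mem_qv] at *; simp [Proc.names, hx]) fun h => h.2⟩
  | @rel P f ρ α Δ _ ih =>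
    obtain ⟨e, rfl, he⟩ := ih
    refine ⟨e.mapProc fun P => .rel f P, (Effect.run_mapProc _ _ _).symm,
      he.mapProc (fun ρ Δ h => .rel h) (Act.qbv_relabel f α) ?_ ?_ ∅
      (Finset.union_empty _).symm (fun P' => (Finset.union_empty _).symm) fun h =>
        ⟨h, Finset.disjoint_empty_right _, fun P' h _ => h⟩⟩
    · rintro h rfl
      exact h rfl
    · intro c r h
      cases α <;> simp only [Act.relabel, reduceCtorEq, Act.qout.injEq] at h
      exact ⟨_, by rw [h.2]⟩
  | @res P L ρ α Δ _ hd ih =>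
    obtain ⟨e, rfl, he⟩ := ih
    exact ⟨e.mapProc fun P => .res L P, (Effect.run_mapProc _ _ _).symm,
      he.mapProc (fun ρ Δ h => .res h hd) rfl id (fun c r h => ⟨c, h⟩) ∅
      (Finset.union_empty _).symm (fun P' => (Finset.union_empty _).symm) fun h =>
        ⟨h, Finset.disjoint_empty_right _, fun P' h _ => h⟩⟩
  | cond _ hb ih =>
    obtain ⟨e, rfl, he⟩ := ih
    exact ⟨e, rfl, he.weaken (fun ρ Δ h => .cond h hb) (fun x hx => hx) fun h => h⟩
  | const A r v _ ih =>
    obtain ⟨e, rfl, he⟩ := ih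
    refine ⟨e, rfl, he.weaken (fun ρ Δ h => .const A r v h) (fun x hx => ?_) fun h => ?_⟩
    · rw [Proc.mem_qv] at *
      obtain ⟨y, hy, hyx⟩ := Finset.mem_image.1 ((D.body A).names_inst _ _ hx)
      rcases y with y | i
      · exact absurd hy (D.names_subset A y)
      · have : r i = x := Sum.inl_injective hyx
        subst this
        simp [Proc.names]
    · refine (D.body A).legal_inst _ _ (D.legal A) fun x hx y hy hxy => ?_
      rcases x with x | i
      · exact absurd hx (D.names_subset A x)
      rcases y with y | j
      · exact absurd hy (D.names_subset A y)
      · exact congrArg Sum.inr (h hxy)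

theorem Step.finite_support {D : Program S} {C : Config S} {α : Act S} {Δ : PMF (Config S)}
    (h : Step D C α Δ) : Δ.support.Finite := by
  obtain ⟨e, rfl, _⟩ := h.exists_effect
  exact e.finite_support _

theorem Step.qv_subset {D : Program S} {C C' : Config S} {α : Act S} {Δ : PMF (Config S)}
    (h : Step D C α Δ) (hC : C' ∈ Δ.support) : C'.qv ⊆ C.qv ∪ α.qbv := by
  obtain ⟨e, rfl, he⟩ := h.exists_effect
  exact he.qv _ (Effect.proc_mem_targets hC)

end Effects

/-! ### Weak transitions of configurations. -/

section Weak

variable {S : Sig} {D : Program S}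

theorem HatTau.finite_support {s : Config S} {Θ : PMF (Config S)} (h : HatTau D s Θ) :
    Θ.support.Finite := by
  rcases h with h | rfl
  · exact h.finite_support
  · exact finite_support_pure s

theorem HatTau.refl (s : Config S) : HatTau D s (PMF.pure s) := Or.inr rfl

theorem WeakTau.bind {X : Type} (p : PMF X) (f g : X → PMF (Config S)) (hp : p.support.Finite)
    (hf : ∀ x ∈ p.support, (f x).support.Finite) (h : ∀ x ∈ p.support, WeakTau D (f x) (g x)) :
    WeakTau D (p.bind f) (p.bind g) :=
  reflTransGen_bind (fun _ _ h => h.finite_support) HatTau.refl hp hf h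

theorem weak_iff {α : Act S} (hα : α ≠ .tau) (Δ Θ : PMF (Config S)) : Weak D α Δ Θ ↔
    ∃ Δ₁ Δ₂, WeakTau D Δ Δ₁ ∧ Lift (fun s => Step D s α) Δ₁ Δ₂ ∧ WeakTau D Δ₂ Θ := by
  cases α <;> first | exact absurd rfl hα | exact Iff.rfl

theorem Step.weak {C : Config S} {α : Act S} {Θ : PMF (Config S)} (h : Step D C α Θ) :
    Weak D α (PMF.pure C) Θ := by
  by_cases hα : α = .tau
  · subst hα
    exact .single (.point (Or.inl h))
  · exact (weak_iff hα _ _).2 ⟨_, _, .refl, .point h, .refl⟩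

/-! ### Conditioning of configurations -/

/-- The probability of the condition in the state of a configuration. -/
def condWeight (v : QVar ↪ QVar) (C : Config S) : ENNReal := ENNReal.ofReal (condProb v C.state)

/-- The configuration with the conditioned state. -/
def condConfig (v : QVar ↪ QVar) (C : Config S) : Config S := ⟨C.proc, condState v C.state⟩

/-- The conditioned distribution. -/
def condDist (v : QVar ↪ QVar) (Δ : PMF (Config S)) : PMF (Config S) :=
  (reweight Δ (condWeight v)).map (condConfig v)

theorem condWeight_le_one (v : QVar ↪ QVar) (C : Config S) : condWeight v C ≤ 1 :=
  ENNReal.ofReal_le_one.2 (condProb_le_one v _)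

theorem condWeight_ne_zero {v : QVar ↪ QVar} {C : Config S} :
    condWeight v C ≠ 0 ↔ condProb v C.state ≠ 0 := by
  rw [condWeight, Ne, ENNReal.ofReal_eq_zero, not_le]
  exact ⟨ne_of_gt, fun h => lt_of_le_of_ne (condProb_nonneg v _) h.symm⟩

theorem condDist_pure (v : QVar ↪ QVar) (C : Config S) :
    condDist v (PMF.pure C) = PMF.pure (condConfig v C) := by
  rw [condDist, reweight_pure, PMF.pure_map]

/-- The effect acts on qubits that `v` fixes, while the condition concerns other qubits; the
probability of the condition is thus preserved, for measurements on average over the outcomes. -/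
theorem Effect.expect_run {v : QVar ↪ QVar} {e : Effect S} (hv : Fixes v e.qubits) (ρ : QState) :
    expect (e.run ρ) (condWeight v) = ENNReal.ofReal (condProb v ρ) := by
  cases e with
  | ret P => exact expect_pure _ _
  | op E q P =>
    rw [run, expect_pure]
    exact congrArg ENNReal.ofReal (condProb_extend_tuple hv E ρ)
  | meas M q P =>
    rw [run, expect_map, expect, tsum_fintype]
    simp only [Measurement.outcome, PMF.ofFintype_apply, Function.comp_apply, condWeight]
    simp_rw [← ENNReal.ofReal_mul (M.prob_nonneg q ρ _)]
    rw [← ENNReal.ofReal_sum_of_nonneg fun i _ =>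
      mul_nonneg (M.prob_nonneg q ρ i) (condProb_nonneg v _), sum_prob_mul_condProb hv M ρ]

/-- Effects commute with conditioning. For a measurement, Bayes' rule turns the outcome distribution
of `ρ` into that of the conditioned state, and outcomes excluded by the condition leave the support.
-/
theorem Effect.condDist_run {v : QVar ↪ QVar} {e : Effect S} (hv : Fixes v e.qubits) {ρ : QState}
    (h0 : condProb v ρ ≠ 0) : condDist v (e.run ρ) = e.run (condState v ρ) := by
  cases e with
  | ret P => exact condDist_pure _ _
  | op E q P =>
    rw [run, run, condDist_pure, condConfig, (condState_extend_tuple hv E h0).2]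
  | meas M q P =>
    have he : expect ((Effect.meas M q P).run ρ) (condWeight v) ≠ 0 := by
      rw [expect_run hv]
      exact (condWeight_ne_zero (C := (⟨.nil, ρ⟩ : Config S))).2 h0
    have he1 : expect ((Effect.meas M q P).run ρ) (condWeight v) ≠ ⊤ :=
      expect_ne_top (condWeight_le_one v)
    have hev := expect_run hv ρ
    rw [run] at he he1 hev
    rw [run, run, condDist, reweight_map (condWeight_le_one v) he, PMF.map_comp]
    rw [expect_map] at he he1 hev
    have hpos : 0 < condProb v ρ := lt_of_le_of_ne (condProb_nonneg v ρ) h0.symm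
    have hw : reweight (M.outcome q ρ)
        (condWeight v ∘ fun i => (⟨P i, M.post q ρ i⟩ : Config S))
        = M.outcome q (condState v ρ) := by
      ext i
      rw [reweight_apply he he1, hev]
      simp only [Measurement.outcome, PMF.ofFintype_apply, Function.comp_apply, condWeight]
      rw [prob_condState hv M h0, ← ENNReal.ofReal_mul (M.prob_nonneg q ρ i),
        ← ENNReal.ofReal_inv_of_pos hpos, ← ENNReal.ofReal_mul
          (mul_nonneg (M.prob_nonneg q ρ i) (condProb_nonneg v _)), mul_comm]
    rw [← hw]
    refine map_congr_support fun i hi => ?_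
    obtain ⟨hi1, hi2⟩ := (mem_support_reweight he he1 i).1 hi
    have h1 : M.prob q ρ i ≠ 0 := by
      intro h
      rw [PMF.mem_support_iff, Measurement.outcome, PMF.ofFintype_apply, h] at hi1
      simp at hi1
    have h2 := condWeight_ne_zero.1 hi2
    change (⟨P i, condState v (M.post q ρ i)⟩ : Config S) = _
    rw [post_condState hv M h0 i h1 h2]

theorem Step.expect_eq {v : QVar ↪ QVar} {C : Config S} {α : Act S} {Δ : PMF (Config S)}
    (h : Step D C α Δ) (hv : Fixes v C.qv) : expect Δ (condWeight v) = condWeight v C := by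
  obtain ⟨e, rfl, he⟩ := h.exists_effect
  exact e.expect_run (hv.mono he.qubits) _

theorem Step.condConfig {v : QVar ↪ QVar} {C : Config S} {α : Act S} {Δ : PMF (Config S)}
    (h : Step D C α Δ) (hv : Fixes v C.qv) (h0 : condWeight v C ≠ 0) :
    Step D (QCCS.condConfig v C) α (condDist v Δ) := by
  obtain ⟨e, rfl, he⟩ := h.exists_effect
  rw [e.condDist_run (hv.mono he.qubits) (condWeight_ne_zero.1 h0)]
  exact he.step _

theorem Lift.forall_support {R : Config S → PMF (Config S) → Prop} {Δ Θ : PMF (Config S)}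
    (h : Lift R Δ Θ) {p : Config S → Prop}
    (hp : ∀ s ∈ Δ.support, ∀ Ψ, R s Ψ → ∀ t ∈ Ψ.support, p t) : ∀ t ∈ Θ.support, p t := by
  obtain ⟨ω, _, h2, rfl, rfl⟩ := h.exists_coupling
  intro t ht
  obtain ⟨x, hx, hxt⟩ := (PMF.mem_support_bind_iff _ _ _).1 ht
  exact hp x.1 ((PMF.mem_support_map_iff _ _ _).2 ⟨x, hx, rfl⟩) _ (h2 x hx) t hxt

/-- A τ-step adds no free variables, so `v` keeps fixing the variables in use; the set `U` reserves
the variable that a subsequent input receives. The total weight of the condition is constant along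
the sequence, so conditioning takes each lifted step to a lifted step by `Lift.reweight`. -/
theorem WeakTau.cond {v : QVar ↪ QVar} {U : Finset QVar} {Δ Θ : PMF (Config S)}
    (h : WeakTau D Δ Θ) (hv : ∀ s ∈ Δ.support, Fixes v (s.qv ∪ U)) :
    (∀ s ∈ Θ.support, Fixes v (s.qv ∪ U)) ∧
    expect Θ (condWeight v) = expect Δ (condWeight v) ∧
    (expect Δ (condWeight v) ≠ 0 → WeakTau D (condDist v Δ) (condDist v Θ)) := by
  induction h with
  | refl => exact ⟨hv, rfl, fun _ => .refl⟩
  | @tail Θ Θ' _ hs ih =>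
    obtain ⟨h1, h2, h3⟩ := ih
    have hstep := hs.reweight (R' := HatTau D) (condWeight_le_one v) (c := condConfig v)
      (fun s hs Ψ hΨ => by
        rcases hΨ with hΨ | rfl
        · exact hΨ.expect_eq ((h1 s hs).mono Finset.subset_union_left)
        · exact expect_pure _ _)
      (fun s hs Ψ hΨ h0 => by
        rcases hΨ with hΨ | rfl
        · exact Or.inl (hΨ.condConfig ((h1 s hs).mono Finset.subset_union_left) h0)
        · exact Or.inr (condDist_pure v s))
    refine ⟨hs.forall_support fun s hs Ψ hΨ t ht => ?_, hstep.1.trans h2, fun h0 =>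
      (h3 h0).tail (hstep.2 (h2 ▸ h0))⟩
    rcases hΨ with hΨ | rfl
    · refine (h1 s hs).mono (Finset.union_subset_union ?_ subset_rfl)
      simpa [Act.qbv] using hΨ.qv_subset ht
    · rw [PMF.mem_support_pure_iff] at ht
      exact ht ▸ h1 s hs

theorem Weak.cond {v : QVar ↪ QVar} {α : Act S} {Δ Θ : PMF (Config S)}
    (h : Weak D α Δ Θ) (hv : ∀ s ∈ Δ.support, Fixes v (s.qv ∪ α.qbv))
    (h0 : expect Δ (condWeight v) ≠ 0) : Weak D α (condDist v Δ) (condDist v Θ) := by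
  by_cases hα : α = .tau
  · subst hα
    exact (WeakTau.cond h hv).2.2 h0
  · rw [weak_iff hα] at h ⊢
    obtain ⟨Δ₁, Δ₂, w1, hs, w2⟩ := h
    obtain ⟨v1, e1, c1⟩ := w1.cond hv
    have hstep := hs.reweight (R' := fun s => Step D s α) (condWeight_le_one v) (c := condConfig v)
      (fun s hs Ψ hΨ => hΨ.expect_eq ((v1 s hs).mono Finset.subset_union_left))
      (fun s hs Ψ hΨ h0 => hΨ.condConfig ((v1 s hs).mono Finset.subset_union_left) h0)
    have v2 : ∀ s ∈ Δ₂.support, Fixes v (s.qv ∪ α.qbv) :=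
      hs.forall_support fun s hs Ψ hΨ t ht =>
        (v1 s hs).mono (Finset.union_subset (hΨ.qv_subset ht) Finset.subset_union_right)
    obtain ⟨_, _, c2⟩ := w2.cond v2
    exact ⟨_, _, c1 h0, hstep.2 (e1 ▸ h0), c2 (hstep.1 ▸ e1 ▸ h0)⟩

end Weak

/-! ## Open bisimilarity is preserved by super-operators and by conditioning -/

section OpenBisimilarity

variable {S : Sig} {D : Program S}

theorem IsOpenBisimulation.of_symmetric {R : Config S → Config S → Prop}
    (hs : ∀ C C', R C C' → R C' C) (h1 : ∀ C C', R C C' → C.Legal) (h2 : IsOpenSimulation D R) :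
    IsOpenBisimulation D R := by
  refine ⟨fun C C' h => ⟨h1 _ _ h, h1 _ _ (hs _ _ h)⟩, h2, ?_⟩
  have : (fun C C' => R C' C) = R := by
    funext C C'
    exact propext ⟨hs _ _, hs _ _⟩
  rwa [this]

theorem OpenBisimilar.symm {C C' : Config S} (h : OpenBisimilar D C C') : OpenBisimilar D C' C := by
  obtain ⟨R, hR, h⟩ := h
  exact ⟨fun C C' => R C' C, ⟨fun C C' h => (hR.1 _ _ h).symm, hR.2.2, hR.2.1⟩, h⟩

theorem OpenBisimilar.legal {C C' : Config S} (h : OpenBisimilar D C C') : C.Legal :=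
  ((isGreatest_openBisimilar D).1.1 _ _ h).1

theorem OpenBisimilar.sameEnv {C C' : Config S} (h : OpenBisimilar D C C') : SameEnv C C' :=
  ((isGreatest_openBisimilar D).1.2.1 _ _ h).1

theorem Config.applyOutside_comp (C : Config S) (T : Finset QVar) (E F : SuperOp (Env T)) :
    C.applyOutside T (F.comp E) = (C.applyOutside T E).applyOutside T F := by
  rw [applyOutside, SuperOp.comp_extend]
  rfl

theorem Config.applyOutside_id (C : Config S) (T : Finset QVar) :
    C.applyOutside T (SuperOp.id _) = C := by
  rw [applyOutside, SuperOp.id_extend]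

theorem OpenBisimilar.simulate {C C' : Config S} (h : OpenBisimilar D C C') {α : Act S}
    {Δ : PMF (Config S)} (hs : Step D C α Δ) :
    ∃ Θ, Weak D α (PMF.pure C') Θ ∧ LiftState (OpenBisimilar D) Δ Θ := by
  have := ((isGreatest_openBisimilar D).1.2.1 _ _ h).2 (SuperOp.id _) α Δ
  rw [Config.applyOutside_id, Config.applyOutside_id] at this
  exact this hs

theorem SameEnv.applyOutside {C C' : Config S} (h : SameEnv C C') (E : SuperOp (Env C.qv)) :
    SameEnv (C.applyOutside C.qv E) (C'.applyOutside C.qv E) :=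
  ⟨h.1, ptr_extend _ E h.2⟩

/-- A further super-operator `F` after `E` is covered by the quantification over super-operators in
the definition, applied to `F.comp E`. -/
theorem OpenBisimilar.applyOutside {C C' : Config S} (h : OpenBisimilar D C C')
    (E : SuperOp (Env C.qv)) :
    OpenBisimilar D (C.applyOutside C.qv E) (C'.applyOutside C.qv E) := by
  -- `T` is kept apart from `C.qv` so that `C` and `C'` can be exchanged without transporting `E`.
  -- Successor pairs return to the relation with the identity in place of `E`.
  refine ⟨fun A B => ∃ (C C' : Config S) (T : Finset QVar) (E : SuperOp (Env T)),
    OpenBisimilar D C C' ∧ T = C.qv ∧ A = C.applyOutside T E ∧ B = C'.applyOutside T E,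
    .of_symmetric ?_ ?_ ?_, C, C', C.qv, E, h, rfl, rfl, rfl⟩
  · rintro _ _ ⟨C, C', T, E, h, hT, rfl, rfl⟩
    exact ⟨C', C, T, E, h.symm, hT.trans h.sameEnv.1, rfl, rfl⟩
  · rintro _ _ ⟨C, C', T, E, h, hT, rfl, rfl⟩
    exact h.legal
  · rintro _ _ ⟨C, C', T, E, h, rfl, rfl, rfl⟩
    refine ⟨h.sameEnv.applyOutside E, fun (F : SuperOp (Env C.qv)) α Δ hs => ?_⟩
    have := ((isGreatest_openBisimilar D).1.2.1 _ _ h).2 (F.comp E) α Δ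
    rw [Config.applyOutside_comp, Config.applyOutside_comp] at this
    obtain ⟨Θ, h1, h2⟩ := this hs
    exact ⟨Θ, h1, h2.mono fun s t hst => ⟨s, t, _, SuperOp.id _, hst, rfl,
      (s.applyOutside_id _).symm, (t.applyOutside_id _).symm⟩⟩

/-- Bisimilar configurations, conditioned on the state of the environment. -/
def CondBisimilar (D : Program S) (A B : Config S) : Prop :=
  ∃ (C C' : Config S) (v : QVar ↪ QVar), OpenBisimilar D C C' ∧ Fixes v C.qv ∧
    condProb v C.state ≠ 0 ∧ A = condConfig v C ∧ B = condConfig v C'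

/-- An action receives at most one variable; for the others the choice `0` is immaterial. -/
theorem Act.exists_qbv_subset (α : Act S) : ∃ r, α.qbv ⊆ {r} := by
  cases α with
  | qin c r => exact ⟨r, subset_rfl⟩
  | _ => exact ⟨0, Finset.empty_subset _⟩

/-- The move is repeated without the condition, answered by bisimilarity, and the answer is
conditioned. That `v` also fixes a received variable ensures that it fixes all variables of the
successors. -/
theorem CondBisimilar.simulate {C C' : Config S} {v : QVar ↪ QVar} {α : Act S}
    (h : OpenBisimilar D C C') (hv : Fixes v (C.qv ∪ α.qbv)) (h0 : condProb v C.state ≠ 0)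
    {Δ : PMF (Config S)} (hs : Step D (condConfig v C) α Δ) :
    ∃ Θ, Weak D α (PMF.pure (condConfig v C')) Θ ∧ LiftState (CondBisimilar D) Δ Θ := by
  obtain ⟨e, rfl, he⟩ := hs.exists_effect
  have hvC : Fixes v C.qv := hv.mono Finset.subset_union_left
  -- The same effect, run from the unconditioned state.
  have hstep : Step D C α (e.run C.state) := he.step C.state
  obtain ⟨Θ, hw, hl⟩ := h.simulate hstep
  have hC' : condWeight v C' = condWeight v C :=
    congrArg ENNReal.ofReal (condProb_congr hvC h.sameEnv.2).symm
  have hw' := hw.cond (v := v)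
    (fun s hs => by
      rw [PMF.mem_support_pure_iff] at hs
      rwa [hs, ← h.sameEnv.1])
    (by rw [expect_pure, hC']; exact condWeight_ne_zero.2 h0)
  rw [condDist_pure] at hw'
  refine ⟨_, hw', ?_⟩
  have hq : ∀ s ∈ (e.run C.state).support, Fixes v s.qv := fun s hs => hv.mono (hstep.qv_subset hs)
  have hr := Lift.reweight (R' := fun s Ψ => ∃ t, CondBisimilar D s t ∧ Ψ = PMF.pure t)
    (condWeight_le_one v) (c := condConfig v) hl
    (fun s hs Ψ hΨ => by
      obtain ⟨t, ht, rfl⟩ := hΨ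
      rw [expect_pure]
      exact congrArg ENNReal.ofReal (condProb_congr (hq s hs) ht.sameEnv.2).symm)
    (fun s hs Ψ hΨ h0 => by
      obtain ⟨t, ht, rfl⟩ := hΨ
      exact ⟨condConfig v t, ⟨s, t, v, ht, hq s hs, condWeight_ne_zero.1 h0, rfl, rfl⟩,
        condDist_pure v t⟩)
  have h1 := hr.2 (by
    rw [hstep.expect_eq hvC]
    exact condWeight_ne_zero.2 h0)
  have h2 := e.condDist_run (hvC.mono he.qubits) h0
  rw [condDist] at h2
  rw [h2] at h1
  exact h1

/-- Conditioned bisimilar pairs form an open bisimulation: a super-operator following the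
conditioning is absorbed into one preceding it, which returns the situation to
`CondBisimilar.simulate`. -/
theorem CondBisimilar.openBisimilar {A B : Config S} (h : CondBisimilar D A B) :
    OpenBisimilar D A B := by
  refine ⟨CondBisimilar D, .of_symmetric ?_ ?_ ?_, h⟩
  · rintro _ _ ⟨C, C', v, h, hv, h0, rfl, rfl⟩
    exact ⟨C', C, v, h.symm, h.sameEnv.1 ▸ hv, condProb_congr hv h.sameEnv.2 ▸ h0, rfl, rfl⟩
  · rintro _ _ ⟨C, C', v, h, hv, h0, rfl, rfl⟩
    exact h.legal
  · rintro _ _ ⟨C, C', v, h, hv, h0, rfl, rfl⟩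
    refine ⟨⟨h.sameEnv.1, ptr_condState hv h.sameEnv.2 h0⟩,
      fun (E : SuperOp (Env C.qv)) α Δ hs => ?_⟩
    have h0' : condProb v C'.state ≠ 0 := condProb_congr hv h.sameEnv.2 ▸ h0
    -- The action may receive a variable that `v` moves. The permutation `F` of the environment
    -- replaces `v` by some `v'` fixing `r` as well, without changing the conditioned states.
    obtain ⟨r, hr⟩ := α.exists_qbv_subset
    obtain ⟨v', F, hv', hF⟩ := exists_fixes_insert hv r
    have key : ∀ B : Config S, condProb v B.state ≠ 0 →
        condProb v' (B.applyOutside C.qv (F.comp (E.ampl hv.rangeEquiv))).state ≠ 0 ∧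
        (condConfig v B).applyOutside C.qv E
          = condConfig v' (B.applyOutside C.qv (F.comp (E.ampl hv.rangeEquiv))) := by
      intro B hB
      obtain ⟨e1, e2⟩ := extend_condState hv E hB
      obtain ⟨e3, e4⟩ := hF ((E.ampl hv.rangeEquiv).extend (splitEquiv C.qv) B.state)
      rw [Config.applyOutside_comp]
      constructor
      · change condProb v' (F.extend _ ((E.ampl _).extend _ _)) ≠ 0
        rwa [e3, e1]
      · change (⟨B.proc, _⟩ : Config S) = ⟨B.proc, _⟩
        congr 1
        change E.extend _ (condState v B.state) = condState v' (F.extend _ ((E.ampl _).extend _ _))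
        rw [e4 (by rwa [e1]), e2]
    change Step D ((condConfig v C).applyOutside C.qv E) α Δ at hs
    change ∃ Θ, Weak D α (PMF.pure ((condConfig v C').applyOutside C.qv E)) Θ ∧ _
    rw [(key C h0).2] at hs
    rw [(key C' h0').2]
    refine CondBisimilar.simulate (h.applyOutside _) (hv'.mono ?_) (key C h0).1 hs
    rw [Finset.insert_eq, Finset.union_comm]
    exact Finset.union_subset_union hr subset_rfl

/-- Measurements by the environment. -/
theorem OpenBisimilar.post {C C' : Config S} (h : OpenBisimilar D C C') {n : ℕ} (M : Measurement n)
    (q : Fin n ↪ QVar) (hd : Disjoint (Finset.univ.map q) C.qv) (i : Fin n → Bool) :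
    M.prob q C.state i = M.prob q C'.state i ∧ (M.prob q C.state i ≠ 0 →
      OpenBisimilar D ⟨C.proc, M.post q C.state i⟩ ⟨C'.proc, M.post q C'.state i⟩) := by
  obtain ⟨v, F, hv, hF⟩ := exists_condState_eq_post M q hd i
  have hb := h.applyOutside F
  have hp : M.prob q C.state i = M.prob q C'.state i := by
    rw [← (hF C.state).1, ← (hF C'.state).1]
    exact condProb_congr hv hb.sameEnv.2
  refine ⟨hp, fun h0 => ?_⟩
  have := CondBisimilar.openBisimilar ⟨_, _, v, hb, hv,
    (by change condProb v (F.extend _ _) ≠ 0; rwa [(hF C.state).1]), rfl, rfl⟩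
  rw [← (hF C.state).2 h0, ← (hF C'.state).2 (hp ▸ h0)]
  exact this

end OpenBisimilarity

/-! ## Open bisimilarity is preserved by parallel composition -/

section Parallel

variable {S : Sig} {D : Program S}

theorem Step.par {C : Config S} {α : Act S} {Δ : PMF (Config S)} (h : Step D C α Δ)
    {T : Proc S 0 0} (hd : Disjoint α.qbv T.qv) :
    Step D (C.par T) α (Δ.map fun B => B.par T) := .intL h hd

theorem HatTau.par {C : Config S} {Δ : PMF (Config S)} (h : HatTau D C Δ) (T : Proc S 0 0) :
    HatTau D (C.par T) (Δ.map fun B => B.par T) := by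
  rcases h with h | rfl
  · exact Or.inl (h.par (Finset.disjoint_empty_left _))
  · exact Or.inr (PMF.pure_map _ _)

theorem WeakTau.par {Δ Θ : PMF (Config S)} (h : WeakTau D Δ Θ) (T : Proc S 0 0) :
    WeakTau D (Δ.map fun B => B.par T) (Θ.map fun B => B.par T) :=
  Relation.ReflTransGen.lift (fun Δ : PMF (Config S) => Δ.map fun B : Config S => B.par T)
    (fun _ _ h => Lift.map _ _ h fun _ _ _ hs => hs.par T) _ _ h

theorem Weak.par {α : Act S} {Δ Θ : PMF (Config S)} (h : Weak D α Δ Θ) {T : Proc S 0 0}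
    (hd : Disjoint α.qbv T.qv) : Weak D α (Δ.map fun B => B.par T) (Θ.map fun B => B.par T) := by
  by_cases hα : α = .tau
  · subst hα
    exact WeakTau.par h T
  · rw [weak_iff hα] at h ⊢
    obtain ⟨Δ₁, Δ₂, w1, hs, w2⟩ := h
    exact ⟨_, _, w1.par T, hs.map _ _ fun _ _ _ h => h.par hd, w2.par T⟩

/-- Bisimilar configurations in parallel with the same process. -/
def ParBisimilar (D : Program S) (A B : Config S) : Prop :=
  ∃ (C C' : Config S) (T : Proc S 0 0), OpenBisimilar D C C' ∧ T.Legal ∧ Disjoint C.qv T.qv ∧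
    A = C.par T ∧ B = C'.par T

theorem LiftState.par {Δ Θ : PMF (Config S)} (h : LiftState (OpenBisimilar D) Δ Θ)
    {T : Proc S 0 0} (hT : T.Legal) (hd : ∀ s ∈ Δ.support, Disjoint s.qv T.qv) :
    LiftState (ParBisimilar D) (Δ.map fun B => B.par T) (Θ.map fun B => B.par T) := by
  refine Lift.map _ _ h fun s hs Ψ hΨ => ?_
  obtain ⟨t, ht, rfl⟩ := hΨ
  exact ⟨t.par T, ⟨s, t, T, ht, hT, hd s hs, rfl, rfl⟩, PMF.pure_map _ _⟩

/-- Matching a communication between a configuration and its environment. -/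
theorem ParBisimilar.simulate_com {C C' B : Config S} {α : Act S} {T T' : Proc S 0 0}
    (h : OpenBisimilar D C C') (hα : α ≠ .tau) (hs : Step D C α (PMF.pure B))
    (hcom : ∀ (P P' : Proc S 0 0) (ρ : QState), Step D ⟨P, ρ⟩ α (PMF.pure ⟨P', ρ⟩) →
      Step D ⟨.par P T, ρ⟩ .tau (PMF.pure ⟨.par P' T', ρ⟩))
    (hT : T'.Legal) (hd : Disjoint B.qv T'.qv) :
    ∃ Θ, Weak D .tau (PMF.pure (C'.par T)) Θ ∧
      LiftState (ParBisimilar D) (PMF.pure (B.par T')) Θ := by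
  obtain ⟨Θ, hw, hl⟩ := h.simulate hs
  obtain ⟨Δ₁, Δ₂, w1, hs, w2⟩ := (weak_iff hα _ _).1 hw
  have w1' := w1.par T
  rw [PMF.pure_map] at w1'
  have hl' := hl.par hT (by
    intro s hs
    rw [PMF.mem_support_pure_iff] at hs
    rwa [hs])
  rw [PMF.pure_map] at hl'
  -- All branches perform the visible action in one lifted step; with the partner action of `T` each
  -- becomes a τ-step, after which `T'` runs alongside.
  refine ⟨_, w1'.trans ((Relation.ReflTransGen.single ?_).trans (w2.par T')), hl'⟩
  refine hs.map _ _ fun s _ Ψ hΨ => Or.inl ?_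
  obtain ⟨e, rfl, he⟩ := hΨ.exists_effect
  obtain ⟨P', rfl⟩ := he.ret hα
  rw [Effect.run, PMF.pure_map]
  exact hcom _ _ _ (he.step s.state)

/-- Matching a transition of the environment. -/
theorem ParBisimilar.of_effect {C C' : Config S} (h : OpenBisimilar D C C') (e : Effect S)
    (hT : ∀ T ∈ e.targets, T.Legal ∧ Disjoint C.qv T.qv) (hq : Disjoint e.qubits C.qv) :
    LiftState (ParBisimilar D) ((e.run C.state).map (Config.mapProc fun T => .par C.proc T))
      ((e.run C'.state).map (Config.mapProc fun T => .par C'.proc T)) := by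
  cases e with
  | ret T =>
    obtain ⟨h1, h2⟩ := hT T rfl
    rw [Effect.run, Effect.run, PMF.pure_map, PMF.pure_map]
    exact .point ⟨_, ⟨C, C', T, h, h1, h2, rfl, rfl⟩, rfl⟩
  | op E q T =>
    obtain ⟨h1, h2⟩ := hT T rfl
    obtain ⟨F, hF⟩ := exists_extend_tuple q hq E
    rw [Effect.run, Effect.run, PMF.pure_map, PMF.pure_map, ← hF, ← hF]
    exact .point ⟨_, ⟨_, _, T, h.applyOutside F, h1, h2, rfl, rfl⟩, rfl⟩
  | meas M q T =>
    have ho : M.outcome q C'.state = M.outcome q C.state := by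
      ext i
      simp only [Measurement.outcome, PMF.ofFintype_apply, (h.post M q hq i).1]
    rw [Effect.run, Effect.run, PMF.map_comp, PMF.map_comp, ho]
    -- The outcome distributions agree, so branches with the same outcome are paired; only outcomes
    -- of nonzero probability occur.
    refine LiftState.of_coupling (Set.toFinite _) _ _ fun i hi => ?_
    have h0 : M.prob q C.state i ≠ 0 := by
      intro h
      rw [PMF.mem_support_iff, Measurement.outcome, PMF.ofFintype_apply, h] at hi
      simp at hi
    obtain ⟨h1, h2⟩ := hT (T i) ⟨i, rfl⟩
    exact ⟨_, _, T i, (h.post M q hq i).2 h0, h1, h2, rfl, rfl⟩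

/-- Case distinction on who moves. In quantum communications, legality makes the sender give up the
transferred variable, so the two sides still share none. -/
theorem ParBisimilar.simulate {C C' : Config S} {T : Proc S 0 0} (h : OpenBisimilar D C C')
    (hT : T.Legal) (hd : Disjoint C.qv T.qv) {α : Act S} {Δ : PMF (Config S)}
    (hs : Step D (C.par T) α Δ) :
    ∃ Θ, Weak D α (PMF.pure (C'.par T)) Θ ∧ LiftState (ParBisimilar D) Δ Θ := by
  obtain ⟨P, ρ⟩ := C
  have hret : ∀ {P P' : Proc S 0 0} {α : Act S}, α ≠ .tau →
      Step D ⟨P, ρ⟩ α (PMF.pure ⟨P', ρ⟩) → Realizes D P α (.ret P') := by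
    intro P P' α hα h
    obtain ⟨e, he, hr⟩ := h.exists_effect
    exact hr.eq_ret hα he ▸ hr
  change Step D ⟨.par P T, ρ⟩ α Δ at hs
  change Disjoint P.qv T.qv at hd
  cases hs with
  | @ccomL _ P' _ T' _ c v h1 h2 =>
    have r1 := hret (by simp) h1
    have r2 := hret (by simp) h2
    refine ParBisimilar.simulate_com h (by simp) h1
      (fun Q Q' σ hQ => .ccomL hQ (r2.step σ)) (r2.legal hT _ rfl) ?_
    change Disjoint P'.qv T'.qv
    exact hd.mono (by simpa [Act.qbv] using r1.qv _ rfl) (by simpa [Act.qbv] using r2.qv _ rfl)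
  | @ccomR _ P' _ T' _ c v h1 h2 =>
    have r1 := hret (by simp) h1
    have r2 := hret (by simp) h2
    refine ParBisimilar.simulate_com h (by simp) h1
      (fun Q Q' σ hQ => .ccomR hQ (r2.step σ)) (r2.legal hT _ rfl) ?_
    change Disjoint P'.qv T'.qv
    exact hd.mono (by simpa [Act.qbv] using r1.qv _ rfl) (by simpa [Act.qbv] using r2.qv _ rfl)
  | @qcomL _ P' _ T' _ c r h1 h2 =>
    have r1 := hret (by simp) h1
    have r2 := hret (by simp) h2
    refine ParBisimilar.simulate_com h (by simp) h1
      (fun Q Q' σ hQ => .qcomL hQ (r2.step σ)) (r2.legal hT _ rfl) ?_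
    refine Finset.disjoint_of_subset_left (r1.qv _ rfl) ?_
    rw [Finset.disjoint_union_left]
    exact ⟨hd.mono_right (by simpa [Act.qbv] using r2.qv _ rfl),
      Finset.disjoint_singleton_left.2 (r2.out_notMem hT c r rfl _ rfl)⟩
  | @qcomR _ P' _ T' _ c r h1 h2 =>
    have r1 := hret (by simp) h1
    have r2 := hret (by simp) h2
    refine ParBisimilar.simulate_com h (by simp) h1
      (fun Q Q' σ hQ => .qcomR hQ (r2.step σ)) (r2.legal hT _ rfl) ?_
    change Disjoint P'.qv T'.qv
    refine Finset.disjoint_of_subset_right (r2.qv _ rfl) ?_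
    rw [Finset.disjoint_union_right]
    exact ⟨hd.mono_left (by simpa [Act.qbv] using r1.qv _ rfl),
      Finset.disjoint_singleton_right.2 (r1.out_notMem h.legal c r rfl _ rfl)⟩
  | intL h1 hα =>
    obtain ⟨Θ, hw, hl⟩ := h.simulate h1
    have hw' := hw.par hα
    rw [PMF.pure_map] at hw'
    refine ⟨_, hw', hl.par hT fun s hs => ?_⟩
    exact Finset.disjoint_of_subset_left (h1.qv_subset hs)
      (Finset.disjoint_union_left.2 ⟨hd, hα⟩)
  | intR h1 hα =>
    obtain ⟨e, rfl, he⟩ := h1.exists_effect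
    have hqv : P.qv = C'.proc.qv := h.sameEnv.1
    -- `T` makes the same move next to `C'`; a variable it receives is fresh there too, as `C` and
    -- `C'` have the same free variables.
    refine ⟨_, Step.weak (.intR (he.step C'.state) (hqv ▸ hα)),
      ParBisimilar.of_effect h e (fun T' hT' => ⟨he.legal hT T' hT', ?_⟩)
        (hd.symm.mono_left he.qubits)⟩
    exact Finset.disjoint_of_subset_right (he.qv T' hT')
      (Finset.disjoint_union_right.2 ⟨hd, hα.symm⟩)

theorem exists_extend_of_eq_union {U V W : Finset QVar} (hU : U = V ∪ W) (E : SuperOp (Env U)) :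
    ∃ F : SuperOp (Env V), ∀ ρ : QState,
      F.extend (splitEquiv V) ρ = E.extend (splitEquiv U) ρ := by
  subst hU
  exact exists_extend_union V W E

/-- A super-operator outside `qv(C ‖ T)` also acts outside `qv(C)`, so it can be applied to the
components `C` and `C'` before putting them in parallel with `T`. -/
theorem ParBisimilar.openBisimilar {A B : Config S} (h : ParBisimilar D A B) :
    OpenBisimilar D A B := by
  refine ⟨ParBisimilar D, .of_symmetric ?_ ?_ ?_, h⟩
  · rintro _ _ ⟨C, C', T, h, hT, hd, rfl, rfl⟩
    exact ⟨C', C, T, h.symm, hT, h.sameEnv.1 ▸ hd, rfl, rfl⟩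
  · rintro _ _ ⟨C, C', T, h, hT, hd, rfl, rfl⟩
    exact Proc.legal_par.2 ⟨hd, h.legal, hT⟩
  · rintro _ _ ⟨C, C', T, h, hT, hd, rfl, rfl⟩
    have hqv : ∀ C : Config S, (C.par T).qv = C.qv ∪ T.qv := fun C => Proc.qv_par _ _
    refine ⟨⟨?_, ?_⟩, fun E α Δ hs => ?_⟩
    · rw [hqv, hqv, h.sameEnv.1]
    · rw [hqv]
      exact ptr_union hd h.sameEnv.2
    · obtain ⟨F, hF⟩ := exists_extend_of_eq_union (hqv C) E
      have key : ∀ B : Config S, (B.par T).applyOutside (C.par T).qv E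
          = (B.applyOutside C.qv F).par T := fun B => by
        change (⟨_, _⟩ : Config S) = ⟨_, F.extend (splitEquiv C.qv) B.state⟩
        rw [hF]
        rfl
      rw [key] at hs ⊢
      exact ParBisimilar.simulate (h.applyOutside F) hT hd hs

end Parallel

/-! ## Open bisimilarity is a reduction barbed congruence -/

section Soundness

variable {S : Sig} {D : Program S}

theorem OpenBisimilar.simulate_weakTau {Δ Δ' Θ : PMF (Config S)}
    (h : LiftState (OpenBisimilar D) Δ Θ) (hw : WeakTau D Δ Δ') :
    ∃ Θ', WeakTau D Θ Θ' ∧ LiftState (OpenBisimilar D) Δ' Θ' := by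
  induction hw with
  | refl => exact ⟨Θ, .refl, h⟩
  | tail _ hs ih =>
    obtain ⟨Θ₁, h1, h2⟩ := ih
    obtain ⟨Θ₂, h3, h4⟩ := h2.simulate (H := HatTau D) (W := WeakTau D) WeakTau.bind
      (fun s t hst Ψ hΨ => by
        rcases hΨ with hΨ | rfl
        · exact hst.simulate hΨ
        · exact ⟨_, .refl, .point ⟨t, hst, rfl⟩⟩) hs
    exact ⟨Θ₂, h1.trans h3, h4⟩

theorem OpenBisimilar.reductionClosed {C C' : Config S} (h : OpenBisimilar D C C')
    {Δ : PMF (Config S)} (hw : WeakTau D (PMF.pure C) Δ) :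
    ∃ Θ, WeakTau D (PMF.pure C') Θ ∧ LiftState (OpenBisimilar D) Δ Θ :=
  simulate_weakTau (.point ⟨C', h, rfl⟩) hw

/-! ### Preservation of barbs. -/

open Classical in
theorem barbValue_eq_expect (c : S.CChan) (Δ : PMF (Config S)) : barbValue D c Δ
    = expect Δ fun C => if ∃ v Θ, Step D C (.cout c v) Θ then 1 else 0 := by
  refine tsum_congr fun C => ?_
  rw [mul_ite, mul_one, mul_zero]

/-- The weak answer to an output passes through a distribution all of whose states perform that
output; it is reached by τ-steps alone. -/
theorem OpenBisimilar.exists_barb {s t : Config S} (h : OpenBisimilar D s t) {c : S.CChan}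
    (hs : ∃ v Θ, Step D s (.cout c v) Θ) :
    ∃ Θ, WeakTau D (PMF.pure t) Θ ∧ ∀ t' ∈ Θ.support, ∃ v Θ, Step D t' (.cout c v) Θ := by
  obtain ⟨v, Δ, hs⟩ := hs
  obtain ⟨Θ, ⟨Δ₁, Δ₂, w1, hl, _⟩, _⟩ := h.simulate hs
  refine ⟨Δ₁, w1, fun t' ht' => ?_⟩
  obtain ⟨ω, _, h2, rfl, _⟩ := hl.exists_coupling
  obtain ⟨x, hx, rfl⟩ := (PMF.mem_support_map_iff _ _ _).1 ht'
  exact ⟨v, _, h2 x hx⟩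

/-- The matching distribution of `C'` need not show the barb yet. Each of its states paired with a
state ready for output moves on until all its branches are ready, and the others stay put, so the
probability of the barb does not decrease. -/
theorem OpenBisimilar.barb {C C' : Config S} (h : OpenBisimilar D C C') {c : S.CChan} {p : ENNReal}
    (hb : Barb D C c p) : Barb D C' c p := by
  classical
  obtain ⟨Δ, hw, hp⟩ := hb
  obtain ⟨Θ, hw', hl⟩ := h.reductionClosed hw
  obtain ⟨ω, hf, hR, rfl, rfl⟩ := hl.exists_coupling
  have : ∀ x : Config S × Config S, ∃ Ψ, x ∈ ω.support → WeakTau D (PMF.pure x.2) Ψ ∧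
      ((∃ v Θ, Step D x.1 (.cout c v) Θ) → ∀ t ∈ Ψ.support, ∃ v Θ, Step D t (.cout c v) Θ) := by
    intro x
    by_cases hx : x ∈ ω.support ∧ ∃ v Θ, Step D x.1 (.cout c v) Θ
    · obtain ⟨Ψ, h1, h2⟩ := (hR x hx.1).exists_barb hx.2
      exact ⟨Ψ, fun _ => ⟨h1, fun _ => h2⟩⟩
    · exact ⟨PMF.pure x.2, fun hx' => ⟨.refl, fun hb => absurd ⟨hx', hb⟩ hx⟩⟩
  choose k hk using this
  refine ⟨ω.bind k, hw'.trans (WeakTau.bind ω (fun x => PMF.pure x.2) k hf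
    (fun _ _ => finite_support_pure _) fun x hx => (hk x hx).1), hp.trans ?_⟩
  rw [barbValue_eq_expect, barbValue_eq_expect, expect_map, expect_bind]
  refine expect_mono fun x hx => ?_
  by_cases hb : ∃ v Θ, Step D x.1 (.cout c v) Θ
  · simp only [Function.comp_apply, if_pos hb]
    refine (expect_const (k x) 1).symm.le.trans (expect_mono fun t ht => ?_)
    rw [if_pos ((hk x hx).2 hb t ht)]
  · simp only [Function.comp_apply, if_neg hb, zero_le]

theorem isReductionBarbed_openBisimilar (D : Program S) :
    IsReductionBarbed D (OpenBisimilar D) := by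
  refine ⟨(isGreatest_openBisimilar D).1.1, fun C C' h c p => ⟨h.barb, h.symm.barb⟩,
    fun C C' h => ⟨fun Δ hΔ => h.reductionClosed hΔ, fun Θ hΘ => ?_⟩,
    ⟨fun C C' h T hT hd => ?_, fun C C' h E => h.applyOutside E⟩, fun C C' h => h.sameEnv⟩
  · obtain ⟨Δ, h1, h2⟩ := h.symm.reductionClosed hΘ
    exact ⟨Δ, h1, h2.symm.mono fun s t hst => hst.symm⟩
  · exact ParBisimilar.openBisimilar ⟨C, C', T, h, hT,
      (Finset.disjoint_union_right.1 hd).1.symm, rfl, rfl⟩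

end Soundness

end QCCS

end

theorem mainTheorem2 (S : QCCS.Sig) (D : QCCS.Program S) (C C' : QCCS.Config S)
    (h : QCCS.OpenBisimilar D C C') : QCCS.ReductionBarbedCongruent D C C' :=
  ⟨_, QCCS.isReductionBarbed_openBisimilar D, h⟩
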